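/- **Setting.** Let $\mathcal X\subset\mathbb R^n$ be convex and compact, $\mathcal K\subset\mathbb R^m$ a closed convex pointed cone with nonempty interior, $A\in\mathbb R^{p\times n}$ with $\operatorname{rank}A=p<n$, $b\in\mathbb R^p$, $f:\mathbb R^n\to\mathbb R$ convex on $\mathcal X$ with modulus $\mu\ge 0$, and $g:\mathbb R^n\to\mathbb R^m$ $\mathcal K$-convex on $\mathcal X$; $f,g$ are $C^1$ on an open set containing $\mathcal X$, with $\nabla f,\nabla g$ Lipschitz on $\mathcal X$. Consider $\min\{f(x): x\in\mathcal X,\ Ax=b,\ g(x)\in-\mathcal K\}$. For $y=(v,\lambda)$ put $\Phi(x,y)=f(x)+\langle v,Ax-b\rangle+\langle\lambda,g(x)\rangle$ and $\mathcal Y=\mathbb R^p\times\mathcal K^*$. For $B\in(0,\infty]$ put $\hat{\mathcal Y}=\mathcal Y\cap\{\|y\|\le B\}$, $\hat{\mathcal Z}=\mathcal X\times\hat{\mathcal Y}$, and let $\hat{\mathcal Z}^\star$ be the set of saddle points of $\min_{x\in\mathcal X}\max_{y\in\hat{\mathcal Y}}\Phi(x,y)$; for $B=\infty$ write $\mathcal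 Z,\mathcal Z^\star$. Assume $\mathcal Z^\star\neq\emptyset$. All norms are Euclidean (spectral for matrices). Let $\varphi_p,\varphi_d$ be $1$-strongly convex on $\mathcal X$, $\mathcal Y$, differentiable there, with $L_\varphi$-Lipschitz gradients ($L_\varphi>0$), and let $\mathbf D_p,\mathbf D_d$ be their Bregman distances; if $\mu>0$, take $\varphi_p=\frac12\|\cdot\|^2$. Fix $\xi>0$. On $\hat{\mathcal Z}$ the smoothed duality gap is $\mathcal G_\xi(z)=\sup_{(x',y')\in\hat{\mathcal Z}}\{\Phi(x,y')-\Phi(x',y)-2\xi\mathbf D_p(x',x)-2\xi\mathbf D_d(y',y)\}$. A number $\rho>0$ is a *quadratic growth constant* on $S\subseteq\hat{\mathcal Z}$ if $\operatorname{dist}^2(z,\hat{\mathcal Z}^\star)\le\rho\,\mathcal G_\xi(z)$ for all $z\in S$. *Metric subregularity* means: with $\hat{\mathcal L}=\iota_{\mathcal X}+\Phi-\iota_{\hat{\mathcal Y}}$ and $\mathcal F(z)=\partial_x\hat{\mathcal L}(z)\times\partial_y(-\hat{\mathcal L})(z)$, for every $z^\star\in\hat{\mathcal Z}^\star$ there are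 $\varepsilon,\rho'>0$ with $\operatorname{dist}(z,\hat{\mathcal Z}^\star)\le\rho'\operatorname{dist}(0,\mathcal F(z))$ for all $z\in\hat{\mathcal Z}$ with $\|z-z^\star\|<\varepsilon$. **Algorithms.** Parameters: $\eta\in(0,1)$, $\bar\tau,\gamma_0>0$, $c_{\rm nm}\in\{0,1\}$, $c_\alpha,c_\beta,\delta$. APDB from $z^0$, for $K$ iterations: set $z^{-1}=z^0$, $\tau_{-1}=\bar\tau$, $\sigma_{-1}=\gamma_0\bar\tau$. In iteration $k$, try step sizes $\tau_k=\tau_k^\circ,\eta\tau_k^\circ,\eta^2\tau_k^\circ,\dots$ in order until the test below holds, where $\tau_0^\circ=\bar\tau$; with the accepted $\tau_k$ put $\gamma_{k+1}=\gamma_k(1+\mu\tau_k)$ and $\tau_{k+1}^\circ=\tau_k\sqrt{\tfrac{\gamma_k}{\gamma_{k+1}}(1+c_{\rm nm}\tfrac{\tau_k}{\tau_{k-1}})}$. For a trial $\tau_k$ put $\sigma_k=\gamma_k\tau_k$, $\theta_k=\sigma_{k-1}/\sigma_k$. The test is $E_k\le-\frac{\delta}{\tau_k}\mathbf D_p(x^{k+1},x^k)-\frac{\delta}{\sigma_k}\mathbf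 D_d(y^{k+1},y^k)$. - *xy* ($\hat{\mathcal Y}=\mathcal Y$): $s^k=(1+\theta_k)\nabla_x\Phi(z^k)-\theta_k\nabla_x\Phi(z^{k-1})$, $x^{k+1}=\arg\min_{x\in\mathcal X}\{\langle s^k,x\rangle+\frac1{\tau_k}\mathbf D_p(x,x^k)\}$, $y^{k+1}=\arg\min_{y\in\mathcal Y}\{-\langle\nabla_y\Phi(x^{k+1},y^k),y\rangle+\frac1{\sigma_k}\mathbf D_d(y,y^k)\}$; with $\alpha_{k+1}=c_\alpha/\tau_k$, $\beta_{k+1}=\gamma_0c_\beta/\sigma_k$ for $k\ge-1$, $$E_k=\tfrac{1}{2\alpha_{k+1}}\|\nabla_x\Phi(x^{k+1},y^{k+1})-\nabla_x\Phi(x^{k+1},y^k)\|^2-\tfrac1{\sigma_k}\mathbf D_d(y^{k+1},y^k)+\tfrac1{2\beta_{k+1}}\|\nabla_x\Phi(x^{k+1},y^k)-\nabla_x\Phi(x^k,y^k)\|^2-\big(\tfrac1{\tau_k}-\theta_k(\alpha_k+\beta_k)\big)\mathbf D_p(x^{k+1},x^k).$$ - *yx*: $s^k=(1+\theta_k)\nabla_y\Phi(z^k)-\theta_k\nabla_y\Phi(z^{k-1})$,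 $y^{k+1}=\arg\min_{y\in\hat{\mathcal Y}}\{-\langle s^k,y\rangle+\frac1{\sigma_k}\mathbf D_d(y,y^k)\}$, $x^{k+1}=\arg\min_{x\in\mathcal X}\{\langle\nabla_x\Phi(x^k,y^{k+1}),x\rangle+\frac1{\tau_k}\mathbf D_p(x,x^k)\}$; with $\alpha_{k+1}=c_\alpha/\sigma_k$ for $k\ge-1$, $$E_k=\Phi(x^{k+1},y^{k+1})-\Phi(x^k,y^{k+1})-\langle\nabla_x\Phi(x^k,y^{k+1}),x^{k+1}-x^k\rangle-\tfrac1{\tau_k}\mathbf D_p(x^{k+1},x^k)+\tfrac1{2\alpha_{k+1}}\|\nabla_y\Phi(x^{k+1},y^{k+1})-\nabla_y\Phi(x^k,y^{k+1})\|^2-\big(\tfrac1{\sigma_k}-\theta_k\alpha_k\big)\mathbf D_d(y^{k+1},y^k).$$ The output is $\bar z^K=\sum_{k<K}t_kz^{k+1}/\sum_{k<K}t_k$, $t_k=\sigma_k/\sigma_0$. The restarted method rAPDB with period $\hat K\in\mathbb N$ sets $z^{t+1,0}$ to be the output of APDB run for $\hat K$ iterations from $z^{t,0}$, starting with a given $z^{0,0}\in\hat{\mathcal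 Z}$. **Constants.** $c_2=\sqrt{\frac{L_\varphi\max\{\gamma_0,1\}}{\min\{\gamma_0(1-(c_\alpha+c_\beta)),1\}}}$, $\hat c_2=\sqrt{\frac{L_\varphi\max\{\gamma_0,1\}}{\min\{\gamma_0,1-c_\alpha\}}}$, $R=\frac{c_2+1}{1-1/e}\operatorname{dist}(z^{0,0},\mathcal Z^\star)$, $\mathcal Z_0=\{z\in\mathcal Z:\|z-z^{0,0}\|\le R\}$. For xy: let $\bar B_0=\sup_{z\in\mathcal Z_0}\inf_{(x^\star,y^\star)\in\mathcal Z^\star}\{\|y^\star\|+\sqrt{2\gamma_0\mathbf D_p(x^\star,x)+2\mathbf D_d(y^\star,y)}\}$ and $\bar{\mathcal Y}=\{y\in\mathcal Y:\|y\|\le\bar B_0\}$; let $L_{xx}>0$ be a Lipschitz constant of $\nabla_x\Phi(\cdot,y)$ on $\mathcal X$ uniformly for $y\in\bar{\mathcal Y}$ and $L_{xy}>0$ one of $\nabla_x\Phi(x,\cdot)$ on $\bar{\mathcal Y}$ uniformly for $x\in\mathcal X$; $\Psi=\min\Big\{\frac{\sqrt{c_\alpha(1-\delta)}}{L_{xy}\sqrt{\gamma_0}},\frac{\sqrt{c_\beta(1-(c_\alpha+c_\beta+\delta))}}{L_{xx}}\Big\}$.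 For yx: let $L_{xx},L_{yx}>0$ be Lipschitz constants on $\mathcal X$ of $\nabla_x\Phi(\cdot,y)$ and $\nabla_y\Phi(\cdot,y)$ uniformly for $y\in\hat{\mathcal Y}$; $\Psi=\frac{c_\alpha}{2\gamma_0}\frac{L_{xx}}{L_{yx}^2}\Big(-1+\sqrt{1+\frac{4(1-\delta)\gamma_0}{c_\alpha}\frac{L_{yx}^2}{L_{xx}^2}}\Big)$. In both cases $L_{xx}\ge\mu$ (automatic if $\mathcal X$ has two points), $\hat\tau=\min\{\bar\tau,\eta\Psi\}$, $c_1=\frac{L_\varphi}{2}\frac{\bar\tau}{\hat\tau}\frac1{\min\{\bar\tau,\gamma_0\bar\tau\}}$, and, if $\mu>0$, $c_3=\frac{6L_\varphi}{\mu}\frac1{\hat\tau^2}\frac1{\min\{1,\gamma_0\}}$. For $c,\rho>0$ say that $\hat K$ is *large enough for* $(c,\rho)$ if $\hat K\ge\max\{4e^2\rho c_1(1+c^2),\,2c_1/\xi\}$ when $\mu=0$, and $\hat K\ge\max\{2e\sqrt{\rho c_3(1+c^2)},\sqrt{2c_3/\xi},2\}$ when $\mu>0$. **Theorem.** 1. (rAPDB-xy.)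 Let $B=\infty$, $c_\alpha,c_\beta>0$, $\delta\ge0$, $c_\alpha+c_\beta+\delta<1$, and assume metric subregularity. Then a quadratic growth constant on $\mathcal Z_0$ exists, and for every such constant $\rho$ and every $\hat K$ large enough for $(c_2,\rho)$: the method is well defined from $z^{0,0}\in\mathcal Z$, and its restart points satisfy, for all $t\ge0$, $\|z^{t,0}-z^{0,0}\|\le R$ and $\operatorname{dist}(z^{t,0},\mathcal Z^\star)\le e^{-t}\operatorname{dist}(z^{0,0},\mathcal Z^\star)$; moreover $z^{t,0}$ converges to some point of $\mathcal Z^\star$. 2. (rAPDB-yx.) Let $c_\beta=0$, $0<c_\alpha<1$, $\delta\ge0$, $c_\alpha+\delta\le1$. Assume that some dual optimal solution $y^\star$ has $\|y^\star\|\le\bar B$ for a known $\bar B>0$, let $\bar B<B<\infty$, and assume metric subregularity for this $B$. Then a quadratic growth constant on $\hat{\mathcal Z}$ exists, and for every such constant $\hat\rho$ and every $\hat K$ large enough for $(\hat c_2,\hat\rho)$: the method is well defined from $z^{0,0}\in\hat{\mathcal Z}$, and its restart points satisfy $\operatorname{dist}(z^{t,0},\hat{\mathcal Z}^\star)\le e^{-t}\operatorname{dist}(z^{0,0},\hat{\mathcal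 Z}^\star)$ for all $t\ge0$ and converge to some point of $\hat{\mathcal Z}^\star$. -/

import Mathlib

open Set Filter Topology
open scoped RealInnerProductSpace

noncomputable section

namespace RAPDB

/-- Primal space `ℝⁿ` with the Euclidean norm. -/
abbrev Vec (n : ℕ) := EuclideanSpace ℝ (Fin n)

/-- Dual space `ℝᵖ × ℝᵐ` with the Euclidean norm; a point is `y = (v, λ)`. -/
abbrev DualVec (p m : ℕ) := WithLp 2 (Vec p × Vec m)

/-- Primal-dual space `ℝⁿ × (ℝᵖ × ℝᵐ)` with the Euclidean norm; a point is `z = (x, y)`. -/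
abbrev PDVec (n p m : ℕ) := WithLp 2 (Vec n × DualVec p m)

/-! ### The conic program and its minimax reformulation -/

/-- Data of the problem `min {f x : x ∈ X, A x = b, g x ∈ -K}`.  `K` is a closed convex cone. -/
structure ConicProgram (n p m : ℕ) where
  X : Set (Vec n)
  K : ProperCone ℝ (Vec m)
  A : Matrix (Fin p) (Fin n) ℝ
  b : Vec p
  f : Vec n → ℝ
  g : Vec n → Vec m

variable {n p m : ℕ}

/-- Assumptions on the sets: `X` is convex and compact, `K` is pointed (it contains no line) with
nonempty interior, and `A` has full row rank `p < n`. -/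
structure ConicProgram.SetAssumptions (P : ConicProgram n p m) : Prop where
  convex_X : Convex ℝ P.X
  compact_X : IsCompact P.X
  pointed_K : ∀ k ∈ P.K, -k ∈ P.K → k = 0
  interior_K : (interior (P.K : Set (Vec m))).Nonempty
  rank_A : P.A.rank = p
  p_lt_n : p < n

/-- Assumptions on the functions: `f` is convex on `X` with modulus `μ`, `g` is `K`-convex on `X`,
both are continuously differentiable on an open set containing `X`, and their derivatives are
Lipschitz on `X`. -/
structure ConicProgram.FunAssumptions (P : ConicProgram n p m) (μ : ℝ) : Prop where
  mu_nonneg : 0 ≤ μ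
  convex_f : StrongConvexOn P.X μ P.f
  convex_g : ∀ x ∈ P.X, ∀ x' ∈ P.X, ∀ a c : ℝ, 0 ≤ a → 0 ≤ c → a + c = 1 →
    a • P.g x + c • P.g x' - P.g (a • x + c • x') ∈ P.K
  smooth : ∃ U : Set (Vec n), IsOpen U ∧ P.X ⊆ U ∧ ContDiffOn ℝ 1 P.f U ∧ ContDiffOn ℝ 1 P.g U
  lipschitz_f : ∃ Lf : ℝ, 0 ≤ Lf ∧ ∀ x ∈ P.X, ∀ x' ∈ P.X,
    ‖gradient P.f x' - gradient P.f x‖ ≤ Lf * ‖x' - x‖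
  lipschitz_g : ∃ Lg : ℝ, 0 ≤ Lg ∧ ∀ x ∈ P.X, ∀ x' ∈ P.X,
    ‖fderiv ℝ P.g x' - fderiv ℝ P.g x‖ ≤ Lg * ‖x' - x‖

/-- The dual domain `Y = ℝᵖ × K*`. -/
def ConicProgram.Y (P : ConicProgram n p m) : Set (DualVec p m) :=
  {y | y.snd ∈ ProperCone.innerDual (P.K : Set (Vec m))}

/-- The restricted dual domain `Y ∩ {y : ‖y‖ ≤ B}`. -/
def ConicProgram.YB (P : ConicProgram n p m) (B : ℝ) : Set (DualVec p m) :=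
  P.Y ∩ {y | ‖y‖ ≤ B}

/-- The coupling function `Φ(x, y) = f x + ⟨v, A x - b⟩ + ⟨λ, g x⟩`. -/
def ConicProgram.Phi (P : ConicProgram n p m) (x : Vec n) (y : DualVec p m) : ℝ :=
  P.f x + ⟪y.fst, Matrix.toEuclideanLin P.A x - P.b⟫ + ⟪y.snd, P.g x⟫

/-- The partial gradient `∇ₓ Φ(x, y)`. -/
def ConicProgram.gradX (P : ConicProgram n p m) (x : Vec n) (y : DualVec p m) : Vec n :=
  gradient (fun u => P.Phi u y) x

/-- The partial gradient `∇_y Φ(x, y)`. -/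
def ConicProgram.gradY (P : ConicProgram n p m) (x : Vec n) (y : DualVec p m) : DualVec p m :=
  gradient (fun u => P.Phi x u) y

/-- The domain `X × Yh` of the minimax problem `min_{x ∈ X} max_{y ∈ Yh} Φ(x, y)`. -/
def ConicProgram.dom (P : ConicProgram n p m) (Yh : Set (DualVec p m)) : Set (PDVec n p m) :=
  {z | z.fst ∈ P.X ∧ z.snd ∈ Yh}

/-- The saddle points of `min_{x ∈ X} max_{y ∈ Yh} Φ(x, y)`. -/
def ConicProgram.saddle (P : ConicProgram n p m) (Yh : Set (DualVec p m)) : Set (PDVec n p m) :=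
  {z | z ∈ P.dom Yh ∧ (∀ y ∈ Yh, P.Phi z.fst y ≤ P.Phi z.fst z.snd) ∧
    ∀ x ∈ P.X, P.Phi z.fst z.snd ≤ P.Phi x z.snd}

/-- The dual function `q(y) = inf_{x ∈ X} Φ(x, y)` for `y ∈ Y`. -/
def ConicProgram.dualFun (P : ConicProgram n p m) (y : DualVec p m) : ℝ :=
  sInf ((fun x => P.Phi x y) '' P.X)

/-- The set `Y*` of dual optimal solutions of the conic program. -/
def ConicProgram.dualOpt (P : ConicProgram n p m) : Set (DualVec p m) :=
  {y | y ∈ P.Y ∧ ∀ y' ∈ P.Y, P.dualFun y' ≤ P.dualFun y}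

/-! ### KKT map, metric subregularity -/

/-- The KKT map `F(z) = ∂ₓ L̂(z) × ∂_y (-L̂)(z)` at `z ∈ X × Yh`, where
`L̂(x, y) = ι_X(x) + Φ(x, y) - ι_Yh(y)` and `∂` is the convex subdifferential in the indicated
block of variables. -/
def ConicProgram.kktMap (P : ConicProgram n p m) (Yh : Set (DualVec p m)) (z : PDVec n p m) :
    Set (PDVec n p m) :=
  {d | (∀ x ∈ P.X, P.Phi z.fst z.snd + ⟪d.fst, x - z.fst⟫ ≤ P.Phi x z.snd) ∧
    ∀ y ∈ Yh, -P.Phi z.fst z.snd + ⟪d.snd, y - z.snd⟫ ≤ -P.Phi z.fst y}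

/-- Metric subregularity of the KKT map at every saddle point, with radius and constant
depending on the saddle point. -/
def ConicProgram.MetricSubregular (P : ConicProgram n p m) (Yh : Set (DualVec p m)) : Prop :=
  ∀ zs ∈ P.saddle Yh, ∃ ε > 0, ∃ ρ > 0, ∀ z ∈ P.dom Yh ∩ Metric.ball zs ε,
    Metric.infDist z (P.saddle Yh) ≤ ρ * Metric.infDist 0 (P.kktMap Yh z)

/-! ### Bregman distances, smoothed duality gap, quadratic growth -/

/-- `φ` generates a Bregman distance on `S`: differentiable at the points of `S`, `1`-strongly
convex on `S`, with `Lφ`-Lipschitz gradient on `S`. -/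
structure IsBregmanKernel {E : Type*} [NormedAddCommGroup E] [InnerProductSpace ℝ E]
    [CompleteSpace E] (S : Set E) (Lφ : ℝ) (φ : E → ℝ) : Prop where
  strongConvex : StrongConvexOn S 1 φ
  differentiable : ∀ u ∈ S, DifferentiableAt ℝ φ u
  lipschitz : ∀ u ∈ S, ∀ u' ∈ S, ‖gradient φ u - gradient φ u'‖ ≤ Lφ * ‖u - u'‖

/-- Bregman distance `D(u, ū) = φ(u) - φ(ū) - ⟨∇φ(ū), u - ū⟩`. -/
def breg {E : Type*} [NormedAddCommGroup E] [InnerProductSpace ℝ E] [CompleteSpace E]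
    (φ : E → ℝ) (u ubar : E) : ℝ :=
  φ u - φ ubar - ⟪gradient φ ubar, u - ubar⟫

/-- Self-centered smoothed duality gap
`G_ξ(z) = sup_{z' ∈ X × Yh} {Φ(x, y') - Φ(x', y) - 2 ξ (D_p(x', x) + D_d(y', y))}` for
`z ∈ X × Yh`. -/
def ConicProgram.smoothedGap (P : ConicProgram n p m) (φp : Vec n → ℝ) (φd : DualVec p m → ℝ)
    (Yh : Set (DualVec p m)) (ξ : ℝ) (z : PDVec n p m) : ℝ :=
  sSup ((fun z' : PDVec n p m => P.Phi z.fst z'.snd - P.Phi z'.fst z.snd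
    - 2 * ξ * (breg φp z'.fst z.fst + breg φd z'.snd z.snd)) '' P.dom Yh)

/-- `ρ` is a quadratic growth constant of the smoothed duality gap on the set `S`. -/
def ConicProgram.QuadGrowth (P : ConicProgram n p m) (φp : Vec n → ℝ) (φd : DualVec p m → ℝ)
    (Yh : Set (DualVec p m)) (ξ : ℝ) (S : Set (PDVec n p m)) (ρ : ℝ) : Prop :=
  ∀ z ∈ S, Metric.infDist z (P.saddle Yh) ^ 2 ≤ ρ * P.smoothedGap φp φd Yh ξ z

/-! ### The algorithms -/

/-- Parameters of APDB: the modulus `μ`, the constants `c_α, c_β, δ` of the backtracking test, the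
backtracking factor `η`, the initial step size `τ̄`, the initial ratio `γ₀`, and the switch
`c_nm ∈ {0, 1}` (`0`: monotone, `1`: non-monotone step-size search). -/
structure Params where
  μ : ℝ
  cα : ℝ
  cβ : ℝ
  δ : ℝ
  η : ℝ
  τbar : ℝ
  γ0 : ℝ
  cnm : ℝ

/-- Conditions on the parameters common to both variants. -/
structure Params.Valid (q : Params) : Prop where
  η_pos : 0 < q.η
  η_lt_one : q.η < 1
  τbar_pos : 0 < q.τbar
  γ0_pos : 0 < q.γ0
  cnm_mem : q.cnm = 0 ∨ q.cnm = 1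

/-- What iteration `k` starts from: `z = zᵏ`, `zprev = zᵏ⁻¹`, `τprev = τ_{k-1}`,
`σprev = σ_{k-1}`, `γ = γ_k`. -/
structure IterState (n p m : ℕ) where
  z : PDVec n p m
  zprev : PDVec n p m
  τprev : ℝ
  σprev : ℝ
  γ : ℝ

/-- `w` is the candidate `(x^{k+1}, y^{k+1})` of APDB-xy for the trial step size `τ`. -/
def xyTrial (P : ConicProgram n p m) (φp : Vec n → ℝ) (φd : DualVec p m → ℝ)
    (s : IterState n p m) (τ : ℝ) (w : PDVec n p m) : Prop :=
  let σ := s.γ * τ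
  let θ := s.σprev / σ
  let sk := (1 + θ) • P.gradX s.z.fst s.z.snd - θ • P.gradX s.zprev.fst s.zprev.snd
  (w.fst ∈ P.X ∧ IsMinOn (fun x => ⟪sk, x⟫ + 1 / τ * breg φp x s.z.fst) P.X w.fst) ∧
  (w.snd ∈ P.Y ∧
    IsMinOn (fun y => -⟪P.gradY w.fst s.z.snd, y⟫ + 1 / σ * breg φd y s.z.snd) P.Y w.snd)

/-- The backtracking test of APDB-xy for the candidate `w` and the trial step size `τ`.
At `k = 0` the quantities `α_0 = c_α / τ_{-1}` and `β_0 = γ₀ c_β / σ_{-1}` follow the rule used for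
all later indices. -/
def xyTest (P : ConicProgram n p m) (φp : Vec n → ℝ) (φd : DualVec p m → ℝ) (q : Params)
    (s : IterState n p m) (τ : ℝ) (w : PDVec n p m) : Prop :=
  let σ := s.γ * τ
  let θ := s.σprev / σ
  let αk := q.cα / s.τprev
  let βk := q.γ0 * q.cβ / s.σprev
  let αnext := q.cα / τ
  let βnext := q.γ0 * q.cβ / σ
  1 / (2 * αnext) * ‖P.gradX w.fst w.snd - P.gradX w.fst s.z.snd‖ ^ 2
      - 1 / σ * breg φd w.snd s.z.snd
      + 1 / (2 * βnext) * ‖P.gradX w.fst s.z.snd - P.gradX s.z.fst s.z.snd‖ ^ 2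
      - (1 / τ - θ * (αk + βk)) * breg φp w.fst s.z.fst
    ≤ -(q.δ / τ * breg φp w.fst s.z.fst) - q.δ / σ * breg φd w.snd s.z.snd

/-- `w` is the candidate `(x^{k+1}, y^{k+1})` of APDB-yx, over the dual domain `Yh`, for the trial
step size `τ`. -/
def yxTrial (P : ConicProgram n p m) (φp : Vec n → ℝ) (φd : DualVec p m → ℝ)
    (Yh : Set (DualVec p m)) (s : IterState n p m) (τ : ℝ) (w : PDVec n p m) : Prop :=
  let σ := s.γ * τ
  let θ := s.σprev / σ
  let sk := (1 + θ) • P.gradY s.z.fst s.z.snd - θ • P.gradY s.zprev.fst s.zprev.snd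
  (w.snd ∈ Yh ∧ IsMinOn (fun y => -⟪sk, y⟫ + 1 / σ * breg φd y s.z.snd) Yh w.snd) ∧
  (w.fst ∈ P.X ∧
    IsMinOn (fun x => ⟪P.gradX s.z.fst w.snd, x⟫ + 1 / τ * breg φp x s.z.fst) P.X w.fst)

/-- The backtracking test of APDB-yx for the candidate `w` and the trial step size `τ`, with
`α_k = c_α / σ_{k-1}` also for `k = 0`. -/
def yxTest (P : ConicProgram n p m) (φp : Vec n → ℝ) (φd : DualVec p m → ℝ) (q : Params)
    (s : IterState n p m) (τ : ℝ) (w : PDVec n p m) : Prop :=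
  let σ := s.γ * τ
  let θ := s.σprev / σ
  let αk := q.cα / s.σprev
  let αnext := q.cα / σ
  P.Phi w.fst w.snd - P.Phi s.z.fst w.snd - ⟪P.gradX s.z.fst w.snd, w.fst - s.z.fst⟫
      - 1 / τ * breg φp w.fst s.z.fst
      + 1 / (2 * αnext) * ‖P.gradY w.fst w.snd - P.gradY s.z.fst w.snd‖ ^ 2
      - (1 / σ - θ * αk) * breg φd w.snd s.z.snd
    ≤ -(q.δ / τ * breg φp w.fst s.z.fst) - q.δ / σ * breg φd w.snd s.z.snd

/-- The state from which iteration `k` starts, read off the iterates `zᵏ`, the accepted step sizes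
`τ_k` and the ratios `γ_k`; initially `z⁻¹ = z⁰`, `τ_{-1} = τ̄`, `σ_{-1} = γ₀ τ̄`. -/
def stateAt (q : Params) (z : ℕ → PDVec n p m) (τ γ : ℕ → ℝ) : ℕ → IterState n p m
  | 0 => ⟨z 0, z 0, q.τbar, q.γ0 * q.τbar, γ 0⟩
  | k + 1 => ⟨z (k + 1), z k, τ k, γ k * τ k, γ (k + 1)⟩

/-- The first trial step size of iteration `k`: `τ̄` for `k = 0`, and
`τ_k √(γ_k / γ_{k+1} · (1 + c_nm τ_k / τ_{k-1}))` for iteration `k + 1`. -/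
def firstTrial (q : Params) (z : ℕ → PDVec n p m) (τ γ : ℕ → ℝ) : ℕ → ℝ
  | 0 => q.τbar
  | k + 1 => τ k * √(γ k / γ (k + 1) * (1 + q.cnm * (τ k / (stateAt q z τ γ k).τprev)))

/-- `z⁰, …, zᴷ` with accepted step sizes `τ_0, …, τ_{K-1}` and ratios `γ_0, …, γ_K` is a run of
`K` iterations of an APDB method with candidate rule `trial` and backtracking test `test`,
started at `z0`.  In iteration `k` the trial step sizes `τ°, η τ°, η² τ°, …` are tried in order and
the first one whose candidate passes the test is accepted. -/
structure IsAPDB (trial test : IterState n p m → ℝ → PDVec n p m → Prop) (q : Params)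
    (z0 : PDVec n p m) (K : ℕ) (z : ℕ → PDVec n p m) (τ γ : ℕ → ℝ) : Prop where
  z_zero : z 0 = z0
  γ_zero : γ 0 = q.γ0
  γ_succ : ∀ k < K, γ (k + 1) = γ k * (1 + q.μ * τ k)
  step : ∀ k < K, ∃ j : ℕ, τ k = q.η ^ j * firstTrial q z τ γ k ∧
    trial (stateAt q z τ γ k) (τ k) (z (k + 1)) ∧ test (stateAt q z τ γ k) (τ k) (z (k + 1)) ∧
    ∀ i < j, ∀ w, trial (stateAt q z τ γ k) (q.η ^ i * firstTrial q z τ γ k) w →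
      ¬ test (stateAt q z τ γ k) (q.η ^ i * firstTrial q z τ γ k) w

/-- The weighted average `z̄ᴷ = (∑_{k<K} t_k z^{k+1}) / ∑_{k<K} t_k` with `t_k = σ_k / σ_0` and
`σ_k = γ_k τ_k`. -/
def average (K : ℕ) (z : ℕ → PDVec n p m) (τ γ : ℕ → ℝ) : PDVec n p m :=
  (∑ k ∈ Finset.range K, γ k * τ k / (γ 0 * τ 0))⁻¹ •
    ∑ k ∈ Finset.range K, (γ k * τ k / (γ 0 * τ 0)) • z (k + 1)

/-- `Z 0, Z 1, …` are the restart points `z^{0,0}, z^{1,0}, …` of the restarted method with restart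
period `K`: each is the weighted average of a run of `K` iterations started at the previous one. -/
def IsRestarted (trial test : IterState n p m → ℝ → PDVec n p m → Prop) (q : Params)
    (z0 : PDVec n p m) (K : ℕ) (Z : ℕ → PDVec n p m) : Prop :=
  Z 0 = z0 ∧ ∀ t, ∃ (z : ℕ → PDVec n p m) (τ γ : ℕ → ℝ),
    IsAPDB trial test q (Z t) K z τ γ ∧ Z (t + 1) = average K z τ γ

/-- Restart points of rAPDB-xy. -/
def IsRAPDBxy (P : ConicProgram n p m) (φp : Vec n → ℝ) (φd : DualVec p m → ℝ) (q : Params)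
    (z0 : PDVec n p m) (K : ℕ) (Z : ℕ → PDVec n p m) : Prop :=
  IsRestarted (xyTrial P φp φd) (xyTest P φp φd q) q z0 K Z

/-- Restart points of rAPDB-yx over the dual domain `Yh`. -/
def IsRAPDByx (P : ConicProgram n p m) (φp : Vec n → ℝ) (φd : DualVec p m → ℝ)
    (Yh : Set (DualVec p m)) (q : Params) (z0 : PDVec n p m) (K : ℕ) (Z : ℕ → PDVec n p m) :
    Prop :=
  IsRestarted (yxTrial P φp φd Yh) (yxTest P φp φd q) q z0 K Z

/-! ### Constants -/

/-- `L` is a Lipschitz constant of `∇ₓΦ(·, y)` over `X`, uniformly for `y ∈ S`. -/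
def ConicProgram.LipXX (P : ConicProgram n p m) (S : Set (DualVec p m)) (L : ℝ) : Prop :=
  ∀ x ∈ P.X, ∀ x' ∈ P.X, ∀ y ∈ S, ‖P.gradX x' y - P.gradX x y‖ ≤ L * ‖x' - x‖

/-- `L` is a Lipschitz constant of `∇ₓΦ(x, ·)` over `S`, uniformly for `x ∈ X`. -/
def ConicProgram.LipXY (P : ConicProgram n p m) (S : Set (DualVec p m)) (L : ℝ) : Prop :=
  ∀ x ∈ P.X, ∀ y ∈ S, ∀ y' ∈ S, ‖P.gradX x y' - P.gradX x y‖ ≤ L * ‖y' - y‖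

/-- `L` is a Lipschitz constant of `∇_yΦ(·, y)` over `X`, uniformly for `y ∈ S`. -/
def ConicProgram.LipYX (P : ConicProgram n p m) (S : Set (DualVec p m)) (L : ℝ) : Prop :=
  ∀ x ∈ P.X, ∀ x' ∈ P.X, ∀ y ∈ S, ‖P.gradY x' y - P.gradY x y‖ ≤ L * ‖x' - x‖

/-- The bound on the dual iterates of APDB-xy started at `z⁰`: the infimum over saddle points of
`‖y*‖ + √(2 γ₀ D_p(x*, x⁰) + 2 D_d(y*, y⁰))`. -/
def ConicProgram.dualBound (P : ConicProgram n p m) (φp : Vec n → ℝ) (φd : DualVec p m → ℝ)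
    (γ0 : ℝ) (z0 : PDVec n p m) : ℝ :=
  sInf ((fun zs : PDVec n p m => ‖zs.snd‖ +
    √(2 * γ0 * breg φp zs.fst z0.fst + 2 * breg φd zs.snd z0.snd)) '' P.saddle P.Y)

/-- The largest of the dual bounds over the starting points in `S`. -/
def ConicProgram.dualBoundOn (P : ConicProgram n p m) (φp : Vec n → ℝ) (φd : DualVec p m → ℝ)
    (γ0 : ℝ) (S : Set (PDVec n p m)) : ℝ :=
  sSup (P.dualBound φp φd γ0 '' S)

/-- `Ψ₁`. -/
def Psi1 (q : Params) (Lxx Lxy : ℝ) : ℝ :=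
  min (√(q.cα * (1 - q.δ)) / (Lxy * √q.γ0)) (√(q.cβ * (1 - (q.cα + q.cβ + q.δ))) / Lxx)

/-- `Ψ₂`. -/
def Psi2 (q : Params) (Lxx Lyx : ℝ) : ℝ :=
  q.cα / (2 * q.γ0) * (Lxx / Lyx ^ 2) *
    (-1 + √(1 + 4 * (1 - q.δ) * q.γ0 / q.cα * (Lyx ^ 2 / Lxx ^ 2)))

/-- The lower bound `τ̂` on the step sizes; it is `η Ψ` as soon as `η Ψ ≤ τ̄`. -/
def tauHat (q : Params) (Ψ : ℝ) : ℝ := min q.τbar (q.η * Ψ)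

/-- `c₁`, with the initial step sizes `τ₀ = τ̄` and `σ₀ = γ₀ τ̄`. -/
def c1 (q : Params) (Lφ τhat : ℝ) : ℝ :=
  Lφ / 2 * (q.τbar / τhat) * (1 / min q.τbar (q.γ0 * q.τbar))

/-- `c₂` (for rAPDB-xy). -/
def c2 (q : Params) (Lφ : ℝ) : ℝ :=
  √(Lφ * max q.γ0 1 / min (q.γ0 * (1 - (q.cα + q.cβ))) 1)

/-- `ĉ₂` (for rAPDB-yx). -/
def c2hat (q : Params) (Lφ : ℝ) : ℝ :=
  √(Lφ * max q.γ0 1 / min q.γ0 (1 - q.cα))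

/-- `c₃`. -/
def c3 (q : Params) (Lφ τhat : ℝ) : ℝ :=
  6 * Lφ / q.μ * (1 / τhat ^ 2) * (1 / min 1 q.γ0)

/-- The restart period `K` is above the threshold, which depends on whether `μ = 0` or `μ > 0`. -/
def PeriodLargeEnough (q : Params) (Lφ τhat c ξ ρ : ℝ) (K : ℕ) : Prop :=
  (q.μ = 0 →
    max (4 * Real.exp 1 ^ 2 * ρ * c1 q Lφ τhat * (1 + c ^ 2)) (2 * c1 q Lφ τhat / ξ) ≤ K) ∧
  (0 < q.μ →
    max (max (2 * Real.exp 1 * √(ρ * c3 q Lφ τhat * (1 + c ^ 2))) (√(2 * c3 q Lφ τhat / ξ))) 2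
      ≤ K)

/-- The radius `R = (c₂ + 1) / (1 - 1/e) · dist(z^{0,0}, Z*)`. -/
def ConicProgram.radius (P : ConicProgram n p m) (q : Params) (Lφ : ℝ) (z0 : PDVec n p m) : ℝ :=
  (c2 q Lφ + 1) / (1 - 1 / Real.exp 1) * Metric.infDist z0 (P.saddle P.Y)

/-- The compact set `Z₀ = {z ∈ X × Y : ‖z - z^{0,0}‖ ≤ R}`. -/
def ConicProgram.Z0 (P : ConicProgram n p m) (q : Params) (Lφ : ℝ) (z0 : PDVec n p m) :
    Set (PDVec n p m) :=
  {z | z ∈ P.dom P.Y ∧ ‖z - z0‖ ≤ P.radius q Lφ z0}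

end RAPDB

end

/-!
# Linear convergence of restarted APDB for conic programs

Both variants of the method decrease a potential `W` which starts as `γ₀ D_p + D_d` and dominates a
positive multiple of it (`IsPotential`, `isPotential_xy`, `isPotential_yx`): the decrease of `W` in
one iteration bounds the duality gap at the new iterate, weighted by `σ_k`.  Only the convexity of
`Φ(·, y)` enters this inequality, so that the growth `γ_{k+1} = γ_k (1 + μ τ_k)` of the weights
costs a remainder `(μ / 2) σ_k ‖x' - x^{k+1}‖²`.  This matters for the yx variant, whose primal
step is linearized at `x^k`, so that strong convexity yields a term in `x' - x^k` and not in
`x' - x^{k+1}`.  The remainder is recovered elsewhere: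

* at a saddle point the gap is itself at least `(μ / 2) ‖x* - x^{k+1}‖²`, so `W` decreases and the
  iterates stay within a constant multiple of their initial distance (`IsPotential.run_le`,
  `IsPotential.norm_sub_saddle_le`);
* at the weighted average, Jensen's inequality for a strongly convex function turns the sum of the
  remainders into the single term `(μ / 2) ‖x' - x̄‖²` (`IsPotential.average_gap`), and evaluating
  at the midpoint of `z'` and `z̄` removes it, since strong convexity gains the same amount there
  (`IsPotential.smoothedGap_average_le`).

Every step size up to `Ψ √(γ₀ / γ_k)` passes the test, hence `τ_k ≥ τ̂ √(γ₀ / γ_k)`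
(`IsAPDB.tauHat_le`) and the total weight grows like `K` for `μ = 0` and like `K²` for `μ > 0`
(`IsAPDB.totalWeight_ge`).  The smoothed gap at the average is then at most a small multiple of
`‖z̄ - z⁰‖²`, and quadratic growth turns this into a contraction of the distance to the saddle points
by `1 / e` (`IsPotential.period_contraction`).  Iterating gives linear convergence, and the
displacements are summable (`IsPotential.restart_converges`).

Quadratic growth follows from metric subregularity (`MetricSubregular.exists_quadGrowth`): the gap
dominates the squared displacement of the point where its supremum is attained, and the KKT
residual at that point is of the order of the displacement.

For the xy variant the Lipschitz constants are given only on a ball that contains the accepted dual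
iterates, whereas rejected candidates might leave it.  As `Y` is a cone and `∇ₓΦ` is affine in `y`,
`L_xy` is valid on all of `Y` unless the radius is zero, and in that case the run starts at a saddle
point and does not move (`xy_small_steps_pass`).
-/

namespace RAPDB

/-! ### First-order inequalities for convex and smooth functions -/

section FirstOrder

variable {E : Type*} [NormedAddCommGroup E] [InnerProductSpace ℝ E] [CompleteSpace E]
  {S : Set E} {h : E → ℝ} {g u v w : E}

theorem hasDerivAt_comp_add_smul {d : E} {t : ℝ} (hg : HasGradientAt h g (v + t • d)) :
    HasDerivAt (fun r : ℝ => h (v + r • d)) ⟪g, d⟫ t := by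
  have h1 : HasDerivAt (fun r : ℝ => v + r • d) d t := by
    simpa using ((hasDerivAt_id t).smul_const d).const_add v
  exact (hg.hasFDerivAt.comp_hasDerivAt t h1).congr_deriv (by simp)

omit [CompleteSpace E] in
theorem add_smul_sub_mem (hS : Convex ℝ S) (hv : v ∈ S) (hu : u ∈ S) {t : ℝ} (h0 : 0 ≤ t)
    (h1 : t ≤ 1) : v + t • (u - v) ∈ S := by
  have := hS hv hu (sub_nonneg.2 h1) h0 (by ring)
  convert this using 1
  module

theorem strongConvexOn_first_order {c : ℝ} (hh : StrongConvexOn S c h) (hg : HasGradientAt h g v)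
    (hv : v ∈ S) (hu : u ∈ S) : h v + ⟪g, u - v⟫ + c / 2 * ‖u - v‖ ^ 2 ≤ h u := by
  have hd : HasDerivAt (fun r : ℝ => h (v + r • (u - v))) ⟪g, u - v⟫ 0 :=
    hasDerivAt_comp_add_smul (by simpa using hg)
  have hl := (hasDerivAt_iff_tendsto_slope_zero.1 hd).mono_left
    (nhdsWithin_mono 0 (s := Ioi (0 : ℝ)) (fun x hx => ne_of_gt hx))
  have hr : Tendsto (fun t : ℝ => h u - h v - c / 2 * (1 - t) * ‖u - v‖ ^ 2) (𝓝[>] 0)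
      (𝓝 (h u - h v - c / 2 * (1 - 0) * ‖u - v‖ ^ 2)) :=
    (Continuous.tendsto (by fun_prop) 0).mono_left nhdsWithin_le_nhds
  have key := le_of_tendsto_of_tendsto hl hr ?_
  · linarith
  filter_upwards [Ioo_mem_nhdsGT (zero_lt_one' ℝ)] with t ht
  have h1 := hh.2 hv hu (sub_nonneg.2 ht.2.le) ht.1.le (by ring)
  have e1 : (1 - t) • v + t • u = v + t • (u - v) := by module
  rw [e1] at h1
  simp only [zero_add, zero_smul, add_zero, smul_eq_mul] at h1 ⊢
  rw [inv_mul_le_iff₀ ht.1, norm_sub_rev u v]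
  linarith

theorem descent_lemma {L : ℝ} (hS : Convex ℝ S) (hd : ∀ u ∈ S, DifferentiableAt ℝ h u)
    (hL : ∀ u ∈ S, ∀ v ∈ S, ‖gradient h u - gradient h v‖ ≤ L * ‖u - v‖)
    (hv : v ∈ S) (hu : u ∈ S) :
    h u - h v - ⟪gradient h v, u - v⟫ ≤ L / 2 * ‖u - v‖ ^ 2 := by
  set d := u - v with hd'
  let ψ : ℝ → ℝ := fun t => h (v + t • d) - t * ⟪gradient h v, d⟫ - L / 2 * t ^ 2 * ‖d‖ ^ 2
  have hψ : ∀ t ∈ Icc (0 : ℝ) 1, HasDerivAt ψ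
      (⟪gradient h (v + t • d), d⟫ - ⟪gradient h v, d⟫ - L * t * ‖d‖ ^ 2) t := by
    intro t ht
    have h1 : HasDerivAt (fun r : ℝ => h (v + r • d)) ⟪gradient h (v + t • d), d⟫ t :=
      hasDerivAt_comp_add_smul (hd _ (add_smul_sub_mem hS hv hu ht.1 ht.2)).hasGradientAt
    have h2 : HasDerivAt (fun r : ℝ => r * ⟪gradient h v, d⟫) ⟪gradient h v, d⟫ t := by
      simpa using (hasDerivAt_id t).mul_const ⟪gradient h v, d⟫
    have h3 : HasDerivAt (fun r : ℝ => L / 2 * r ^ 2 * ‖d‖ ^ 2) (L * t * ‖d‖ ^ 2) t := by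
      have := (((hasDerivAt_id t).pow 2).const_mul (L / 2)).mul_const (‖d‖ ^ 2)
      refine this.congr_deriv ?_
      simp only [Nat.cast_ofNat, id_eq, Nat.add_one_sub_one, pow_one, mul_one]
      ring
    exact (h1.sub h2).sub h3
  have hanti : AntitoneOn ψ (Icc 0 1) := by
    refine antitoneOn_of_deriv_nonpos (convex_Icc 0 1)
      (fun t ht => (hψ t ht).continuousAt.continuousWithinAt)
      (fun t ht => ((hψ t (interior_subset ht)).differentiableAt).differentiableWithinAt) ?_
    intro t ht
    have ht' := interior_subset ht
    rw [(hψ t ht').deriv, ← inner_sub_left]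
    have h1 := real_inner_le_norm (gradient h (v + t • d) - gradient h v) d
    have h2 := hL _ (add_smul_sub_mem hS hv hu ht'.1 ht'.2) v hv
    rw [add_sub_cancel_left, norm_smul, Real.norm_of_nonneg ht'.1] at h2
    have h3 := mul_le_mul_of_nonneg_right h2 (norm_nonneg d)
    nlinarith
  have := hanti (left_mem_Icc.2 zero_le_one) (right_mem_Icc.2 zero_le_one) zero_le_one
  simp only [ψ, one_smul, zero_smul, add_zero] at this
  rw [hd', add_sub_cancel] at this
  linarith

theorem inner_nonneg_of_isMinOn (hS : Convex ℝ S) (hmin : IsMinOn h S w)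
    (hg : HasGradientAt h g w) (hw : w ∈ S) (hu : u ∈ S) : 0 ≤ ⟪g, u - w⟫ := by
  have hd : HasDerivAt (fun r : ℝ => h (w + r • (u - w))) ⟪g, u - w⟫ 0 :=
    hasDerivAt_comp_add_smul (by simpa using hg)
  have hl := (hasDerivAt_iff_tendsto_slope_zero.1 hd).mono_left
    (nhdsWithin_mono 0 (s := Ioi (0 : ℝ)) (fun x hx => ne_of_gt hx))
  refine ge_of_tendsto hl ?_
  filter_upwards [Ioo_mem_nhdsGT (zero_lt_one' ℝ)] with t ht
  have h1 : h w ≤ h (w + t • (u - w)) := hmin (add_smul_sub_mem hS hw hu ht.1.le ht.2.le)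
  simp only [zero_add, zero_smul, add_zero, smul_eq_mul]
  exact mul_nonneg (inv_nonneg.2 ht.1.le) (sub_nonneg.2 h1)

theorem hasGradientAt_inner (s : E) : HasGradientAt (fun u => ⟪s, u⟫) s v := by
  rw [hasGradientAt_iff_hasFDerivAt]
  exact (innerSL ℝ s).hasFDerivAt

theorem _root_.HasGradientAt.add' {h₁ h₂ : E → ℝ} {g₁ g₂ : E} (H₁ : HasGradientAt h₁ g₁ v)
    (H₂ : HasGradientAt h₂ g₂ v) : HasGradientAt (fun u => h₁ u + h₂ u) (g₁ + g₂) v := by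
  rw [hasGradientAt_iff_hasFDerivAt, map_add]
  exact H₁.hasFDerivAt.add H₂.hasFDerivAt

theorem _root_.HasGradientAt.const_mul' (c : ℝ) (H : HasGradientAt h g v) :
    HasGradientAt (fun u => c * h u) (c • g) v := by
  rw [hasGradientAt_iff_hasFDerivAt]
  exact (H.hasFDerivAt.const_mul c).congr_fderiv (by ext; simp)

omit [CompleteSpace E] in
/-- Jensen's inequality for `h - c / 2 * ‖· - u‖²`, which is convex when `h` is `c`-strongly
convex. -/
theorem strongConvexOn_jensen {c : ℝ} (hh : StrongConvexOn S c h) {ι : Type*} {s : Finset ι}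
    {ω : ι → ℝ} {x : ι → E} (hω : ∀ i ∈ s, 0 ≤ ω i) (h1 : ∑ i ∈ s, ω i = 1)
    (hx : ∀ i ∈ s, x i ∈ S) (u : E) :
    h (∑ i ∈ s, ω i • x i) - c / 2 * ‖∑ i ∈ s, ω i • x i - u‖ ^ 2 ≤
      ∑ i ∈ s, ω i * (h (x i) - c / 2 * ‖x i - u‖ ^ 2) := by
  have hc : ConvexOn ℝ S fun x => h x - c / 2 * ‖x - u‖ ^ 2 := by
    have h1 := strongConvexOn_iff_convex.1 hh
    refine ⟨h1.1, ?_⟩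
    intro x hx y hy a b ha hb hab
    have h2 := h1.2 hx hy ha hb hab
    simp only [smul_eq_mul] at h2 ⊢
    have e : ∀ z : E, ‖z - u‖ ^ 2 = ‖z‖ ^ 2 - 2 * ⟪z, u⟫ + ‖u‖ ^ 2 := fun z =>
      norm_sub_sq_real z u
    rw [e, e, e, inner_add_left, real_inner_smul_left, real_inner_smul_left]
    obtain rfl : b = 1 - a := by linarith
    linarith
  have := hc.map_sum_le hω h1 hx
  simpa using this

end FirstOrder

/-! ### Bregman distances and proximal points -/

section Bregman

variable {E : Type*} [NormedAddCommGroup E] [InnerProductSpace ℝ E] [CompleteSpace E]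
  {S T : Set E} {φ : E → ℝ} {L : ℝ} {u v w : E}

theorem IsBregmanKernel.mono (h : IsBregmanKernel S L φ) (hT : Convex ℝ T) (hTS : T ⊆ S) :
    IsBregmanKernel T L φ where
  strongConvex := ⟨hT, fun _ hx _ hy => h.strongConvex.2 (hTS hx) (hTS hy)⟩
  differentiable := fun u hu => h.differentiable u (hTS hu)
  lipschitz := fun u hu v hv => h.lipschitz u (hTS hu) v (hTS hv)

theorem IsBregmanKernel.half_sq_le_breg (h : IsBregmanKernel S L φ) (hu : u ∈ S) (hv : v ∈ S) :
    1 / 2 * ‖u - v‖ ^ 2 ≤ breg φ u v := by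
  have := strongConvexOn_first_order h.strongConvex (h.differentiable v hv).hasGradientAt hv hu
  unfold breg
  linarith

theorem IsBregmanKernel.breg_nonneg (h : IsBregmanKernel S L φ) (hu : u ∈ S) (hv : v ∈ S) :
    0 ≤ breg φ u v := le_trans (by positivity) (h.half_sq_le_breg hu hv)

theorem IsBregmanKernel.breg_le (h : IsBregmanKernel S L φ) (hu : u ∈ S) (hv : v ∈ S) :
    breg φ u v ≤ L / 2 * ‖u - v‖ ^ 2 :=
  descent_lemma h.strongConvex.1 h.differentiable h.lipschitz hv hu

@[simp] theorem breg_self : breg φ u u = 0 := by simp [breg]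

theorem breg_three_point (u v w : E) :
    breg φ u v - breg φ u w - breg φ w v = ⟪gradient φ w - gradient φ v, u - w⟫ := by
  have e : u - v = (u - w) + (w - v) := by abel
  unfold breg
  rw [e, inner_add_right, inner_sub_left]
  ring

theorem IsBregmanKernel.continuousOn (h : IsBregmanKernel S L φ) : ContinuousOn φ S :=
  fun u hu => (h.differentiable u hu).continuousAt.continuousWithinAt

theorem IsBregmanKernel.continuousOn_gradient (h : IsBregmanKernel S L φ) :
    ContinuousOn (gradient φ) S := by
  have : LipschitzOnWith (Real.toNNReal L) (gradient φ) S := by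
    refine LipschitzOnWith.of_dist_le_mul fun u hu v hv => ?_
    rw [dist_eq_norm, dist_eq_norm]
    exact (h.lipschitz u hu v hv).trans
      (mul_le_mul_of_nonneg_right (Real.le_coe_toNNReal L) (norm_nonneg _))
  exact this.continuousOn

theorem IsBregmanKernel.continuousOn_breg_right (h : IsBregmanKernel S L φ) (u : E) :
    ContinuousOn (fun v => breg φ u v) S := by
  unfold breg
  exact (continuousOn_const.sub h.continuousOn).sub
    (h.continuousOn_gradient.inner (continuousOn_const.sub continuousOn_id))

theorem IsBregmanKernel.continuousOn_breg_left (h : IsBregmanKernel S L φ) (v : E) :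
    ContinuousOn (fun u => breg φ u v) S := by
  unfold breg
  exact (h.continuousOn.sub continuousOn_const).sub (by fun_prop)

theorem IsBregmanKernel.hasGradientAt_breg (h : IsBregmanKernel S L φ) (hw : w ∈ S) (v : E) :
    HasGradientAt (fun u => breg φ u v) (gradient φ w - gradient φ v) w := by
  have h1 := (h.differentiable w hw).hasGradientAt.hasFDerivAt
  have h2 := (hasGradientAt_inner (v := w) (gradient φ v)).hasFDerivAt
  rw [hasGradientAt_iff_hasFDerivAt, map_sub]
  refine ((h1.sub h2).add_const (⟪gradient φ v, v⟫ - φ v)).congr_of_eventuallyEq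
    (Eventually.of_forall fun u => ?_)
  simp only [breg, inner_sub_right, Pi.sub_apply]
  ring

theorem IsBregmanKernel.prox_optimality (h : IsBregmanKernel S L φ) {ψ : E → ℝ} {g : E} {c : ℝ}
    (hmin : IsMinOn (fun u => ψ u + c * breg φ u v) S w) (hψ : HasGradientAt ψ g w)
    (hw : w ∈ S) (hu : u ∈ S) :
    0 ≤ ⟪g, u - w⟫ + c * (breg φ u v - breg φ u w - breg φ w v) := by
  have := inner_nonneg_of_isMinOn h.strongConvex.1 hmin
    (hψ.add' ((h.hasGradientAt_breg hw v).const_mul' c)) hw hu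
  rwa [inner_add_left, real_inner_smul_left, ← breg_three_point] at this

theorem IsBregmanKernel.prox_inequality (h : IsBregmanKernel S L φ) {s : E} {c : ℝ}
    (hmin : IsMinOn (fun u => ⟪s, u⟫ + c * breg φ u v) S w) (hw : w ∈ S) (hu : u ∈ S) :
    ⟪s, w - u⟫ ≤ c * (breg φ u v - breg φ u w - breg φ w v) := by
  have := h.prox_optimality hmin (hasGradientAt_inner s) hw hu
  rw [← neg_sub u w, inner_neg_right]
  linarith

theorem IsBregmanKernel.exists_prox [ProperSpace E] (h : IsBregmanKernel S L φ) (hS : IsClosed S)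
    (hv : v ∈ S) (s : E) {c : ℝ} (hc : 0 < c) :
    ∃ w ∈ S, IsMinOn (fun u => ⟪s, u⟫ + c * breg φ u v) S w := by
  refine ContinuousOn.exists_isMinOn' ?_ hS hv ?_
  · exact (by fun_prop : Continuous fun u => ⟪s, u⟫).continuousOn.add
      (continuousOn_const.mul (h.continuousOn_breg_left v))
  · have h1 : (Metric.closedBall v (2 * ‖s‖ / c))ᶜ ∈ cocompact E :=
      (isCompact_closedBall v _).compl_mem_cocompact
    filter_upwards [mem_inf_of_left h1, mem_inf_of_right (mem_principal_self S)] with u hu huS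
    rw [mem_compl_iff, Metric.mem_closedBall, not_le, dist_eq_norm, div_lt_iff₀ hc] at hu
    have h2 := h.half_sq_le_breg huS hv
    have h3 := real_inner_le_norm s (v - u)
    rw [inner_sub_right, norm_sub_rev] at h3
    rw [breg_self]
    have h4 := mul_le_mul_of_nonneg_left h2 hc.le
    have h5 := mul_le_mul_of_nonneg_right hu.le (norm_nonneg (u - v))
    nlinarith

theorem breg_half_sq (u v : E) : breg (fun x : E => 1 / 2 * ‖x‖ ^ 2) u v = 1 / 2 * ‖u - v‖ ^ 2 := by
  have hg : HasGradientAt (fun x : E => 1 / 2 * ‖x‖ ^ 2) v v := by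
    rw [hasGradientAt_iff_hasFDerivAt]
    exact ((hasStrictFDerivAt_norm_sq v).hasFDerivAt.const_mul (1 / 2 : ℝ)).congr_fderiv
      (by ext; simp)
  rw [breg, hg.gradient, norm_sub_sq_real, inner_sub_right, real_inner_self_eq_norm_sq,
    real_inner_comm]
  ring

end Bregman

/-! ### The coupling function, its gradients and the saddle set -/

section Coupling

variable {n p m : ℕ} {P : ConicProgram n p m} {μ : ℝ} {Yh : Set (DualVec p m)}

/-- The constraint residual `(A x - b, g x)`, so that `Φ(x, y) = f x + ⟨residual x, y⟩`. -/
noncomputable def ConicProgram.residual (P : ConicProgram n p m) (x : Vec n) : DualVec p m :=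
  WithLp.toLp 2 (Matrix.toEuclideanLin P.A x - P.b, P.g x)

theorem ConicProgram.Phi_eq (P : ConicProgram n p m) (x : Vec n) (y : DualVec p m) :
    P.Phi x y = P.f x + ⟪P.residual x, y⟫ := by
  rw [WithLp.prod_inner_apply, real_inner_comm, real_inner_comm y.ofLp.2, ← add_assoc]
  rfl

theorem ConicProgram.gradY_eq (P : ConicProgram n p m) (x : Vec n) (y : DualVec p m) :
    P.gradY x y = P.residual x := by
  have h : HasGradientAt (fun u => P.Phi x u) (P.residual x) y := by
    have e : (fun u => P.Phi x u) = fun u => P.f x + ⟪P.residual x, u⟫ :=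
      funext fun u => P.Phi_eq x u
    rw [e]
    have := (hasGradientAt_inner (v := y) (P.residual x)).hasFDerivAt
    exact hasGradientAt_iff_hasFDerivAt.2 (this.const_add _)
  exact h.gradient

theorem ConicProgram.Phi_sub (P : ConicProgram n p m) (x : Vec n) (y y' : DualVec p m) :
    P.Phi x y - P.Phi x y' = ⟪P.residual x, y - y'⟫ := by
  rw [P.Phi_eq, P.Phi_eq, inner_sub_right]
  ring

theorem ConicProgram.continuous_Phi (P : ConicProgram n p m) (x : Vec n) :
    Continuous (P.Phi x) := by
  have e : P.Phi x = fun u => P.f x + ⟪P.residual x, u⟫ := funext fun u => P.Phi_eq x u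
  rw [e]
  fun_prop

theorem ConicProgram.FunAssumptions.contDiffOn_residual (hf : P.FunAssumptions μ) :
    ∃ U : Set (Vec n), IsOpen U ∧ P.X ⊆ U ∧ ContDiffOn ℝ 1 P.f U ∧ ContDiffOn ℝ 1 P.residual U := by
  obtain ⟨U, hU, hXU, h1, h2⟩ := hf.smooth
  refine ⟨U, hU, hXU, h1, ?_⟩
  have hA : ContDiff ℝ 1 fun x : Vec n => Matrix.toEuclideanLin P.A x - P.b :=
    (LinearMap.toContinuousLinearMap (Matrix.toEuclideanLin P.A)).contDiff.sub contDiff_const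
  exact (WithLp.prodContinuousLinearEquiv 2 ℝ (Vec p) (Vec m)).symm.contDiff.comp_contDiffOn
    (hA.contDiffOn.prodMk h2)

theorem ConicProgram.FunAssumptions.differentiableAt (hf : P.FunAssumptions μ) {x : Vec n}
    (hx : x ∈ P.X) : DifferentiableAt ℝ P.f x ∧ DifferentiableAt ℝ P.residual x := by
  obtain ⟨U, hU, hXU, h1, h2⟩ := hf.contDiffOn_residual
  exact ⟨(h1.differentiableOn one_ne_zero).differentiableAt (hU.mem_nhds (hXU hx)),
    (h2.differentiableOn one_ne_zero).differentiableAt (hU.mem_nhds (hXU hx))⟩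

theorem ConicProgram.FunAssumptions.hasGradientAt_Phi_aux (hf : P.FunAssumptions μ) {x : Vec n}
    (hx : x ∈ P.X) (y : DualVec p m) : HasGradientAt (fun u => P.Phi u y)
      (gradient P.f x + (fderiv ℝ P.residual x).adjoint y) x := by
  obtain ⟨h1, h2⟩ := hf.differentiableAt hx
  have e : (fun u => P.Phi u y) = fun u => P.f u + ⟪P.residual u, y⟫ :=
    funext fun u => P.Phi_eq u y
  rw [e]
  refine h1.hasGradientAt.add' ?_
  rw [hasGradientAt_iff_hasFDerivAt]
  refine (h2.hasFDerivAt.inner ℝ (hasFDerivAt_const y x)).congr_fderiv ?_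
  ext u
  simp [ContinuousLinearMap.adjoint_inner_left, real_inner_comm]

theorem ConicProgram.FunAssumptions.gradX_eq (hf : P.FunAssumptions μ) {x : Vec n}
    (hx : x ∈ P.X) (y : DualVec p m) :
    P.gradX x y = gradient P.f x + (fderiv ℝ P.residual x).adjoint y :=
  (hf.hasGradientAt_Phi_aux hx y).gradient

theorem ConicProgram.FunAssumptions.hasGradientAt_Phi (hf : P.FunAssumptions μ) {x : Vec n}
    (hx : x ∈ P.X) (y : DualVec p m) : HasGradientAt (fun u => P.Phi u y) (P.gradX x y) x :=
  hf.gradX_eq hx y ▸ hf.hasGradientAt_Phi_aux hx y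

theorem ConicProgram.FunAssumptions.gradX_sub (hf : P.FunAssumptions μ) {x : Vec n}
    (hx : x ∈ P.X) (y y' : DualVec p m) :
    P.gradX x y - P.gradX x y' = (fderiv ℝ P.residual x).adjoint (y - y') := by
  rw [hf.gradX_eq hx, hf.gradX_eq hx, map_sub]
  abel

theorem ConicProgram.FunAssumptions.continuousOn_Phi (hf : P.FunAssumptions μ) (y : DualVec p m) :
    ContinuousOn (fun x => P.Phi x y) P.X :=
  fun _ hx => (hf.hasGradientAt_Phi hx y).continuousAt.continuousWithinAt

/-- The derivative of the residual is bounded on the compact set `X`; hence `∇ₓΦ(x, ·)` and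
`∇_yΦ(·, y)` share a Lipschitz constant. -/
theorem ConicProgram.FunAssumptions.exists_lipschitz (hf : P.FunAssumptions μ)
    (hs : P.SetAssumptions) : ∃ C : ℝ, 0 ≤ C ∧
      (∀ x ∈ P.X, ∀ y y', ‖P.gradX x y - P.gradX x y'‖ ≤ C * ‖y - y'‖) ∧
      ∀ x ∈ P.X, ∀ x' ∈ P.X, ‖P.residual x - P.residual x'‖ ≤ C * ‖x - x'‖ := by
  obtain ⟨U, hU, hXU, -, h2⟩ := hf.contDiffOn_residual
  have hc : ContinuousOn (fun x => fderiv ℝ P.residual x) P.X :=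
    (h2.continuousOn_fderiv_of_isOpen hU le_rfl).mono hXU
  obtain ⟨C, hC⟩ := hs.compact_X.exists_bound_of_continuousOn hc
  refine ⟨max C 0, le_max_right _ _, fun x hx y y' => ?_, fun x hx x' hx' => ?_⟩
  · rw [hf.gradX_sub hx]
    refine ((fderiv ℝ P.residual x).adjoint.le_opNorm _).trans ?_
    rw [LinearIsometryEquiv.norm_map]
    exact mul_le_mul_of_nonneg_right ((hC x hx).trans (le_max_left _ _)) (norm_nonneg _)
  · exact hs.convex_X.norm_image_sub_le_of_norm_fderiv_le (fun u hu => (hf.differentiableAt hu).2)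
      (fun u hu => (hC u hu).trans (le_max_left _ _)) hx' hx

theorem ConicProgram.FunAssumptions.strongConvexOn_Phi (hf : P.FunAssumptions μ)
    {y : DualVec p m} (hy : y ∈ P.Y) : StrongConvexOn P.X μ fun x => P.Phi x y := by
  refine ⟨hf.convex_f.1, fun x hx x' hx' a c ha hc hac => ?_⟩
  have h1 := hf.convex_f.2 hx hx' ha hc hac
  have h2 := ProperCone.mem_innerDual.1 hy (hf.convex_g x hx x' hx' a c ha hc hac)
  rw [real_inner_comm, inner_sub_right, inner_add_right, real_inner_smul_right,
    real_inner_smul_right] at h2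
  have e : Matrix.toEuclideanLin P.A (a • x + c • x') - P.b =
      a • (Matrix.toEuclideanLin P.A x - P.b) + c • (Matrix.toEuclideanLin P.A x' - P.b) := by
    obtain rfl : c = 1 - a := by linarith
    rw [map_add, map_smul, map_smul]
    module
  simp only [ConicProgram.Phi, smul_eq_mul] at h1 ⊢
  rw [e, inner_add_right, real_inner_smul_right, real_inner_smul_right]
  linarith

theorem ConicProgram.FunAssumptions.Phi_first_order (hf : P.FunAssumptions μ) {x x' : Vec n}
    {y : DualVec p m} (hx : x ∈ P.X) (hx' : x' ∈ P.X) (hy : y ∈ P.Y) :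
    P.Phi x y + ⟪P.gradX x y, x' - x⟫ + μ / 2 * ‖x' - x‖ ^ 2 ≤ P.Phi x' y :=
  strongConvexOn_first_order (hf.strongConvexOn_Phi hy) (hf.hasGradientAt_Phi hx y) hx hx'

theorem ConicProgram.FunAssumptions.Phi_convex (hf : P.FunAssumptions μ) {x x' : Vec n}
    {y : DualVec p m} (hx : x ∈ P.X) (hx' : x' ∈ P.X) (hy : y ∈ P.Y) :
    P.Phi x y + ⟪P.gradX x y, x' - x⟫ ≤ P.Phi x' y := by
  have h1 := hf.Phi_first_order hx hx' hy
  have h2 : 0 ≤ μ / 2 * ‖x' - x‖ ^ 2 := by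
    have := hf.mu_nonneg
    positivity
  linarith

theorem ConicProgram.isClosed_Y (P : ConicProgram n p m) : IsClosed P.Y :=
  (ProperCone.innerDual (P.K : Set (Vec m))).isClosed.preimage
    (by fun_prop : Continuous fun y : DualVec p m => y.snd)

theorem ConicProgram.smul_mem_Y {y : DualVec p m} (hy : y ∈ P.Y) {t : ℝ} (ht : 0 ≤ t) :
    t • y ∈ P.Y := by
  refine ProperCone.mem_innerDual.2 fun k hk => ?_
  rw [WithLp.smul_snd, real_inner_smul_right]
  exact mul_nonneg ht (ProperCone.mem_innerDual.1 hy hk)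

theorem ConicProgram.convex_Y (P : ConicProgram n p m) : Convex ℝ P.Y := by
  intro y hy y' hy' a c ha hc _
  refine ProperCone.mem_innerDual.2 fun k hk => ?_
  rw [WithLp.add_snd, WithLp.smul_snd, WithLp.smul_snd, inner_add_right, real_inner_smul_right,
    real_inner_smul_right]
  exact add_nonneg (mul_nonneg ha (ProperCone.mem_innerDual.1 hy hk))
    (mul_nonneg hc (ProperCone.mem_innerDual.1 hy' hk))

theorem ConicProgram.YB_eq (P : ConicProgram n p m) (B : ℝ) :
    P.YB B = P.Y ∩ Metric.closedBall 0 B := by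
  ext y
  simp [ConicProgram.YB]

theorem ConicProgram.isClosed_YB (P : ConicProgram n p m) (B : ℝ) : IsClosed (P.YB B) :=
  P.YB_eq B ▸ P.isClosed_Y.inter Metric.isClosed_closedBall

theorem ConicProgram.convex_YB (P : ConicProgram n p m) (B : ℝ) : Convex ℝ (P.YB B) :=
  P.YB_eq B ▸ P.convex_Y.inter (convex_closedBall 0 B)

theorem ConicProgram.isClosed_dom (hs : P.SetAssumptions) (hY : IsClosed Yh) :
    IsClosed (P.dom Yh) :=
  (hs.compact_X.isClosed.preimage (by fun_prop : Continuous fun z : PDVec n p m => z.fst)).inter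
    (hY.preimage (by fun_prop : Continuous fun z : PDVec n p m => z.snd))

theorem norm_sq_prod (z : PDVec n p m) : ‖z‖ ^ 2 = ‖z.fst‖ ^ 2 + ‖z.snd‖ ^ 2 :=
  WithLp.prod_norm_sq_eq_of_L2 z

theorem norm_sub_sq_prod (z w : PDVec n p m) :
    ‖z - w‖ ^ 2 = ‖z.fst - w.fst‖ ^ 2 + ‖z.snd - w.snd‖ ^ 2 := by
  rw [norm_sq_prod, WithLp.sub_fst, WithLp.sub_snd]

theorem norm_fst_sub_le (z w : PDVec n p m) : ‖z.fst - w.fst‖ ≤ ‖z - w‖ :=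
  abs_le_of_sq_le_sq' (by have := norm_sub_sq_prod z w; nlinarith [sq_nonneg ‖z.snd - w.snd‖])
    (norm_nonneg _) |>.2

theorem norm_snd_sub_le (z w : PDVec n p m) : ‖z.snd - w.snd‖ ≤ ‖z - w‖ :=
  abs_le_of_sq_le_sq' (by have := norm_sub_sq_prod z w; nlinarith [sq_nonneg ‖z.fst - w.fst‖])
    (norm_nonneg _) |>.2

theorem ConicProgram.mem_saddle_iff {z : PDVec n p m} : z ∈ P.saddle Yh ↔
    z ∈ P.dom Yh ∧ ∀ z' ∈ P.dom Yh, P.Phi z.fst z'.snd ≤ P.Phi z'.fst z.snd := by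
  refine ⟨fun h => ⟨h.1, fun z' hz' => (h.2.1 _ hz'.2).trans (h.2.2 _ hz'.1)⟩,
    fun h => ⟨h.1, fun y hy => ?_, fun x hx => ?_⟩⟩
  · exact h.2 (WithLp.toLp 2 (z.fst, y)) ⟨h.1.1, hy⟩
  · exact h.2 (WithLp.toLp 2 (x, z.snd)) ⟨hx, h.1.2⟩

theorem ConicProgram.FunAssumptions.isClosed_saddle (hf : P.FunAssumptions μ)
    (hs : P.SetAssumptions) (hY : IsClosed Yh) : IsClosed (P.saddle Yh) := by
  have hdom := P.isClosed_dom hs hY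
  have e : P.saddle Yh = P.dom Yh ∩ ⋂ z' ∈ P.dom Yh,
      (P.dom Yh ∩ {z | P.Phi z.fst z'.snd - P.Phi z'.fst z.snd ≤ 0}) := by
    ext z
    rw [ConicProgram.mem_saddle_iff]
    simp only [mem_inter_iff, mem_iInter, mem_ofPred_eq, sub_nonpos]
    exact ⟨fun h => ⟨h.1, fun z' hz' => ⟨h.1, h.2 z' hz'⟩⟩,
      fun h => ⟨h.1, fun z' hz' => (h.2 z' hz').2⟩⟩
  rw [e]
  refine hdom.inter (isClosed_biInter fun z' _ => ?_)
  refine ContinuousOn.preimage_isClosed_of_isClosed (t := Iic (0 : ℝ)) ?_ hdom isClosed_Iic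
  refine ContinuousOn.sub ?_ ?_
  · exact (hf.continuousOn_Phi z'.snd).comp
      (by fun_prop : Continuous fun z : PDVec n p m => z.fst).continuousOn fun z hz => hz.1
  · exact ((P.continuous_Phi z'.fst).comp
      (by fun_prop : Continuous fun z : PDVec n p m => z.snd)).continuousOn

end Coupling

/-! ### Quadratic growth of the smoothed duality gap -/

section QuadraticGrowth

variable {n p m : ℕ} {P : ConicProgram n p m} {μ Lφ ξ : ℝ} {Yh : Set (DualVec p m)}
  {φp : Vec n → ℝ} {φd : DualVec p m → ℝ}

/-- The objective of the smoothed duality gap at `z`. -/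
noncomputable def ConicProgram.gapObj (P : ConicProgram n p m) (φp : Vec n → ℝ)
    (φd : DualVec p m → ℝ) (ξ : ℝ) (z z' : PDVec n p m) : ℝ :=
  P.Phi z.fst z'.snd - P.Phi z'.fst z.snd
    - 2 * ξ * (breg φp z'.fst z.fst + breg φd z'.snd z.snd)

/-- `w` is the proximal point at which the supremum defining the smoothed duality gap of `z` is
attained. -/
structure ConicProgram.IsGapProx (P : ConicProgram n p m) (φp : Vec n → ℝ) (φd : DualVec p m → ℝ)
    (Yh : Set (DualVec p m)) (ξ : ℝ) (z w : PDVec n p m) : Prop where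
  mem : w ∈ P.dom Yh
  fst : IsMinOn (fun x => P.Phi x z.snd + 2 * ξ * breg φp x z.fst) P.X w.fst
  snd : IsMinOn (fun y => ⟪-P.residual z.fst, y⟫ + 2 * ξ * breg φd y z.snd) Yh w.snd

theorem ConicProgram.FunAssumptions.exists_isGapProx (hf : P.FunAssumptions μ)
    (hs : P.SetAssumptions) (hφp : IsBregmanKernel P.X Lφ φp) (hφd : IsBregmanKernel Yh Lφ φd)
    (hY : IsClosed Yh) (hξ : 0 < ξ) {z : PDVec n p m} (hz : z ∈ P.dom Yh) :
    ∃ w, P.IsGapProx φp φd Yh ξ z w := by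
  obtain ⟨x, hx, hxm⟩ := hs.compact_X.exists_isMinOn ⟨_, hz.1⟩
    ((hf.continuousOn_Phi z.snd).add
      (continuousOn_const.mul (hφp.continuousOn_breg_left z.fst)) :
      ContinuousOn (fun x => P.Phi x z.snd + 2 * ξ * breg φp x z.fst) P.X)
  obtain ⟨y, hy, hym⟩ := hφd.exists_prox hY hz.2 (-P.residual z.fst) (c := 2 * ξ) (by positivity)
  exact ⟨WithLp.toLp 2 (x, y), ⟨hx, hy⟩, hxm, hym⟩

theorem ConicProgram.IsGapProx.gapObj_le {z w : PDVec n p m} (h : P.IsGapProx φp φd Yh ξ z w)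
    {z' : PDVec n p m} (hz' : z' ∈ P.dom Yh) :
    P.gapObj φp φd ξ z z' ≤ P.gapObj φp φd ξ z w := by
  have h1 : P.Phi w.fst z.snd + 2 * ξ * breg φp w.fst z.fst ≤
    P.Phi z'.fst z.snd + 2 * ξ * breg φp z'.fst z.fst := h.fst hz'.1
  have h2 : ⟪-P.residual z.fst, w.snd⟫ + 2 * ξ * breg φd w.snd z.snd ≤
    ⟪-P.residual z.fst, z'.snd⟫ + 2 * ξ * breg φd z'.snd z.snd := h.snd hz'.2
  rw [inner_neg_left, inner_neg_left] at h2
  unfold ConicProgram.gapObj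
  rw [P.Phi_eq z.fst z'.snd, P.Phi_eq z.fst w.snd]
  linarith

theorem ConicProgram.IsGapProx.gapObj_le_smoothedGap {z w : PDVec n p m}
    (h : P.IsGapProx φp φd Yh ξ z w) {z' : PDVec n p m} (hz' : z' ∈ P.dom Yh) :
    P.gapObj φp φd ξ z z' ≤ P.smoothedGap φp φd Yh ξ z :=
  le_csSup ⟨P.gapObj φp φd ξ z w, by rintro _ ⟨u, hu, rfl⟩; exact h.gapObj_le hu⟩ ⟨z', hz', rfl⟩

theorem ConicProgram.IsGapProx.optimality_fst {z w : PDVec n p m}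
    (h : P.IsGapProx φp φd Yh ξ z w) (hf : P.FunAssumptions μ)
    (hφp : IsBregmanKernel P.X Lφ φp) {x : Vec n} (hx : x ∈ P.X) :
    0 ≤ ⟪P.gradX w.fst z.snd, x - w.fst⟫ +
      2 * ξ * (breg φp x z.fst - breg φp x w.fst - breg φp w.fst z.fst) :=
  hφp.prox_optimality h.fst (hf.hasGradientAt_Phi h.mem.1 _) h.mem.1 hx

theorem ConicProgram.IsGapProx.optimality_snd {z w : PDVec n p m}
    (h : P.IsGapProx φp φd Yh ξ z w)
    (hφd : IsBregmanKernel Yh Lφ φd) {y : DualVec p m} (hy : y ∈ Yh) :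
    ⟪P.residual z.fst, y - w.snd⟫ ≤
      2 * ξ * (breg φd y z.snd - breg φd y w.snd - breg φd w.snd z.snd) := by
  have := hφd.prox_inequality h.snd h.mem.2 hy
  rwa [← neg_sub y, inner_neg_neg] at this

/-- Since the objective of the smoothed gap is strongly concave, the gap dominates the squared
displacement of the proximal point. -/
theorem ConicProgram.IsGapProx.sq_le_smoothedGap {z w : PDVec n p m}
    (h : P.IsGapProx φp φd Yh ξ z w) (hf : P.FunAssumptions μ) (hYh : Yh ⊆ P.Y) (hξ : 0 < ξ)
    (hφp : IsBregmanKernel P.X Lφ φp) (hφd : IsBregmanKernel Yh Lφ φd) (hz : z ∈ P.dom Yh) :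
    ξ * ‖w - z‖ ^ 2 ≤ P.smoothedGap φp φd Yh ξ z := by
  refine le_trans ?_ (h.gapObj_le_smoothedGap h.mem)
  have h1 := h.optimality_fst hf hφp hz.1
  have h2 := h.optimality_snd hφd hz.2
  have h3 := hf.Phi_convex h.mem.1 hz.1 (hYh hz.2)
  have h4 := P.Phi_sub z.fst z.snd w.snd
  have h5 := hφp.half_sq_le_breg hz.1 h.mem.1
  have h6 := hφd.half_sq_le_breg hz.2 h.mem.2
  rw [breg_self] at h1 h2
  unfold ConicProgram.gapObj
  rw [norm_sub_sq_prod, norm_sub_rev w.fst, norm_sub_rev w.snd]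
  nlinarith

/-- The KKT residual at the proximal point is controlled by its displacement. -/
theorem ConicProgram.IsGapProx.exists_infDist_kktMap_le (hf : P.FunAssumptions μ)
    (hs : P.SetAssumptions) (hYh : Yh ⊆ P.Y) (hξ : 0 < ξ) (hL : 0 < Lφ)
    (hφp : IsBregmanKernel P.X Lφ φp) (hφd : IsBregmanKernel Yh Lφ φd) :
    ∃ C : ℝ, 0 ≤ C ∧ ∀ z ∈ P.dom Yh, ∀ w, P.IsGapProx φp φd Yh ξ z w →
      Metric.infDist 0 (P.kktMap Yh w) ≤ C * ‖w - z‖ := by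
  obtain ⟨C, hC0, hCx, hCy⟩ := hf.exists_lipschitz hs
  refine ⟨2 * (C + 2 * ξ * Lφ), by positivity, fun z hz w h => ?_⟩
  set dx := P.gradX w.fst w.snd - P.gradX w.fst z.snd
    - (2 * ξ) • (gradient φp w.fst - gradient φp z.fst) with hdx
  set dy := P.residual z.fst - P.residual w.fst
    - (2 * ξ) • (gradient φd w.snd - gradient φd z.snd) with hdy
  have hmem : WithLp.toLp 2 (dx, dy) ∈ P.kktMap Yh w := by
    refine ⟨fun x hx => ?_, fun y hy => ?_⟩
    · have h1 := h.optimality_fst hf hφp hx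
      have h2 := hf.Phi_convex h.mem.1 hx (hYh h.mem.2)
      rw [breg_three_point] at h1
      change P.Phi w.fst w.snd + ⟪dx, x - w.fst⟫ ≤ P.Phi x w.snd
      rw [hdx, inner_sub_left, inner_sub_left, real_inner_smul_left]
      linarith
    · have h1 := h.optimality_snd hφd hy
      have h2 := P.Phi_sub w.fst y w.snd
      rw [breg_three_point] at h1
      change -P.Phi w.fst w.snd + ⟪dy, y - w.snd⟫ ≤ -P.Phi w.fst y
      rw [hdy, inner_sub_left, inner_sub_left, real_inner_smul_left]
      linarith
  have hx : ‖dx‖ ≤ (C + 2 * ξ * Lφ) * ‖w - z‖ := by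
    have h1 := norm_sub_le (P.gradX w.fst w.snd - P.gradX w.fst z.snd)
      ((2 * ξ) • (gradient φp w.fst - gradient φp z.fst))
    have h2 := hCx _ h.mem.1 w.snd z.snd
    have h3 := hφp.lipschitz _ h.mem.1 _ hz.1
    rw [norm_smul, Real.norm_of_nonneg (by positivity : 0 ≤ 2 * ξ)] at h1
    have h4 := mul_le_mul_of_nonneg_left (norm_fst_sub_le w z) (by positivity : 0 ≤ 2 * ξ * Lφ)
    have h5 := mul_le_mul_of_nonneg_left (norm_snd_sub_le w z) hC0
    have h6 := mul_le_mul_of_nonneg_left h3 (by positivity : 0 ≤ 2 * ξ)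
    linarith
  have hy : ‖dy‖ ≤ (C + 2 * ξ * Lφ) * ‖w - z‖ := by
    have h1 := norm_sub_le (P.residual z.fst - P.residual w.fst)
      ((2 * ξ) • (gradient φd w.snd - gradient φd z.snd))
    have h2 := hCy _ hz.1 _ h.mem.1
    have h3 := hφd.lipschitz _ h.mem.2 _ hz.2
    rw [norm_smul, Real.norm_of_nonneg (by positivity : 0 ≤ 2 * ξ)] at h1
    rw [norm_sub_rev z.fst] at h2
    have h4 := mul_le_mul_of_nonneg_left (norm_snd_sub_le w z) (by positivity : 0 ≤ 2 * ξ * Lφ)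
    have h5 := mul_le_mul_of_nonneg_left (norm_fst_sub_le w z) hC0
    have h6 := mul_le_mul_of_nonneg_left h3 (by positivity : 0 ≤ 2 * ξ)
    linarith
  refine (Metric.infDist_le_dist_of_mem hmem).trans ?_
  rw [dist_zero_left]
  have h0 : 0 ≤ (C + 2 * ξ * Lφ) * ‖w - z‖ := by positivity
  have h1 := norm_sq_prod (WithLp.toLp 2 (dx, dy) : PDVec n p m)
  have h2 : ‖(WithLp.toLp 2 (dx, dy) : PDVec n p m)‖ ^ 2 ≤
      (2 * (C + 2 * ξ * Lφ) * ‖w - z‖) ^ 2 := by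
    rw [h1]
    change ‖dx‖ ^ 2 + ‖dy‖ ^ 2 ≤ _
    nlinarith [norm_nonneg dx, norm_nonneg dy]
  exact abs_le_of_sq_le_sq' h2 (by linarith) |>.2

/-- A point that is its own proximal point is a saddle point. -/
theorem ConicProgram.IsGapProx.mem_saddle {z : PDVec n p m}
    (h : P.IsGapProx φp φd Yh ξ z z) (hf : P.FunAssumptions μ) (hYh : Yh ⊆ P.Y)
    (hφp : IsBregmanKernel P.X Lφ φp) (hφd : IsBregmanKernel Yh Lφ φd) : z ∈ P.saddle Yh := by
  refine ⟨h.mem, fun y hy => ?_, fun x hx => ?_⟩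
  · have h1 := h.optimality_snd hφd hy
    have h2 := P.Phi_sub z.fst y z.snd
    rw [breg_self] at h1
    linarith
  · have h1 := h.optimality_fst hf hφp hx
    have h2 := hf.Phi_convex h.mem.1 hx (hYh h.mem.2)
    rw [breg_self] at h1
    linarith

/-- Metric subregularity of the KKT map implies quadratic growth of the smoothed duality gap on
compact sets: near a saddle point, subregularity is applied at the proximal point; near any other
point the gap is bounded away from zero. -/
theorem ConicProgram.MetricSubregular.exists_quadGrowth (hms : P.MetricSubregular Yh)
    (hf : P.FunAssumptions μ) (hs : P.SetAssumptions) (hYh : Yh ⊆ P.Y) (hY : IsClosed Yh)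
    (hξ : 0 < ξ) (hL : 0 < Lφ) (hφp : IsBregmanKernel P.X Lφ φp)
    (hφd : IsBregmanKernel Yh Lφ φd) {S : Set (PDVec n p m)} (hS : IsCompact S)
    (hSd : S ⊆ P.dom Yh) : ∃ ρ > 0, P.QuadGrowth φp φd Yh ξ S ρ := by
  have hnn : ∀ z ∈ P.dom Yh, 0 ≤ P.smoothedGap φp φd Yh ξ z := fun z hz => by
    obtain ⟨w, hw⟩ := hf.exists_isGapProx hs hφp hφd hY hξ hz
    exact le_trans (by positivity) (hw.sq_le_smoothedGap hf hYh hξ hφp hφd hz)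
  suffices H : ∃ ρ > 0, P.QuadGrowth φp φd Yh ξ (S ∩ P.dom Yh) ρ by
    rwa [inter_eq_left.2 hSd] at H
  refine hS.induction_on (p := fun T => ∃ ρ > 0, P.QuadGrowth φp φd Yh ξ (T ∩ P.dom Yh) ρ)
    ⟨1, one_pos, by simp [ConicProgram.QuadGrowth]⟩ ?_ ?_ ?_
  · rintro T T' hTT' ⟨ρ, hρ, h⟩
    exact ⟨ρ, hρ, fun z hz => h z ⟨hTT' hz.1, hz.2⟩⟩
  · rintro T T' ⟨ρ, hρ, h⟩ ⟨ρ', hρ', h'⟩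
    refine ⟨max ρ ρ', lt_max_of_lt_left hρ, ?_⟩
    rintro z ⟨hz | hz, hzd⟩
    · exact (h z ⟨hz, hzd⟩).trans (mul_le_mul_of_nonneg_right (le_max_left _ _) (hnn z hzd))
    · exact (h' z ⟨hz, hzd⟩).trans (mul_le_mul_of_nonneg_right (le_max_right _ _) (hnn z hzd))
  · intro zb hzb
    by_cases hsad : zb ∈ P.saddle Yh
    · obtain ⟨ε, hε, ρ, hρ, h⟩ := hms zb hsad
      obtain ⟨C, hC0, hC⟩ := ConicProgram.IsGapProx.exists_infDist_kktMap_le hf hs hYh hξ hL hφp hφd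
      refine ⟨Metric.ball zb (ε / 2), mem_nhdsWithin_of_mem_nhds
        (Metric.ball_mem_nhds _ (half_pos hε)), (1 + ρ * C) ^ 2 / ξ, by positivity, ?_⟩
      rintro z ⟨hzball, hzd⟩
      obtain ⟨w, hw⟩ := hf.exists_isGapProx hs hφp hφd hY hξ hzd
      have hG := hw.sq_le_smoothedGap hf hYh hξ hφp hφd hzd
      have hle : Metric.infDist z (P.saddle Yh) ≤ (1 + ρ * C) * ‖w - z‖ := by
        rcases lt_or_ge ‖w - z‖ (ε / 2) with hlt | hge
        · have h1 : w ∈ Metric.ball zb ε := by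
            have := dist_triangle w z zb
            rw [Metric.mem_ball] at hzball ⊢
            rw [dist_eq_norm w z] at this
            linarith
          have h2 := h w ⟨hw.mem, h1⟩
          have h3 := mul_le_mul_of_nonneg_left (hC z hzd w hw) hρ.le
          have h4 := Metric.infDist_le_infDist_add_dist (s := P.saddle Yh) (x := z) (y := w)
          rw [dist_eq_norm, norm_sub_rev] at h4
          linarith
        · have h1 := Metric.infDist_le_dist_of_mem hsad (x := z)
          rw [Metric.mem_ball] at hzball
          have h2 : 0 ≤ ρ * C * ‖w - z‖ := by positivity
          linarith
      have hsq := pow_le_pow_left₀ Metric.infDist_nonneg hle 2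
      refine hsq.trans ?_
      rw [div_mul_eq_mul_div, le_div_iff₀ hξ, mul_pow, mul_assoc]
      exact mul_le_mul_of_nonneg_left (by linarith) (by positivity)
    · have hzbd := hSd hzb
      obtain ⟨w, hw⟩ := hf.exists_isGapProx hs hφp hφd hY hξ hzbd
      set c := P.gapObj φp φd ξ zb w with hc
      have hcpos : 0 < c := by
        have h1 : ξ * ‖w - zb‖ ^ 2 ≤ c :=
          (hw.sq_le_smoothedGap hf hYh hξ hφp hφd hzbd).trans
            (csSup_le ⟨_, zb, hzbd, rfl⟩ (by rintro _ ⟨u, hu, rfl⟩; exact hw.gapObj_le hu))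
        refine lt_of_lt_of_le ?_ h1
        have : w ≠ zb := fun e => hsad ((e ▸ hw).mem_saddle hf hYh hφp hφd)
        have := norm_pos_iff.2 (sub_ne_zero.2 this)
        positivity
      have hcont : ContinuousOn (fun z => P.gapObj φp φd ξ z w) (P.dom Yh) := by
        have c1 : ContinuousOn (fun z : PDVec n p m => z.fst) (P.dom Yh) := by fun_prop
        have c2 : ContinuousOn (fun z : PDVec n p m => z.snd) (P.dom Yh) := by fun_prop
        refine (((hf.continuousOn_Phi w.snd).comp c1 fun z hz => hz.1).sub
          ((P.continuous_Phi w.fst).comp_continuousOn c2)).sub (continuousOn_const.mul ?_)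
        exact ((hφp.continuousOn_breg_right w.fst).comp c1 fun z hz => hz.1).add
          ((hφd.continuousOn_breg_right w.snd).comp c2 fun z hz => hz.2)
      have hev : {z | c / 2 < P.gapObj φp φd ξ z w} ∈ 𝓝[P.dom Yh] zb :=
        (hcont zb hzbd).eventually (lt_mem_nhds (by linarith : c / 2 < c))
      set D := Metric.infDist zb (P.saddle Yh) with hD
      have hD0 : 0 ≤ D := Metric.infDist_nonneg
      refine ⟨{z | c / 2 < P.gapObj φp φd ξ z w} ∩ Metric.ball zb 1,
        inter_mem (nhdsWithin_mono _ hSd hev)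
        (mem_nhdsWithin_of_mem_nhds (Metric.ball_mem_nhds _ one_pos)),
        (D + 1) ^ 2 / (c / 2), by positivity, ?_⟩
      rintro z ⟨⟨hz1, hz2⟩, hzd⟩
      obtain ⟨w', hw'⟩ := hf.exists_isGapProx hs hφp hφd hY hξ hzd
      have h1 : c / 2 ≤ P.smoothedGap φp φd Yh ξ z :=
        (le_of_lt hz1).trans (hw'.gapObj_le_smoothedGap hw.mem)
      have h2 := Metric.infDist_le_infDist_add_dist (s := P.saddle Yh) (x := z) (y := zb)
      rw [Metric.mem_ball] at hz2
      have h3 := pow_le_pow_left₀ Metric.infDist_nonneg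
        (by linarith : Metric.infDist z (P.saddle Yh) ≤ D + 1) 2
      rw [div_mul_eq_mul_div, le_div_iff₀ (by positivity)]
      exact mul_le_mul h3 h1 (by positivity) (by positivity)

end QuadraticGrowth

/-! ### Potential functions for one iteration -/

section Potential

variable {n p m : ℕ}

/-- Invariants of the states met by a run of APDB over the dual domain `Yh`. -/
structure StateOK (P : ConicProgram n p m) (Yh : Set (DualVec p m)) (q : Params)
    (s : IterState n p m) : Prop where
  z_mem : s.z ∈ P.dom Yh
  zprev_mem : s.zprev ∈ P.dom Yh
  τprev_pos : 0 < s.τprev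
  σprev_pos : 0 < s.σprev
  γ0_le : q.γ0 ≤ s.γ
  σprev_le : s.σprev ≤ s.γ * s.τprev

/-- The state after the candidate `w` for the step size `τ` has been accepted in state `s`. -/
def IterState.next (q : Params) (s : IterState n p m) (τ : ℝ) (w : PDVec n p m) :
    IterState n p m :=
  ⟨w, s.z, τ, s.γ * τ, s.γ * (1 + q.μ * τ)⟩

/-- `W` is a potential for the method with candidate rule `trial` and test `test`.  It starts as
`γ₀ D_p + D_d`, dominates `κp D_p + κd D_d`, and its decrease in an accepted step bounds the
duality gap at the new point, weighted by `σ = γ τ`, up to `(μ / 2) σ ‖x' - x⁺‖²`.  This last term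
is what remains of the growth `γ⁺ = γ (1 + μ τ)` when only the convexity of `Φ(·, y)` is used. -/
structure IsPotential (P : ConicProgram n p m) (φp : Vec n → ℝ) (φd : DualVec p m → ℝ)
    (Yh : Set (DualVec p m)) (q : Params) (κp κd : ℝ)
    (trial test : IterState n p m → ℝ → PDVec n p m → Prop)
    (W : IterState n p m → PDVec n p m → ℝ) : Prop where
  trial_mem : ∀ {s τ w}, trial s τ w → w ∈ P.dom Yh
  exists_trial : ∀ {s τ}, StateOK P Yh q s → 0 < τ → ∃ w, trial s τ w
  init : ∀ z z', W ⟨z, z, q.τbar, q.γ0 * q.τbar, q.γ0⟩ z' =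
    q.γ0 * breg φp z'.fst z.fst + breg φd z'.snd z.snd
  lower : ∀ {s z'}, StateOK P Yh q s → z' ∈ P.dom Yh →
    κp * breg φp z'.fst s.z.fst + κd * breg φd z'.snd s.z.snd ≤ W s z'
  step : ∀ {s τ w z'}, StateOK P Yh q s → 0 < τ → trial s τ w → test s τ w → z' ∈ P.dom Yh →
    s.γ * τ * (P.Phi w.fst z'.snd - P.Phi z'.fst w.snd) ≤
      W s z' - W (s.next q τ w) z' + q.μ / 2 * (s.γ * τ) * ‖z'.fst - w.fst‖ ^ 2

theorem neg_inner_le_young {E : Type*} [NormedAddCommGroup E] [InnerProductSpace ℝ E] (a d : E)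
    {α : ℝ} (hα : 0 < α) : -⟪a, d⟫ ≤ 1 / (2 * α) * ‖a‖ ^ 2 + α / 2 * ‖d‖ ^ 2 := by
  have h1 := neg_le_of_abs_le (abs_real_inner_le_norm a d)
  have h2 : 1 / (2 * α) * ‖a‖ ^ 2 + α / 2 * ‖d‖ ^ 2 - ‖a‖ * ‖d‖ =
      1 / (2 * α) * (‖a‖ - α * ‖d‖) ^ 2 := by
    field_simp
    ring
  have h3 : 0 ≤ 1 / (2 * α) * (‖a‖ - α * ‖d‖) ^ 2 := by positivity
  linarith

theorem mul_le_of_le_step {γ τ σ σ' G a b u u' : ℝ} (hγ : 0 < γ) (hτ : 0 < τ) (hσ : σ = γ * τ)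
    (h : G ≤ 1 / τ * a + 1 / σ * b + σ' / σ * u - u') :
    σ * G ≤ γ * a + b + σ' * u - σ * u' := by
  subst hσ
  refine (mul_le_mul_of_nonneg_left h (by positivity)).trans_eq ?_
  field_simp

variable {P : ConicProgram n p m} {q : Params} {φp : Vec n → ℝ} {φd : DualVec p m → ℝ}
  {Lφ : ℝ} {Yh : Set (DualVec p m)}

theorem mu_mul_breg (hμ : 0 ≤ q.μ) (hφμ : 0 < q.μ → φp = fun x => 1 / 2 * ‖x‖ ^ 2) (u v : Vec n) :
    q.μ * breg φp u v = q.μ / 2 * ‖u - v‖ ^ 2 := by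
  rcases hμ.eq_or_lt with h | h
  · rw [← h]; ring
  · rw [hφμ h, breg_half_sq]; ring

theorem exists_prox_fst (hs : P.SetAssumptions) (hφp : IsBregmanKernel P.X Lφ φp) {v : Vec n}
    (hv : v ∈ P.X) (s : Vec n) {τ : ℝ} (hτ : 0 < τ) :
    ∃ w ∈ P.X, IsMinOn (fun x => ⟪s, x⟫ + 1 / τ * breg φp x v) P.X w :=
  hφp.exists_prox hs.compact_X.isClosed hv s (by positivity)

theorem exists_prox_snd (hY : IsClosed Yh) (hφd : IsBregmanKernel Yh Lφ φd) {v : DualVec p m}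
    (hv : v ∈ Yh) (s : DualVec p m) {σ : ℝ} (hσ : 0 < σ) :
    ∃ w ∈ Yh, IsMinOn (fun y => -⟪s, y⟫ + 1 / σ * breg φd y v) Yh w := by
  have := hφd.exists_prox hY hv (-s) (c := 1 / σ) (by positivity)
  simpa only [inner_neg_left] using this

theorem prox_inequality_snd (hφd : IsBregmanKernel Yh Lφ φd) {v w u s : DualVec p m} {σ : ℝ}
    (hmin : IsMinOn (fun y => -⟪s, y⟫ + 1 / σ * breg φd y v) Yh w) (hw : w ∈ Yh) (hu : u ∈ Yh) :
    ⟪s, u - w⟫ ≤ 1 / σ * (breg φd u v - breg φd u w - breg φd w v) := by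
  have h : IsMinOn (fun y => ⟪-s, y⟫ + 1 / σ * breg φd y v) Yh w := by
    simpa only [inner_neg_left] using hmin
  have := hφd.prox_inequality h hw hu
  rwa [← neg_sub u, inner_neg_neg] at this

/-- The potential of APDB-xy.  The extrapolation error `∇ₓΦ(zᵏ) - ∇ₓΦ(zᵏ⁻¹)` is split into a change
of `y` followed by a change of `x`. -/
noncomputable def xyPotential (P : ConicProgram n p m) (φp : Vec n → ℝ) (φd : DualVec p m → ℝ)
    (q : Params) (s : IterState n p m) (z' : PDVec n p m) : ℝ :=
  s.γ * breg φp z'.fst s.z.fst + breg φd z'.snd s.z.snd + s.σprev *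
    (1 / (2 * (q.cα / s.τprev)) *
        ‖P.gradX s.z.fst s.z.snd - P.gradX s.z.fst s.zprev.snd‖ ^ 2
      + 1 / (2 * (q.γ0 * q.cβ / s.σprev)) *
        ‖P.gradX s.z.fst s.zprev.snd - P.gradX s.zprev.fst s.zprev.snd‖ ^ 2
      - ⟪P.gradX s.z.fst s.z.snd - P.gradX s.zprev.fst s.zprev.snd, s.z.fst - z'.fst⟫)

theorem xyPotential_lower (hγ0 : 0 < q.γ0) (hφp : IsBregmanKernel P.X Lφ φp)
    (hα : 0 < q.cα) (hβ : 0 < q.cβ) (hαβ : q.cα + q.cβ < 1)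
    {s : IterState n p m} {z' : PDVec n p m} (hs : StateOK P P.Y q s) (hz' : z' ∈ P.dom P.Y) :
    q.γ0 * (1 - (q.cα + q.cβ)) * breg φp z'.fst s.z.fst + 1 * breg φd z'.snd s.z.snd ≤
      xyPotential P φp φd q s z' := by
  obtain ⟨hz, -, hτ, hσ, hγ, hστ⟩ := hs
  unfold xyPotential
  set a := P.gradX s.z.fst s.z.snd - P.gradX s.z.fst s.zprev.snd
  set b := P.gradX s.z.fst s.zprev.snd - P.gradX s.zprev.fst s.zprev.snd
  have e : P.gradX s.z.fst s.z.snd - P.gradX s.zprev.fst s.zprev.snd = a + b := by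
    simp only [a, b]; abel
  rw [e]
  have hα' : 0 < q.cα / s.τprev := by positivity
  have hβ' : 0 < q.γ0 * q.cβ / s.σprev := by positivity
  have h1 := neg_inner_le_young a (z'.fst - s.z.fst) hα'
  have h2 := neg_inner_le_young b (z'.fst - s.z.fst) hβ'
  have h3 := hφp.half_sq_le_breg hz'.1 hz.1
  have h4 := hφp.breg_nonneg hz'.1 hz.1
  rw [← neg_sub z'.fst, inner_neg_right, inner_add_left]
  set D := breg φp z'.fst s.z.fst
  set N := ‖z'.fst - s.z.fst‖ ^ 2
  have h5 : s.σprev * ((q.cα / s.τprev + q.γ0 * q.cβ / s.σprev) / 2 * N) ≤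
      s.γ * (q.cα + q.cβ) * D := by
    have e1 : s.σprev * (q.cα / s.τprev + q.γ0 * q.cβ / s.σprev) ≤ s.γ * (q.cα + q.cβ) := by
      have : s.σprev * (q.cα / s.τprev + q.γ0 * q.cβ / s.σprev) =
          s.σprev / s.τprev * q.cα + q.γ0 * q.cβ := by
        field_simp
      rw [this]
      have h6 : s.σprev / s.τprev ≤ s.γ := (div_le_iff₀ hτ).2 hστ
      have h7 := mul_le_mul_of_nonneg_right h6 hα.le
      have h8 := mul_le_mul_of_nonneg_right hγ hβ.le
      linarith
    have h9 := mul_le_mul e1 h3 (by positivity)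
      (mul_nonneg (hγ0.le.trans hγ) (by linarith))
    linarith
  have h6 := mul_le_mul_of_nonneg_left (add_le_add h1 h2) hσ.le
  have h7 : q.γ0 * (1 - (q.cα + q.cβ)) * D ≤ s.γ * (1 - (q.cα + q.cβ)) * D :=
    mul_le_mul_of_nonneg_right (mul_le_mul_of_nonneg_right hγ (by linarith)) h4
  linarith

theorem xyPotential_step (hf : P.FunAssumptions q.μ) (hγ0 : 0 < q.γ0)
    (hφp : IsBregmanKernel P.X Lφ φp) (hφd : IsBregmanKernel P.Y Lφ φd)
    (hφμ : 0 < q.μ → φp = fun x => 1 / 2 * ‖x‖ ^ 2) (hα : 0 < q.cα) (hβ : 0 < q.cβ)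
    (hδ : 0 ≤ q.δ) {s : IterState n p m} {τ : ℝ} {w z' : PDVec n p m} (hs : StateOK P P.Y q s)
    (hτ : 0 < τ) (htrial : xyTrial P φp φd s τ w) (htest : xyTest P φp φd q s τ w)
    (hz' : z' ∈ P.dom P.Y) :
    s.γ * τ * (P.Phi w.fst z'.snd - P.Phi z'.fst w.snd) ≤
      xyPotential P φp φd q s z' - xyPotential P φp φd q (s.next q τ w) z' +
        q.μ / 2 * (s.γ * τ) * ‖z'.fst - w.fst‖ ^ 2 := by
  obtain ⟨hz, -, hτp, hσp, hγ, -⟩ := hs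
  obtain ⟨⟨hwx, hwxm⟩, hwy, hwym⟩ := htrial
  have hγpos : 0 < s.γ := hγ0.trans_le hγ
  have hσ : 0 < s.γ * τ := by positivity
  unfold xyTest at htest
  simp only at htest
  unfold xyPotential IterState.next
  simp only
  set σ := s.γ * τ with hσdef
  set θ := s.σprev / σ with hθ
  set a := P.gradX s.z.fst s.z.snd - P.gradX s.z.fst s.zprev.snd with ha
  set b := P.gradX s.z.fst s.zprev.snd - P.gradX s.zprev.fst s.zprev.snd with hb
  set a' := P.gradX w.fst w.snd - P.gradX w.fst s.z.snd with ha'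
  set b' := P.gradX w.fst s.z.snd - P.gradX s.z.fst s.z.snd with hb'
  have e1 : P.gradX s.z.fst s.z.snd - P.gradX s.zprev.fst s.zprev.snd = a + b := by
    rw [ha, hb]; abel
  have e2 : P.gradX w.fst w.snd - P.gradX s.z.fst s.z.snd = a' + b' := by
    rw [ha', hb']; abel
  rw [e1, e2]
  have h1 := hφp.prox_inequality hwxm hwx hz'.1
  have h2 := prox_inequality_snd hφd hwym hwy hz'.2
  have e3 : (1 + θ) • P.gradX s.z.fst s.z.snd - θ • P.gradX s.zprev.fst s.zprev.snd =
      P.gradX w.fst w.snd - (a' + b') + θ • (a + b) := by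
    rw [← e1, ← e2]; module
  rw [e3, inner_add_left, inner_sub_left, real_inner_smul_left] at h1
  rw [P.gradY_eq] at h2
  have h3 := P.Phi_sub w.fst z'.snd w.snd
  have h4 := hf.Phi_convex hwx hz'.1 hwy
  rw [← neg_sub w.fst, inner_neg_right] at h4
  have hα' : 0 < q.cα / s.τprev := by positivity
  have hβ' : 0 < q.γ0 * q.cβ / s.σprev := by positivity
  have h5 := neg_inner_le_young a (w.fst - s.z.fst) hα'
  have h6 := neg_inner_le_young b (w.fst - s.z.fst) hβ'
  have h7 := hφp.half_sq_le_breg hwx hz.1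
  have hθ0 : 0 ≤ θ := by positivity
  have e4 : w.fst - z'.fst = (w.fst - s.z.fst) + (s.z.fst - z'.fst) := by abel
  have e5 : ⟪a + b, w.fst - z'.fst⟫ =
      ⟪a, w.fst - s.z.fst⟫ + ⟪b, w.fst - s.z.fst⟫ + ⟪a + b, s.z.fst - z'.fst⟫ := by
    rw [e4, inner_add_right, inner_add_left]
  rw [e5] at h1
  have hmu := mu_mul_breg (φp := φp) hf.mu_nonneg hφμ z'.fst w.fst
  have hd1 : 0 ≤ q.δ / τ * breg φp w.fst s.z.fst :=
    mul_nonneg (by positivity) (hφp.breg_nonneg hwx hz.1)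
  have hd2 : 0 ≤ q.δ / σ * breg φd w.snd s.z.snd :=
    mul_nonneg (by positivity) (hφd.breg_nonneg hwy hz.2)
  set α := q.cα / s.τprev
  set β := q.γ0 * q.cβ / s.σprev
  set N := ‖w.fst - s.z.fst‖ ^ 2
  have h8 := mul_le_mul_of_nonneg_left (add_le_add h5 h6) hθ0
  have h9 := mul_le_mul_of_nonneg_left h7 (by positivity : 0 ≤ θ * (α + β))
  have main : P.Phi w.fst z'.snd - P.Phi z'.fst w.snd ≤
      1 / τ * (breg φp z'.fst s.z.fst - breg φp z'.fst w.fst)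
      + 1 / σ * (breg φd z'.snd s.z.snd - breg φd z'.snd w.snd)
      + θ * (1 / (2 * α) * ‖a‖ ^ 2 + 1 / (2 * β) * ‖b‖ ^ 2 - ⟪a + b, s.z.fst - z'.fst⟫)
      - (1 / (2 * (q.cα / τ)) * ‖a'‖ ^ 2 + 1 / (2 * (q.γ0 * q.cβ / σ)) * ‖b'‖ ^ 2
        - ⟪a' + b', w.fst - z'.fst⟫) := by
    linarith
  have hmul := mul_le_of_le_step hγpos hτ hσdef main
  have hγ' : s.γ * (1 + q.μ * τ) = s.γ + σ * q.μ := by rw [hσdef]; ring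
  rw [hγ']
  have := congrArg (fun r => σ * r) hmu
  linarith

theorem isPotential_xy (hs : P.SetAssumptions) (hf : P.FunAssumptions q.μ) (hγ0 : 0 < q.γ0)
    (hφp : IsBregmanKernel P.X Lφ φp) (hφd : IsBregmanKernel P.Y Lφ φd)
    (hφμ : 0 < q.μ → φp = fun x => 1 / 2 * ‖x‖ ^ 2) (hα : 0 < q.cα) (hβ : 0 < q.cβ)
    (hδ : 0 ≤ q.δ) (hαβ : q.cα + q.cβ < 1) :
    IsPotential P φp φd P.Y q (q.γ0 * (1 - (q.cα + q.cβ))) 1 (xyTrial P φp φd)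
      (xyTest P φp φd q) (xyPotential P φp φd q) where
  trial_mem := fun h => ⟨h.1.1, h.2.1⟩
  exists_trial := fun {s τ} hst hτ => by
    have hγ : 0 < s.γ := hγ0.trans_le hst.γ0_le
    obtain ⟨x, hx, hxm⟩ := exists_prox_fst hs hφp hst.z_mem.1
      ((1 + s.σprev / (s.γ * τ)) • P.gradX s.z.fst s.z.snd -
        (s.σprev / (s.γ * τ)) • P.gradX s.zprev.fst s.zprev.snd) hτ
    obtain ⟨y, hy, hym⟩ := exists_prox_snd P.isClosed_Y hφd hst.z_mem.2 (P.gradY x s.z.snd)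
      (mul_pos hγ hτ)
    exact ⟨WithLp.toLp 2 (x, y), ⟨hx, hxm⟩, hy, hym⟩
  init := fun z z' => by simp [xyPotential]
  lower := fun hst hz' => xyPotential_lower hγ0 hφp hα hβ hαβ hst hz'
  step := fun hst hτ h1 h2 hz' =>
    xyPotential_step hf hγ0 hφp hφd hφμ hα hβ hδ hst hτ h1 h2 hz'

/-- The potential of APDB-yx.  It is written with the residual, since `∇_yΦ` does not depend on
`y`. -/
noncomputable def yxPotential (P : ConicProgram n p m) (φp : Vec n → ℝ) (φd : DualVec p m → ℝ)
    (q : Params) (s : IterState n p m) (z' : PDVec n p m) : ℝ :=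
  s.γ * breg φp z'.fst s.z.fst + breg φd z'.snd s.z.snd + s.σprev *
    (1 / (2 * (q.cα / s.σprev)) * ‖P.residual s.z.fst - P.residual s.zprev.fst‖ ^ 2
      - ⟪P.residual s.z.fst - P.residual s.zprev.fst, z'.snd - s.z.snd⟫)

theorem yxPotential_lower (hφp : IsBregmanKernel P.X Lφ φp)
    (hφd : IsBregmanKernel Yh Lφ φd) (hα : 0 < q.cα)
    {s : IterState n p m} {z' : PDVec n p m} (hs : StateOK P Yh q s) (hz' : z' ∈ P.dom Yh) :
    q.γ0 * breg φp z'.fst s.z.fst + (1 - q.cα) * breg φd z'.snd s.z.snd ≤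
      yxPotential P φp φd q s z' := by
  obtain ⟨hz, -, hτ, hσ, hγ, hστ⟩ := hs
  unfold yxPotential
  have hα' : 0 < q.cα / s.σprev := by positivity
  set a := P.residual s.z.fst - P.residual s.zprev.fst
  have h1 := neg_inner_le_young (-a) (z'.snd - s.z.snd) hα'
  rw [inner_neg_left, neg_neg, norm_neg] at h1
  have h3 := hφd.half_sq_le_breg hz'.2 hz.2
  have h4 := mul_le_mul_of_nonneg_right hγ (hφp.breg_nonneg hz'.1 hz.1)
  have h5 := mul_le_mul_of_nonneg_left h1 hσ.le
  have e : s.σprev * (q.cα / s.σprev / 2 * ‖z'.snd - s.z.snd‖ ^ 2) =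
      q.cα * (1 / 2 * ‖z'.snd - s.z.snd‖ ^ 2) := by
    field_simp
  have h6 := mul_le_mul_of_nonneg_left h3 hα.le
  linarith

/-- The primal step is linearized at the old point, where convexity of `Φ(·, y⁺)` is used; the
linearization error at the new point is the one measured by the test. -/
theorem yxPotential_step (hf : P.FunAssumptions q.μ) (hγ0 : 0 < q.γ0)
    (hφp : IsBregmanKernel P.X Lφ φp) (hφd : IsBregmanKernel Yh Lφ φd) (hYh : Yh ⊆ P.Y)
    (hφμ : 0 < q.μ → φp = fun x => 1 / 2 * ‖x‖ ^ 2) (hα : 0 < q.cα)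
    (hδ : 0 ≤ q.δ) {s : IterState n p m} {τ : ℝ} {w z' : PDVec n p m} (hs : StateOK P Yh q s)
    (hτ : 0 < τ) (htrial : yxTrial P φp φd Yh s τ w) (htest : yxTest P φp φd q s τ w)
    (hz' : z' ∈ P.dom Yh) :
    s.γ * τ * (P.Phi w.fst z'.snd - P.Phi z'.fst w.snd) ≤
      yxPotential P φp φd q s z' - yxPotential P φp φd q (s.next q τ w) z' +
        q.μ / 2 * (s.γ * τ) * ‖z'.fst - w.fst‖ ^ 2 := by
  obtain ⟨hz, -, hτp, hσp, hγ, -⟩ := hs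
  obtain ⟨⟨hwy, hwym⟩, hwx, hwxm⟩ := htrial
  have hγpos : 0 < s.γ := hγ0.trans_le hγ
  have hσ : 0 < s.γ * τ := by positivity
  unfold yxTest at htest
  simp only [P.gradY_eq] at htest
  simp only [P.gradY_eq] at hwym
  unfold yxPotential IterState.next
  simp only
  set σ := s.γ * τ with hσdef
  set θ := s.σprev / σ with hθ
  set a := P.residual s.z.fst - P.residual s.zprev.fst with ha
  set a' := P.residual w.fst - P.residual s.z.fst with ha'
  have h1 := hφp.prox_inequality hwxm hwx hz'.1
  have h2 := prox_inequality_snd hφd hwym hwy hz'.2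
  have e3 : (1 + θ) • P.residual s.z.fst - θ • P.residual s.zprev.fst =
      P.residual w.fst - a' + θ • a := by
    rw [ha, ha']; module
  rw [e3, inner_add_left, inner_sub_left, real_inner_smul_left] at h2
  have h3 := P.Phi_sub w.fst z'.snd w.snd
  have h4 := hf.Phi_convex hz.1 hz'.1 (hYh hwy)
  have e0 : ⟪P.gradX s.z.fst w.snd, z'.fst - s.z.fst⟫ = ⟪P.gradX s.z.fst w.snd, w.fst - s.z.fst⟫ -
      ⟪P.gradX s.z.fst w.snd, w.fst - z'.fst⟫ := by
    rw [← inner_sub_right]; congr 1; abel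
  rw [e0] at h4
  have hα' : 0 < q.cα / s.σprev := by positivity
  have h5 := neg_inner_le_young (-a) (w.snd - s.z.snd) hα'
  rw [inner_neg_left, neg_neg, norm_neg] at h5
  have h7 := hφd.half_sq_le_breg hwy hz.2
  have hθ0 : 0 ≤ θ := by positivity
  have e5 : ⟪a, z'.snd - w.snd⟫ = ⟪a, z'.snd - s.z.snd⟫ - ⟪a, w.snd - s.z.snd⟫ := by
    rw [← inner_sub_right]; congr 1; abel
  rw [e5] at h2
  have hmu := mu_mul_breg (φp := φp) hf.mu_nonneg hφμ z'.fst w.fst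
  have hd1 : 0 ≤ q.δ / τ * breg φp w.fst s.z.fst :=
    mul_nonneg (by positivity) (hφp.breg_nonneg hwx hz.1)
  have hd2 : 0 ≤ q.δ / σ * breg φd w.snd s.z.snd :=
    mul_nonneg (by positivity) (hφd.breg_nonneg hwy hz.2)
  set α := q.cα / s.σprev
  set N := ‖w.snd - s.z.snd‖ ^ 2
  have h8 := mul_le_mul_of_nonneg_left h5 hθ0
  have h9 := mul_le_mul_of_nonneg_left h7 (by positivity : 0 ≤ θ * α)
  have main : P.Phi w.fst z'.snd - P.Phi z'.fst w.snd ≤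
      1 / τ * (breg φp z'.fst s.z.fst - breg φp z'.fst w.fst)
      + 1 / σ * (breg φd z'.snd s.z.snd - breg φd z'.snd w.snd)
      + θ * (1 / (2 * α) * ‖a‖ ^ 2 - ⟪a, z'.snd - s.z.snd⟫)
      - (1 / (2 * (q.cα / σ)) * ‖a'‖ ^ 2 - ⟪a', z'.snd - w.snd⟫) := by
    linarith
  have hmul := mul_le_of_le_step hγpos hτ hσdef main
  have hγ' : s.γ * (1 + q.μ * τ) = s.γ + σ * q.μ := by rw [hσdef]; ring
  rw [hγ']
  have := congrArg (fun r => σ * r) hmu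
  linarith

theorem isPotential_yx (hs : P.SetAssumptions) (hf : P.FunAssumptions q.μ) (hγ0 : 0 < q.γ0)
    (hφp : IsBregmanKernel P.X Lφ φp) (hφd : IsBregmanKernel Yh Lφ φd) (hYh : Yh ⊆ P.Y)
    (hY : IsClosed Yh) (hφμ : 0 < q.μ → φp = fun x => 1 / 2 * ‖x‖ ^ 2) (hα : 0 < q.cα)
    (hδ : 0 ≤ q.δ) :
    IsPotential P φp φd Yh q q.γ0 (1 - q.cα) (yxTrial P φp φd Yh)
      (yxTest P φp φd q) (yxPotential P φp φd q) where
  trial_mem := fun h => ⟨h.2.1, h.1.1⟩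
  exists_trial := fun {s τ} hst hτ => by
    have hγ : 0 < s.γ := hγ0.trans_le hst.γ0_le
    obtain ⟨y, hy, hym⟩ := exists_prox_snd hY hφd hst.z_mem.2
      ((1 + s.σprev / (s.γ * τ)) • P.gradY s.z.fst s.z.snd -
        (s.σprev / (s.γ * τ)) • P.gradY s.zprev.fst s.zprev.snd) (mul_pos hγ hτ)
    obtain ⟨x, hx, hxm⟩ := exists_prox_fst hs hφp hst.z_mem.1 (P.gradX s.z.fst y) hτ
    exact ⟨WithLp.toLp 2 (x, y), ⟨hy, hym⟩, hx, hxm⟩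
  init := fun z z' => by simp [yxPotential]
  lower := fun hst hz' => yxPotential_lower hφp hφd hα hst hz'
  step := fun hst hτ h1 h2 hz' =>
    yxPotential_step hf hγ0 hφp hφd hYh hφμ hα hδ hst hτ h1 h2 hz'

end Potential

/-! ### Runs of APDB: invariants and energy estimates -/

section Run

variable {n p m : ℕ} {P : ConicProgram n p m} {q : Params} {φp : Vec n → ℝ}
  {φd : DualVec p m → ℝ} {Lφ ξ κp κd : ℝ} {Yh : Set (DualVec p m)}
  {trial test : IterState n p m → ℝ → PDVec n p m → Prop}
  {W : IterState n p m → PDVec n p m → ℝ} {z0 : PDVec n p m} {K : ℕ}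
  {z : ℕ → PDVec n p m} {τ γ : ℕ → ℝ}

@[simp] theorem stateAt_z (k : ℕ) : (stateAt q z τ γ k).z = z k := by cases k <;> rfl

@[simp] theorem stateAt_γ (k : ℕ) : (stateAt q z τ γ k).γ = γ k := by cases k <;> rfl

theorem IsAPDB.stateAt_succ (h : IsAPDB trial test q z0 K z τ γ) {k : ℕ} (hk : k < K) :
    stateAt q z τ γ (k + 1) = (stateAt q z τ γ k).next q (τ k) (z (k + 1)) := by
  rw [stateAt, IterState.next, h.γ_succ k hk, stateAt_z, stateAt_γ]

theorem IsAPDB.mono (h : IsAPDB trial test q z0 K z τ γ) {k : ℕ} (hk : k ≤ K) :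
    IsAPDB trial test q z0 k z τ γ :=
  ⟨h.z_zero, h.γ_zero, fun j hj => h.γ_succ j (hj.trans_le hk),
    fun j hj => h.step j (hj.trans_le hk)⟩

/-- The invariants hold along a run, and all trial step sizes are positive. -/
theorem IsAPDB.stateOK (h : IsAPDB trial test q z0 K z τ γ) (hq : q.Valid) (hμ : 0 ≤ q.μ)
    (hmem : ∀ {s τ w}, trial s τ w → w ∈ P.dom Yh) (hz0 : z0 ∈ P.dom Yh) {k : ℕ} (hk : k ≤ K) :
    StateOK P Yh q (stateAt q z τ γ k) ∧ 0 < firstTrial q z τ γ k := by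
  induction k with
  | zero =>
    have hz00 : z 0 ∈ P.dom Yh := h.z_zero ▸ hz0
    refine ⟨⟨hz00, hz00, hq.τbar_pos, mul_pos hq.γ0_pos hq.τbar_pos, ?_, ?_⟩,
      hq.τbar_pos⟩
    · exact h.γ_zero.ge
    · change q.γ0 * q.τbar ≤ γ 0 * q.τbar
      rw [h.γ_zero]
  | succ k ih =>
    obtain ⟨hs, hft⟩ := ih (by omega)
    obtain ⟨j, hj, htr, -, -⟩ := h.step k (by omega)
    have hτ : 0 < τ k := hj ▸ mul_pos (pow_pos hq.η_pos j) hft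
    have hγ0 : q.γ0 ≤ γ k := by simpa using hs.γ0_le
    have hγk : 0 < γ k := hq.γ0_pos.trans_le hγ0
    have hγle : γ k ≤ γ (k + 1) := by
      rw [h.γ_succ k (by omega)]
      nlinarith [mul_nonneg hγk.le (mul_nonneg hμ hτ.le)]
    refine ⟨⟨hmem htr, ?_, hτ, mul_pos hγk hτ, hγ0.trans hγle,
      mul_le_mul_of_nonneg_right hγle hτ.le⟩, ?_⟩
    · have := hs.z_mem
      rwa [stateAt_z] at this
    · have h1 : 0 ≤ q.cnm := by rcases hq.cnm_mem with h | h <;> rw [h]; exact zero_le_one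
      have h2 := hs.τprev_pos
      have h3 := hγk.trans_le hγle
      rw [firstTrial]
      positivity

theorem IsAPDB.τ_pos (h : IsAPDB trial test q z0 K z τ γ) (hq : q.Valid) (hμ : 0 ≤ q.μ)
    (hmem : ∀ {s τ w}, trial s τ w → w ∈ P.dom Yh) (hz0 : z0 ∈ P.dom Yh) {k : ℕ} (hk : k < K) :
    0 < τ k := by
  obtain ⟨j, hj, -⟩ := h.step k hk
  exact hj ▸ mul_pos (pow_pos hq.η_pos j) (h.stateOK hq hμ hmem hz0 hk.le).2

theorem IsAPDB.γ0_le (h : IsAPDB trial test q z0 K z τ γ) (hq : q.Valid) (hμ : 0 ≤ q.μ)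
    (hmem : ∀ {s τ w}, trial s τ w → w ∈ P.dom Yh) (hz0 : z0 ∈ P.dom Yh) {k : ℕ} (hk : k ≤ K) :
    q.γ0 ≤ γ k := by
  simpa using (h.stateOK hq hμ hmem hz0 hk).1.γ0_le

theorem IsAPDB.mem_dom (h : IsAPDB trial test q z0 K z τ γ) (hq : q.Valid) (hμ : 0 ≤ q.μ)
    (hmem : ∀ {s τ w}, trial s τ w → w ∈ P.dom Yh) (hz0 : z0 ∈ P.dom Yh) {k : ℕ} (hk : k ≤ K) :
    z k ∈ P.dom Yh := by
  simpa using (h.stateOK hq hμ hmem hz0 hk).1.z_mem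

theorem IsPotential.run_init (hW : IsPotential P φp φd Yh q κp κd trial test W)
    (h : IsAPDB trial test q z0 K z τ γ) (z' : PDVec n p m) :
    W (stateAt q z τ γ 0) z' = q.γ0 * breg φp z'.fst z0.fst + breg φd z'.snd z0.snd := by
  rw [stateAt, h.z_zero, h.γ_zero, hW.init]

theorem IsPotential.run_step (hW : IsPotential P φp φd Yh q κp κd trial test W)
    (h : IsAPDB trial test q z0 K z τ γ) (hq : q.Valid) (hμ : 0 ≤ q.μ) (hz0 : z0 ∈ P.dom Yh)
    {z' : PDVec n p m} (hz' : z' ∈ P.dom Yh) {k : ℕ} (hk : k < K) :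
    γ k * τ k * (P.Phi (z (k + 1)).fst z'.snd - P.Phi z'.fst (z (k + 1)).snd) ≤
      W (stateAt q z τ γ k) z' - W (stateAt q z τ γ (k + 1)) z' +
        q.μ / 2 * (γ k * τ k) * ‖z'.fst - (z (k + 1)).fst‖ ^ 2 := by
  obtain ⟨-, -, htr, hte, -⟩ := h.step k hk
  have := hW.step (h.stateOK hq hμ hW.trial_mem hz0 hk.le).1
    (h.τ_pos hq hμ hW.trial_mem hz0 hk) htr hte hz'
  rwa [← h.stateAt_succ hk, stateAt_γ] at this

theorem ConicProgram.FunAssumptions.saddle_gap {μ : ℝ} (hf : P.FunAssumptions μ)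
    (hs : P.SetAssumptions) (hYh : Yh ⊆ P.Y) {zs w : PDVec n p m} (hzs : zs ∈ P.saddle Yh)
    (hw : w ∈ P.dom Yh) :
    μ / 2 * ‖zs.fst - w.fst‖ ^ 2 ≤ P.Phi w.fst zs.snd - P.Phi zs.fst w.snd := by
  have h1 := hf.Phi_first_order hzs.1.1 hw.1 (hYh hzs.1.2)
  have hmin : IsMinOn (fun x => P.Phi x zs.snd) P.X zs.fst := fun x hx => hzs.2.2 x hx
  have h2 := inner_nonneg_of_isMinOn hs.convex_X hmin (hf.hasGradientAt_Phi hzs.1.1 zs.snd)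
    hzs.1.1 hw.1
  have h3 := hzs.2.1 _ hw.2
  rw [norm_sub_rev]
  linarith

/-- At a saddle point the potential decreases: there the duality gap is at least
`(μ / 2) ‖x* - x⁺‖²`, which pays for the remainder in `IsPotential.step`. -/
theorem IsPotential.run_le (hW : IsPotential P φp φd Yh q κp κd trial test W)
    (h : IsAPDB trial test q z0 K z τ γ) (hq : q.Valid) (hf : P.FunAssumptions q.μ)
    (hs : P.SetAssumptions) (hYh : Yh ⊆ P.Y) (hz0 : z0 ∈ P.dom Yh)
    {zs : PDVec n p m} (hzs : zs ∈ P.saddle Yh) {k : ℕ} (hk : k ≤ K) :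
    κp * breg φp zs.fst (z k).fst + κd * breg φd zs.snd (z k).snd ≤
      q.γ0 * breg φp zs.fst z0.fst + breg φd zs.snd z0.snd := by
  have hdec : ∀ j ≤ K, W (stateAt q z τ γ j) zs ≤ W (stateAt q z τ γ 0) zs := by
    intro j
    induction j with
    | zero => exact fun _ => le_rfl
    | succ j ih =>
      intro hj
      refine le_trans ?_ (ih (by omega))
      have h1 := hW.run_step h hq hf.mu_nonneg hz0 hzs.1 (show j < K by omega)
      have h2 := hf.saddle_gap hs hYh hzs (h.mem_dom hq hf.mu_nonneg hW.trial_mem hz0 hj)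
      have h3 : 0 ≤ γ j * τ j := mul_nonneg
        (hq.γ0_pos.le.trans (h.γ0_le hq hf.mu_nonneg hW.trial_mem hz0 (by omega)))
        (h.τ_pos hq hf.mu_nonneg hW.trial_mem hz0 (by omega)).le
      have h4 := mul_le_mul_of_nonneg_left h2 h3
      linarith
  have h1 := hW.lower (h.stateOK hq hf.mu_nonneg hW.trial_mem hz0 hk).1 hzs.1
  rw [stateAt_z] at h1
  exact h1.trans ((hdec k hk).trans_eq (hW.run_init h zs))

theorem init_le (hγ0 : 0 < q.γ0) (hφp : IsBregmanKernel P.X Lφ φp)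
    (hφd : IsBregmanKernel Yh Lφ φd) {w w' : PDVec n p m} (hw : w ∈ P.dom Yh)
    (hw' : w' ∈ P.dom Yh) :
    q.γ0 * breg φp w'.fst w.fst + breg φd w'.snd w.snd ≤
      Lφ * max q.γ0 1 / 2 * ‖w' - w‖ ^ 2 := by
  have h1 := hφp.breg_le hw'.1 hw.1
  have h2 := hφd.breg_le hw'.2 hw.2
  have h3 : q.γ0 * breg φp w'.fst w.fst ≤ max q.γ0 1 * (Lφ / 2 * ‖w'.fst - w.fst‖ ^ 2) :=
    mul_le_mul (le_max_left _ _) h1 (hφp.breg_nonneg hw'.1 hw.1) (by positivity)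
  have h4 : 1 * breg φd w'.snd w.snd ≤ max q.γ0 1 * (Lφ / 2 * ‖w'.snd - w.snd‖ ^ 2) :=
    mul_le_mul (le_max_right _ _) h2 (hφd.breg_nonneg hw'.2 hw.2) (by positivity)
  rw [norm_sub_sq_prod]
  linarith

theorem IsPotential.norm_sub_saddle_le (hW : IsPotential P φp φd Yh q κp κd trial test W)
    (h : IsAPDB trial test q z0 K z τ γ) (hq : q.Valid) (hf : P.FunAssumptions q.μ)
    (hs : P.SetAssumptions) (hYh : Yh ⊆ P.Y) (hL : 0 < Lφ) (hφp : IsBregmanKernel P.X Lφ φp)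
    (hφd : IsBregmanKernel Yh Lφ φd) (hκp : 0 < κp) (hκd : 0 < κd) (hz0 : z0 ∈ P.dom Yh)
    {zs : PDVec n p m} (hzs : zs ∈ P.saddle Yh) {k : ℕ} (hk : k ≤ K) :
    ‖z k - zs‖ ≤ √(Lφ * max q.γ0 1 / min κp κd) * ‖z0 - zs‖ := by
  have hzk := h.mem_dom hq hf.mu_nonneg hW.trial_mem hz0 hk
  have h1 := hW.run_le h hq hf hs hYh hz0 hzs hk
  have h2 := init_le (Yh := Yh) hq.γ0_pos hφp hφd hz0 hzs.1
  have hmin : 0 < min κp κd := lt_min hκp hκd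
  have h3 : min κp κd * (1 / 2 * ‖zs.fst - (z k).fst‖ ^ 2) ≤ κp * breg φp zs.fst (z k).fst :=
    mul_le_mul (min_le_left _ _) (hφp.half_sq_le_breg hzs.1.1 hzk.1) (by positivity) hκp.le
  have h4 : min κp κd * (1 / 2 * ‖zs.snd - (z k).snd‖ ^ 2) ≤ κd * breg φd zs.snd (z k).snd :=
    mul_le_mul (min_le_right _ _) (hφd.half_sq_le_breg hzs.1.2 hzk.2) (by positivity) hκd.le
  have h5 : ‖z k - zs‖ ^ 2 ≤ Lφ * max q.γ0 1 / min κp κd * ‖z0 - zs‖ ^ 2 := by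
    rw [div_mul_eq_mul_div, le_div_iff₀ hmin, norm_sub_rev (z k), norm_sub_rev z0,
      norm_sub_sq_prod zs (z k)]
    linarith
  have h6 := Real.sqrt_le_sqrt h5
  rwa [Real.sqrt_sq (norm_nonneg _), Real.sqrt_mul (by positivity),
    Real.sqrt_sq (norm_nonneg _)] at h6

/-! ### The averaged iterate -/

/-- The total weight `∑_{k<K} σ_k`. -/
noncomputable def totalWeight (K : ℕ) (τ γ : ℕ → ℝ) : ℝ := ∑ k ∈ Finset.range K, γ k * τ k

theorem average_eq (hpos : 0 < γ 0 * τ 0) :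
    average K z τ γ =
      ∑ k ∈ Finset.range K, (γ k * τ k / totalWeight K τ γ) • z (k + 1) := by
  unfold average totalWeight
  rw [← Finset.sum_div, Finset.smul_sum]
  refine Finset.sum_congr rfl fun k _ => ?_
  rw [smul_smul, inv_div, div_mul_div_comm, mul_comm (γ 0 * τ 0), mul_div_mul_right _ _ hpos.ne']

theorem fst_sum_smul {ι : Type*} (s : Finset ι) (ω : ι → ℝ) (w : ι → PDVec n p m) :
    (∑ i ∈ s, ω i • w i).fst = ∑ i ∈ s, ω i • (w i).fst := by
  change WithLp.fstL 2 ℝ (Vec n) (DualVec p m) _ = _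
  rw [map_sum]
  rfl

theorem snd_sum_smul {ι : Type*} (s : Finset ι) (ω : ι → ℝ) (w : ι → PDVec n p m) :
    (∑ i ∈ s, ω i • w i).snd = ∑ i ∈ s, ω i • (w i).snd := by
  change WithLp.sndL 2 ℝ (Vec n) (DualVec p m) _ = _
  rw [map_sum]
  rfl

theorem ConicProgram.convex_dom (hs : P.SetAssumptions) (hY : Convex ℝ Yh) :
    Convex ℝ (P.dom Yh) := fun _ hz _ hw _ _ ha hb hab =>
  ⟨hs.convex_X hz.1 hw.1 ha hb hab, hY hz.2 hw.2 ha hb hab⟩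

theorem IsAPDB.weight_pos (h : IsAPDB trial test q z0 K z τ γ) (hq : q.Valid) (hμ : 0 ≤ q.μ)
    (hmem : ∀ {s τ w}, trial s τ w → w ∈ P.dom Yh) (hz0 : z0 ∈ P.dom Yh) {k : ℕ} (hk : k < K) :
    0 < γ k * τ k :=
  mul_pos (hq.γ0_pos.trans_le (h.γ0_le hq hμ hmem hz0 hk.le)) (h.τ_pos hq hμ hmem hz0 hk)

theorem IsAPDB.totalWeight_pos (h : IsAPDB trial test q z0 K z τ γ) (hq : q.Valid) (hμ : 0 ≤ q.μ)
    (hmem : ∀ {s τ w}, trial s τ w → w ∈ P.dom Yh) (hz0 : z0 ∈ P.dom Yh) (hK : 0 < K) :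
    0 < totalWeight K τ γ :=
  Finset.sum_pos (fun _ hk => h.weight_pos hq hμ hmem hz0 (Finset.mem_range.1 hk))
    ⟨0, Finset.mem_range.2 hK⟩

/-- A convex set that contains the iterates `z¹, …, zᴷ` contains their weighted average. -/
theorem IsAPDB.average_mem (h : IsAPDB trial test q z0 K z τ γ) (hq : q.Valid) (hμ : 0 ≤ q.μ)
    (hmem : ∀ {s τ w}, trial s τ w → w ∈ P.dom Yh) (hz0 : z0 ∈ P.dom Yh) (hK : 0 < K)
    {C : Set (PDVec n p m)} (hC : Convex ℝ C) (hzC : ∀ k < K, z (k + 1) ∈ C) :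
    average K z τ γ ∈ C := by
  have hT := h.totalWeight_pos hq hμ hmem hz0 hK
  rw [average_eq (h.weight_pos hq hμ hmem hz0 hK)]
  refine hC.sum_mem (fun k hk => ?_) ?_ (fun k hk => hzC k (Finset.mem_range.1 hk))
  · exact div_nonneg (h.weight_pos hq hμ hmem hz0 (Finset.mem_range.1 hk)).le hT.le
  · rw [← Finset.sum_div]
    exact div_self hT.ne'

/-- The duality gap at the average.  Jensen's inequality for `Φ(·, y') - (μ / 2) ‖· - x'‖²` leaves a
single quadratic remainder. -/
theorem IsPotential.average_gap (hW : IsPotential P φp φd Yh q κp κd trial test W)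
    (h : IsAPDB trial test q z0 K z τ γ) (hq : q.Valid) (hf : P.FunAssumptions q.μ)
    (hYh : Yh ⊆ P.Y) (hφp : IsBregmanKernel P.X Lφ φp) (hφd : IsBregmanKernel Yh Lφ φd)
    (hκp : 0 < κp) (hκd : 0 < κd) (hz0 : z0 ∈ P.dom Yh) (hK : 0 < K)
    {z' : PDVec n p m} (hz' : z' ∈ P.dom Yh) :
    P.Phi (average K z τ γ).fst z'.snd - P.Phi z'.fst (average K z τ γ).snd ≤
      (q.γ0 * breg φp z'.fst z0.fst + breg φd z'.snd z0.snd) / totalWeight K τ γ +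
        q.μ / 2 * ‖z'.fst - (average K z τ γ).fst‖ ^ 2 := by
  have hμ := hf.mu_nonneg
  have hT := h.totalWeight_pos hq hμ hW.trial_mem hz0 hK
  set T := totalWeight K τ γ with hTdef
  have hω1 : ∑ k ∈ Finset.range K, γ k * τ k / T = 1 := by
    rw [← Finset.sum_div]
    exact div_self hT.ne'
  have hω0 : ∀ k ∈ Finset.range K, 0 ≤ γ k * τ k / T := fun k hk =>
    div_nonneg (h.weight_pos hq hμ hW.trial_mem hz0 (Finset.mem_range.1 hk)).le hT.le
  have hmem : ∀ k ∈ Finset.range K, z (k + 1) ∈ P.dom Yh := fun k hk =>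
    h.mem_dom hq hμ hW.trial_mem hz0 (Finset.mem_range.1 hk)
  have hsum : ∀ j ≤ K, ∑ k ∈ Finset.range j, γ k * τ k *
      (P.Phi (z (k + 1)).fst z'.snd - P.Phi z'.fst (z (k + 1)).snd
        - q.μ / 2 * ‖(z (k + 1)).fst - z'.fst‖ ^ 2) ≤
      W (stateAt q z τ γ 0) z' - W (stateAt q z τ γ j) z' := by
    intro j
    induction j with
    | zero => simp
    | succ j ih =>
      intro hj
      have h1 := hW.run_step h hq hμ hz0 hz' (show j < K by omega)
      rw [norm_sub_rev] at h1
      rw [Finset.sum_range_succ]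
      linarith [ih (by omega)]
  have hKW : 0 ≤ W (stateAt q z τ γ K) z' := by
    have h1 := h.stateOK hq hμ hW.trial_mem hz0 le_rfl
    exact le_trans (add_nonneg (mul_nonneg hκp.le (hφp.breg_nonneg hz'.1 h1.1.z_mem.1))
      (mul_nonneg hκd.le (hφd.breg_nonneg hz'.2 h1.1.z_mem.2))) (hW.lower h1.1 hz')
  have h1 := hsum K le_rfl
  rw [hW.run_init h] at h1
  have h2 := strongConvexOn_jensen (hf.strongConvexOn_Phi (hYh hz'.2)) hω0 hω1
    (fun k hk => (hmem k hk).1) z'.fst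
  have h3 : P.Phi z'.fst (∑ k ∈ Finset.range K, (γ k * τ k / T) • (z (k + 1)).snd) =
      ∑ k ∈ Finset.range K, γ k * τ k / T * P.Phi z'.fst (z (k + 1)).snd := by
    simp only [P.Phi_eq, mul_add, Finset.sum_add_distrib, inner_sum, real_inner_smul_right]
    rw [← Finset.sum_mul, hω1, one_mul]
  rw [average_eq (h.weight_pos hq hμ hW.trial_mem hz0 hK), fst_sum_smul, snd_sum_smul, ← hTdef, h3]
  have h4 : ∑ k ∈ Finset.range K, γ k * τ k / T *
      (P.Phi (z (k + 1)).fst z'.snd - q.μ / 2 * ‖(z (k + 1)).fst - z'.fst‖ ^ 2) -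
      ∑ k ∈ Finset.range K, γ k * τ k / T * P.Phi z'.fst (z (k + 1)).snd =
      (∑ k ∈ Finset.range K, γ k * τ k *
        (P.Phi (z (k + 1)).fst z'.snd - P.Phi z'.fst (z (k + 1)).snd
        - q.μ / 2 * ‖(z (k + 1)).fst - z'.fst‖ ^ 2)) / T := by
    rw [← Finset.sum_sub_distrib, Finset.sum_div]
    exact Finset.sum_congr rfl fun k _ => by ring
  have h5 := div_le_div_of_nonneg_right (h1.trans (sub_le_self _ hKW)) hT.le
  rw [norm_sub_rev]
  linarith

end Run

/-! ### Smoothed duality gap of the average and step-size bounds -/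

section Period

variable {n p m : ℕ} {P : ConicProgram n p m} {q : Params} {φp : Vec n → ℝ}
  {φd : DualVec p m → ℝ} {Lφ ξ κp κd : ℝ} {Yh : Set (DualVec p m)}
  {trial test : IterState n p m → ℝ → PDVec n p m → Prop}
  {W : IterState n p m → PDVec n p m → ℝ} {z0 : PDVec n p m} {K : ℕ}
  {z : ℕ → PDVec n p m} {τ γ : ℕ → ℝ}

/-- For `μ = 0`: the smoothed gap of the average when the total weight is large. -/
theorem IsPotential.smoothedGap_average_le_of_mu_eq_zero
    (hW : IsPotential P φp φd Yh q κp κd trial test W)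
    (h : IsAPDB trial test q z0 K z τ γ) (hq : q.Valid) (hf : P.FunAssumptions q.μ)
    (hYh : Yh ⊆ P.Y) (hφp : IsBregmanKernel P.X Lφ φp) (hφd : IsBregmanKernel Yh Lφ φd)
    (hκp : 0 < κp) (hκd : 0 < κd) (hz0 : z0 ∈ P.dom Yh) (hK : 0 < K) (hξ : 0 < ξ)
    (hav : average K z τ γ ∈ P.dom Yh) (hμ : q.μ = 0) {M : ℝ} (hM0 : 0 ≤ M)
    (hM : Lφ * max q.γ0 1 / 2 / totalWeight K τ γ ≤ M) (hMξ : 2 * M ≤ ξ) :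
    P.smoothedGap φp φd Yh ξ (average K z τ γ) ≤ 2 * M * ‖average K z τ γ - z0‖ ^ 2 := by
  refine csSup_le ⟨_, z0, hz0, rfl⟩ ?_
  rintro _ ⟨z', hz', rfl⟩
  have hT := h.totalWeight_pos hq hf.mu_nonneg hW.trial_mem hz0 hK
  have h1 := hW.average_gap h hq hf hYh hφp hφd hκp hκd hz0 hK hz'
  have h2 := div_le_div_of_nonneg_right (init_le hq.γ0_pos hφp hφd hz0 hz') hT.le
  set zb := average K z τ γ
  have h3 : Lφ * max q.γ0 1 / 2 * ‖z' - z0‖ ^ 2 / totalWeight K τ γ ≤ M * ‖z' - z0‖ ^ 2 := by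
    rw [mul_div_right_comm]
    exact mul_le_mul_of_nonneg_right hM (sq_nonneg _)
  have h4 := hφp.half_sq_le_breg hz'.1 hav.1
  have h5 := hφd.half_sq_le_breg hz'.2 hav.2
  have h6 : ξ * ‖z' - zb‖ ^ 2 ≤ 2 * ξ * (breg φp z'.fst zb.fst + breg φd z'.snd zb.snd) := by
    rw [norm_sub_sq_prod]
    have := mul_le_mul_of_nonneg_left (add_le_add h4 h5) (by positivity : 0 ≤ 2 * ξ)
    linarith
  have h7 : ‖z' - z0‖ ^ 2 ≤ 2 * ‖z' - zb‖ ^ 2 + 2 * ‖zb - z0‖ ^ 2 := by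
    have e : z' - z0 = (z' - zb) + (zb - z0) := by abel
    rw [e]
    nlinarith [norm_add_le (z' - zb) (zb - z0), norm_nonneg (z' - zb + (zb - z0)),
      sq_nonneg (‖z' - zb‖ - ‖zb - z0‖)]
  have h8 := mul_le_mul_of_nonneg_left h7 hM0
  have h9 := mul_le_mul_of_nonneg_right hMξ (sq_nonneg ‖z' - zb‖)
  rw [hμ] at h1
  linarith

/-- For `μ > 0`: the quadratic remainder in `IsPotential.average_gap` at the midpoint of `z'` and
the average is offset by the gain of strong convexity at that midpoint. -/
theorem IsPotential.smoothedGap_average_le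
    (hW : IsPotential P φp φd Yh q κp κd trial test W)
    (h : IsAPDB trial test q z0 K z τ γ) (hq : q.Valid) (hf : P.FunAssumptions q.μ)
    (hs : P.SetAssumptions) (hYc : Convex ℝ Yh)
    (hYh : Yh ⊆ P.Y) (hφp : IsBregmanKernel P.X Lφ φp) (hφd : IsBregmanKernel Yh Lφ φd)
    (hκp : 0 < κp) (hκd : 0 < κd) (hz0 : z0 ∈ P.dom Yh) (hK : 0 < K) (hξ : 0 < ξ)
    (hav : average K z τ γ ∈ P.dom Yh) {M : ℝ} (hM0 : 0 ≤ M)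
    (hM : Lφ * max q.γ0 1 / 2 / totalWeight K τ γ ≤ M) (hMξ : M ≤ ξ) :
    P.smoothedGap φp φd Yh ξ (average K z τ γ) ≤ 4 * M * ‖average K z τ γ - z0‖ ^ 2 := by
  refine csSup_le ⟨_, z0, hz0, rfl⟩ ?_
  rintro _ ⟨z', hz', rfl⟩
  have hT := h.totalWeight_pos hq hf.mu_nonneg hW.trial_mem hz0 hK
  set zb := average K z τ γ with hzb
  set zm : PDVec n p m := (1 / 2 : ℝ) • z' + (1 / 2 : ℝ) • zb with hzm
  have hzmd : zm ∈ P.dom Yh := P.convex_dom hs hYc hz' hav (by norm_num) (by norm_num) (by norm_num)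
  have h1 := hW.average_gap h hq hf hYh hφp hφd hκp hκd hz0 hK hzmd
  rw [← hzb] at h1
  have h2 := div_le_div_of_nonneg_right (init_le hq.γ0_pos hφp hφd hz0 hzmd) hT.le
  have h3 : Lφ * max q.γ0 1 / 2 * ‖zm - z0‖ ^ 2 / totalWeight K τ γ ≤ M * ‖zm - z0‖ ^ 2 := by
    rw [mul_div_right_comm]
    exact mul_le_mul_of_nonneg_right hM (sq_nonneg _)
  have h4 := hφp.half_sq_le_breg hz'.1 hav.1
  have h5 := hφd.half_sq_le_breg hz'.2 hav.2
  have h6 : ξ * ‖z' - zb‖ ^ 2 ≤ 2 * ξ * (breg φp z'.fst zb.fst + breg φd z'.snd zb.snd) := by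
    rw [norm_sub_sq_prod]
    have := mul_le_mul_of_nonneg_left (add_le_add h4 h5) (by positivity : 0 ≤ 2 * ξ)
    linarith
  have h7 : ‖zm - z0‖ ^ 2 ≤ 1 / 2 * ‖z' - zb‖ ^ 2 + 2 * ‖zb - z0‖ ^ 2 := by
    have e : zm - z0 = (1 / 2 : ℝ) • (z' - zb) + (zb - z0) := by rw [hzm]; module
    have h8 := norm_add_le ((1 / 2 : ℝ) • (z' - zb)) (zb - z0)
    rw [norm_smul, Real.norm_of_nonneg (by norm_num : (0 : ℝ) ≤ 1 / 2)] at h8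
    rw [e]
    nlinarith [norm_nonneg ((1 / 2 : ℝ) • (z' - zb) + (zb - z0)),
      sq_nonneg (1 / 2 * ‖z' - zb‖ - ‖zb - z0‖)]
  have h8 := mul_le_mul_of_nonneg_left h7 hM0
  have h9 := mul_le_mul_of_nonneg_right hMξ (sq_nonneg ‖z' - zb‖)
  have h10 : zm.fst - zb.fst = (1 / 2 : ℝ) • (z'.fst - zb.fst) := by
    change ((1 / 2 : ℝ) • z'.fst + (1 / 2 : ℝ) • zb.fst) - zb.fst = _
    module
  rw [h10, norm_smul, Real.norm_of_nonneg (by norm_num : (0 : ℝ) ≤ 1 / 2), mul_pow] at h1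
  have h11 : P.Phi zb.fst zm.snd = 1 / 2 * P.Phi zb.fst z'.snd + 1 / 2 * P.Phi zb.fst zb.snd := by
    have e : zm.snd = (1 / 2 : ℝ) • z'.snd + (1 / 2 : ℝ) • zb.snd := rfl
    rw [e, P.Phi_eq, P.Phi_eq, P.Phi_eq, inner_add_right, real_inner_smul_right,
      real_inner_smul_right]
    ring
  have h12 := (hf.strongConvexOn_Phi (hYh hav.2)).2 hz'.1 hav.1 (by norm_num : (0 : ℝ) ≤ 1 / 2)
    (by norm_num : (0 : ℝ) ≤ 1 / 2) (by norm_num)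
  simp only [smul_eq_mul] at h12
  change P.Phi zm.fst zb.snd ≤ _ at h12
  linarith

/-- Backtracking never goes below `τ̂ √(γ₀ / γ_k)` when every step size up to `Ψ √(γ₀ / γ_k)`
passes the test. -/
theorem IsAPDB.tauHat_le (h : IsAPDB trial test q z0 K z τ γ) (hq : q.Valid) (hμ : 0 ≤ q.μ)
    (hmem : ∀ {s τ w}, trial s τ w → w ∈ P.dom Yh)
    (hex : ∀ {s τ}, StateOK P Yh q s → 0 < τ → ∃ w, trial s τ w) (hz0 : z0 ∈ P.dom Yh) {Ψ : ℝ}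
    (hΨ : 0 < Ψ)
    (hsmall : ∀ k < K, ∀ t > 0, t ≤ Ψ * √(q.γ0 / γ k) → ∀ w, trial (stateAt q z τ γ k) t w →
      test (stateAt q z τ γ k) t w) {k : ℕ} (hk : k < K) :
    tauHat q Ψ * √(q.γ0 / γ k) ≤ τ k := by
  have hτh : 0 ≤ tauHat q Ψ := le_min hq.τbar_pos.le (mul_pos hq.η_pos hΨ).le
  have H : ∀ k < K, tauHat q Ψ * √(q.γ0 / γ k) ≤ firstTrial q z τ γ k →
      tauHat q Ψ * √(q.γ0 / γ k) ≤ τ k := by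
    intro k hk hft
    obtain ⟨j, hj, -, -, hmin⟩ := h.step k hk
    have hok := h.stateOK hq hμ hmem hz0 hk.le
    -- Either the first trial step is accepted, or the last rejected one exceeds `Ψ √(γ₀ / γ_k)`.
    rcases j with _ | j
    · rwa [hj, pow_zero, one_mul]
    · have ht : 0 < q.η ^ j * firstTrial q z τ γ k := mul_pos (pow_pos hq.η_pos j) hok.2
      obtain ⟨w, hw⟩ := hex hok.1 ht
      have h1 : ¬ q.η ^ j * firstTrial q z τ γ k ≤ Ψ * √(q.γ0 / γ k) := fun hle =>
        hmin j (Nat.lt_succ_self j) w hw (hsmall k hk _ ht hle w hw)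
      have h2 := mul_le_mul_of_nonneg_left (not_le.1 h1).le hq.η_pos.le
      have h3 : tauHat q Ψ * √(q.γ0 / γ k) ≤ q.η * Ψ * √(q.γ0 / γ k) :=
        mul_le_mul_of_nonneg_right (min_le_right _ _) (Real.sqrt_nonneg _)
      rw [hj, pow_succ]
      linarith
  induction k with
  | zero =>
    refine H 0 hk ?_
    rw [h.γ_zero, div_self hq.γ0_pos.ne', Real.sqrt_one, mul_one]
    exact min_le_left _ _
  | succ k ih =>
    refine H _ hk ?_
    have hk' : k < K := by omega
    have ih := ih hk'
    have hγ : 0 < γ k := hq.γ0_pos.trans_le (h.γ0_le hq hμ hmem hz0 hk'.le)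
    have hγ' : 0 < γ (k + 1) := hq.γ0_pos.trans_le (h.γ0_le hq hμ hmem hz0 hk.le)
    have hτ := h.τ_pos hq hμ hmem hz0 hk'
    have hτp := (h.stateOK hq hμ hmem hz0 hk'.le).1.τprev_pos
    have hc : 0 ≤ q.cnm := by rcases hq.cnm_mem with h | h <;> rw [h]; exact zero_le_one
    have e : q.γ0 / γ (k + 1) = q.γ0 / γ k * (γ k / γ (k + 1)) := by field_simp
    rw [firstTrial, e, Real.sqrt_mul (div_nonneg hq.γ0_pos.le hγ.le), ← mul_assoc]
    refine mul_le_mul ih (Real.sqrt_le_sqrt ?_) (Real.sqrt_nonneg _) hτ.le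
    refine le_mul_of_one_le_right (by positivity) ?_
    have : 0 ≤ q.cnm * (τ k / (stateAt q z τ γ k).τprev) := by positivity
    linarith

/-- Growth of the weights: `√(γ_k / γ₀)` increases by at least `μ t / 3` in each step if
`τ_k ≥ t √(γ₀ / γ_k)`. -/
theorem IsAPDB.weight_ge (h : IsAPDB trial test q z0 K z τ γ) (hq : q.Valid) (hμ : 0 ≤ q.μ)
    (hmem : ∀ {s τ w}, trial s τ w → w ∈ P.dom Yh) (hz0 : z0 ∈ P.dom Yh) {t : ℝ} (ht : 0 < t)
    (hμt : q.μ * t ≤ 3) (hτ : ∀ k < K, t * √(q.γ0 / γ k) ≤ τ k) {k : ℕ} (hk : k < K) :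
    q.γ0 * t * (1 + k * (q.μ * t / 3)) ≤ γ k * τ k := by
  have hstep : ∀ j < K, 0 < √(γ j / q.γ0) ∧ γ j = q.γ0 * √(γ j / q.γ0) ^ 2 ∧
      q.γ0 * t * √(γ j / q.γ0) ≤ γ j * τ j := by
    intro j hj
    have hγ : 0 < γ j := hq.γ0_pos.trans_le (h.γ0_le hq hμ hmem hz0 hj.le)
    have hg : 0 < √(γ j / q.γ0) := Real.sqrt_pos.2 (div_pos hγ hq.γ0_pos)
    have e : γ j = q.γ0 * √(γ j / q.γ0) ^ 2 := by
      rw [Real.sq_sqrt (div_pos hγ hq.γ0_pos).le, mul_div_cancel₀ _ hq.γ0_pos.ne']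
    refine ⟨hg, e, ?_⟩
    have h1 := hτ j hj
    have e2 : √(q.γ0 / γ j) = (√(γ j / q.γ0))⁻¹ := by rw [← Real.sqrt_inv, inv_div]
    rw [e2, ← div_eq_mul_inv, div_le_iff₀ hg] at h1
    have h2 := mul_le_mul_of_nonneg_left h1 (mul_pos hq.γ0_pos hg).le
    calc q.γ0 * t * √(γ j / q.γ0) ≤ q.γ0 * √(γ j / q.γ0) ^ 2 * τ j := by linarith
      _ = γ j * τ j := by rw [← e]
  have hgrow : ∀ j < K, 1 + j * (q.μ * t / 3) ≤ √(γ j / q.γ0) := by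
    intro j
    induction j with
    | zero =>
      intro _
      rw [h.γ_zero, div_self hq.γ0_pos.ne']
      simp
    | succ j ih =>
      intro hj
      have hj' : j < K := by omega
      have ih := ih hj'
      obtain ⟨hg, e, h1⟩ := hstep j hj'
      set g := √(γ j / q.γ0)
      have ha : 0 ≤ q.μ * t / 3 := by positivity
      refine le_trans (b := g + q.μ * t / 3) (by push_cast; linarith) ?_
      refine Real.le_sqrt_of_sq_le ?_
      rw [le_div_iff₀ hq.γ0_pos, h.γ_succ j hj', mul_add, mul_one]
      have h2 := mul_le_mul_of_nonneg_left h1 hμ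
      have h3 : 1 ≤ g := by
        have : 0 ≤ (j : ℝ) * (q.μ * t / 3) := by positivity
        linarith
      -- `(g + a)² ≤ g² + 3 a g` for `a = μ t / 3 ≤ 1 ≤ g`.
      have h4 : (q.μ * t / 3) * (q.μ * t / 3) ≤ (q.μ * t / 3) * g :=
        mul_le_mul_of_nonneg_left (by linarith) ha
      have h5 := mul_le_mul_of_nonneg_left h4 hq.γ0_pos.le
      have e' : γ j + γ j * (q.μ * τ j) = q.γ0 * g ^ 2 + q.μ * (γ j * τ j) := by
        rw [← e]; ring
      rw [e']
      linarith
  obtain ⟨-, -, h1⟩ := hstep k hk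
  exact (mul_le_mul_of_nonneg_left (hgrow k hk) (mul_pos hq.γ0_pos ht).le).trans h1

theorem IsAPDB.totalWeight_ge (h : IsAPDB trial test q z0 K z τ γ) (hq : q.Valid) (hμ : 0 ≤ q.μ)
    (hmem : ∀ {s τ w}, trial s τ w → w ∈ P.dom Yh) (hz0 : z0 ∈ P.dom Yh) {t : ℝ} (ht : 0 < t)
    (hμt : q.μ * t ≤ 3) (hτ : ∀ k < K, t * √(q.γ0 / γ k) ≤ τ k) :
    q.γ0 * t * (K + q.μ * t / 6 * (K * (K - 1))) ≤ totalWeight K τ γ := by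
  have h1 : ∑ k ∈ Finset.range K, q.γ0 * t * (1 + k * (q.μ * t / 3)) ≤ totalWeight K τ γ :=
    Finset.sum_le_sum fun k hk => h.weight_ge hq hμ hmem hz0 ht hμt hτ (Finset.mem_range.1 hk)
  refine le_of_eq_of_le ?_ h1
  clear h1 hτ h
  induction K with
  | zero => simp
  | succ K ih =>
    rw [Finset.sum_range_succ, ← ih]
    push_cast
    ring

/-- One restart period: the average stays close to its starting point, and quadratic growth turns
the bound on its smoothed gap into a contraction of the distance to the saddle points. -/
theorem IsPotential.period_contraction (hW : IsPotential P φp φd Yh q κp κd trial test W)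
    (h : IsAPDB trial test q z0 K z τ γ) (hq : q.Valid) (hf : P.FunAssumptions q.μ)
    (hs : P.SetAssumptions) (hYc : Convex ℝ Yh) (hY : IsClosed Yh)
    (hYh : Yh ⊆ P.Y) (hL : 0 < Lφ) (hφp : IsBregmanKernel P.X Lφ φp)
    (hφd : IsBregmanKernel Yh Lφ φd)
    (hκp : 0 < κp) (hκd : 0 < κd) (hz0 : z0 ∈ P.dom Yh) (hξ : 0 < ξ)
    (hne : (P.saddle Yh).Nonempty) {t ρ c : ℝ} (ht : 0 < t) (hμt : q.μ * t ≤ 3)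
    (hτ : ∀ k < K, t * √(q.γ0 / γ k) ≤ τ k) (hρ : 0 < ρ)
    (hc : c = √(Lφ * max q.γ0 1 / min κp κd)) (hK : PeriodLargeEnough q Lφ t c ξ ρ K) :
    average K z τ γ ∈ P.dom Yh ∧
    ‖average K z τ γ - z0‖ ≤ (c + 1) * Metric.infDist z0 (P.saddle Yh) ∧
    (Metric.infDist (average K z τ γ) (P.saddle Yh) ^ 2 ≤
        ρ * P.smoothedGap φp φd Yh ξ (average K z τ γ) →
      Metric.infDist (average K z τ γ) (P.saddle Yh) ≤
        Real.exp (-1) * Metric.infDist z0 (P.saddle Yh)) := by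
  have hμ := hf.mu_nonneg
  have hc0 : 0 ≤ c := hc ▸ Real.sqrt_nonneg _
  have hγ0 := hq.γ0_pos
  set m := min 1 q.γ0 with hm
  set X := max q.γ0 1 with hX
  have hmpos : 0 < m := lt_min one_pos hγ0
  have hXpos : 0 < X := lt_max_of_lt_right one_pos
  have hmX : m * X = q.γ0 := by rw [hm, hX, max_comm, min_mul_max, one_mul]
  have hKpos : 0 < K := by
    have : (0 : ℝ) < K := by
      rcases hμ.eq_or_lt with h0 | h0
      · refine lt_of_lt_of_le ?_ (hK.1 h0.symm)
        refine lt_max_of_lt_right ?_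
        have := hq.τbar_pos
        unfold c1
        positivity
      · exact lt_of_lt_of_le (lt_max_of_lt_right two_pos) (hK.2 h0)
    exact_mod_cast this
  have hKr : (0 : ℝ) < K := by exact_mod_cast hKpos
  have hav : average K z τ γ ∈ P.dom Yh :=
    h.average_mem hq hμ hW.trial_mem hz0 hKpos (P.convex_dom hs hYc) fun k hk =>
      h.mem_dom hq hμ hW.trial_mem hz0 hk
  obtain ⟨zs, hzs, hdist⟩ := (hf.isClosed_saddle hs hY).exists_infDist_eq_dist hne z0
  rw [dist_eq_norm] at hdist
  set d := Metric.infDist z0 (P.saddle Yh) with hd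
  have hclose : ‖average K z τ γ - zs‖ ≤ c * d := by
    have := h.average_mem hq hμ hW.trial_mem hz0 hKpos (convex_closedBall zs (c * d))
      fun k hk => by
        rw [Metric.mem_closedBall, dist_eq_norm, hdist, hc]
        exact hW.norm_sub_saddle_le h hq hf hs hYh hL hφp hφd hκp hκd hz0 hzs hk
    rwa [Metric.mem_closedBall, dist_eq_norm] at this
  have hz0s : ‖zs - z0‖ = d := by rw [norm_sub_rev, hdist]
  have htri : ‖average K z τ γ - z0‖ ≤ ‖average K z τ γ - zs‖ + ‖zs - z0‖ := by
    have := norm_add_le (average K z τ γ - zs) (zs - z0)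
    rwa [sub_add_sub_cancel] at this
  refine ⟨hav, by linarith, fun hqg => ?_⟩
  have hT := h.totalWeight_pos hq hμ hW.trial_mem hz0 hKpos
  have hTge := h.totalWeight_ge hq hμ hW.trial_mem hz0 ht hμt hτ
  -- `C` is `c₁ / K` for `μ = 0` and `c₃ / K²` for `μ > 0`.
  obtain ⟨C, hC0, hgap, hCK⟩ : ∃ C : ℝ, 0 ≤ C ∧
      P.smoothedGap φp φd Yh ξ (average K z τ γ) ≤ 2 * C * ‖average K z τ γ - z0‖ ^ 2 ∧
      4 * Real.exp 1 ^ 2 * ρ * C * (1 + c ^ 2) ≤ 1 := by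
    rcases hμ.eq_or_lt with h0 | h0
    · have hc1 : c1 q Lφ t = Lφ / (2 * t * m) := by
        have e : min q.τbar (q.γ0 * q.τbar) = m * q.τbar := by
          rw [hm, min_mul_of_nonneg _ _ hq.τbar_pos.le, one_mul]
        have := hq.τbar_pos
        rw [c1, e]
        field_simp
      obtain ⟨hK1, hK2⟩ := max_le_iff.1 (hK.1 h0.symm)
      have hc1pos : 0 < c1 q Lφ t := hc1 ▸ by positivity
      refine ⟨c1 q Lφ t / K, by positivity,
        hW.smoothedGap_average_le_of_mu_eq_zero h hq hf hYh hφp hφd hκp hκd hz0 hKpos hξ hav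
          h0.symm (by positivity) ?_ ?_, ?_⟩
      · rw [← h0, zero_mul, zero_div, zero_mul, add_zero] at hTge
        rw [div_le_div_iff₀ hT hKr]
        refine le_trans (le_of_eq ?_) (mul_le_mul_of_nonneg_left hTge hc1pos.le)
        rw [hc1, ← hX, ← hmX]
        field_simp
      · rw [div_le_iff₀ hξ] at hK2
        rw [mul_div_assoc', div_le_iff₀ hKr]
        linarith
      · rw [mul_div_assoc', div_mul_eq_mul_div, div_le_one hKr]
        exact hK1
    · have hc3 : c3 q Lφ t = 6 * Lφ / (q.μ * t ^ 2 * m) := by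
        rw [c3, ← hm]
        field_simp
      have hc3pos : 0 < c3 q Lφ t := hc3 ▸ by positivity
      obtain ⟨hK12, -⟩ := max_le_iff.1 (hK.2 h0)
      obtain ⟨hK1, hK2⟩ := max_le_iff.1 hK12
      have hK2' : 2 * c3 q Lφ t / ξ ≤ (K : ℝ) ^ 2 := (Real.sqrt_le_left hKr.le).1 hK2
      have hK1' : 4 * Real.exp 1 ^ 2 * ρ * c3 q Lφ t * (1 + c ^ 2) ≤ (K : ℝ) ^ 2 := by
        have h1 := pow_le_pow_left₀ (by positivity) hK1 2
        rw [mul_pow, Real.sq_sqrt (by positivity)] at h1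
        linarith
      have hMξ : c3 q Lφ t / (2 * (K : ℝ) ^ 2) ≤ ξ := by
        rw [div_le_iff₀ hξ] at hK2'
        rw [div_le_iff₀ (by positivity)]
        have : 0 ≤ (K : ℝ) ^ 2 * ξ := by positivity
        linarith
      refine ⟨c3 q Lφ t / (K : ℝ) ^ 2, by positivity, ?_, ?_⟩
      · have := hW.smoothedGap_average_le h hq hf hs hYc hYh hφp hφd hκp hκd hz0 hKpos hξ hav
          (M := c3 q Lφ t / (2 * (K : ℝ) ^ 2)) (by positivity) ?_ hMξ
        · refine this.trans_eq ?_
          field_simp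
          ring
        · have hT6 : q.γ0 * q.μ * t ^ 2 * (K : ℝ) ^ 2 / 6 ≤ totalWeight K τ γ := by
            refine le_trans ?_ hTge
            have h1 : 0 ≤ q.γ0 * t * K * (1 - q.μ * t / 6) :=
              mul_nonneg (by positivity) (by linarith)
            linarith
          rw [div_le_div_iff₀ hT (by positivity)]
          refine le_trans (le_of_eq ?_) (mul_le_mul_of_nonneg_left hT6 hc3pos.le)
          rw [hc3, ← hX, ← hmX]
          field_simp
      · rw [mul_div_assoc', div_mul_eq_mul_div, div_le_one (by positivity)]
        exact hK1'
  set zb := average K z τ γ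
  have h1 : ‖zb - z0‖ ^ 2 ≤ 2 * (1 + c ^ 2) * d ^ 2 := by
    have h2 : ‖zb - z0‖ ≤ c * d + d := by linarith
    have h3 := pow_le_pow_left₀ (norm_nonneg _) h2 2
    nlinarith [sq_nonneg (c * d - d)]
  have h2 : Metric.infDist zb (P.saddle Yh) ^ 2 ≤ ρ * (2 * C * (2 * (1 + c ^ 2) * d ^ 2)) :=
    hqg.trans (mul_le_mul_of_nonneg_left
      (hgap.trans (mul_le_mul_of_nonneg_left h1 (by positivity))) hρ.le)
  have he : Real.exp (-1) * Real.exp 1 = 1 := by rw [← Real.exp_add]; simp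
  have h3 : Metric.infDist zb (P.saddle Yh) ^ 2 ≤ (Real.exp (-1) * d) ^ 2 := by
    have h4 := mul_le_mul_of_nonneg_left hCK (by positivity : 0 ≤ (Real.exp (-1) * d) ^ 2)
    have h5 : (Real.exp (-1) * d) ^ 2 * (4 * Real.exp 1 ^ 2 * ρ * C * (1 + c ^ 2)) =
        (Real.exp (-1) * Real.exp 1) ^ 2 * (ρ * (2 * C * (2 * (1 + c ^ 2) * d ^ 2))) := by
      ring
    rw [h5, he] at h4
    linarith
  exact abs_le_of_sq_le_sq' h3 (mul_nonneg (Real.exp_pos _).le Metric.infDist_nonneg) |>.2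

end Period

/-! ### Existence of runs and convergence of the restarted method -/

section Restart

variable {n p m : ℕ} {P : ConicProgram n p m} {q : Params} {φp : Vec n → ℝ}
  {φd : DualVec p m → ℝ} {Lφ ξ κp κd : ℝ} {Yh : Set (DualVec p m)}
  {trial test : IterState n p m → ℝ → PDVec n p m → Prop}
  {W : IterState n p m → PDVec n p m → ℝ} {z0 : PDVec n p m} {K : ℕ}
  {z z' : ℕ → PDVec n p m} {τ τ' γ γ' : ℕ → ℝ}

theorem stateAt_congr {k : ℕ} (hz : ∀ i ≤ k, z i = z' i) (hτ : ∀ i < k, τ i = τ' i)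
    (hγ : ∀ i ≤ k, γ i = γ' i) : stateAt q z τ γ k = stateAt q z' τ' γ' k := by
  cases k with
  | zero => simp only [stateAt, hz 0 le_rfl, hγ 0 le_rfl]
  | succ k =>
    simp only [stateAt, hz (k + 1) le_rfl, hz k k.le_succ, hτ k k.lt_succ_self,
      hγ (k + 1) le_rfl, hγ k k.le_succ]

theorem firstTrial_congr {k : ℕ} (hz : ∀ i ≤ k, z i = z' i) (hτ : ∀ i < k, τ i = τ' i)
    (hγ : ∀ i ≤ k, γ i = γ' i) : firstTrial q z τ γ k = firstTrial q z' τ' γ' k := by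
  cases k with
  | zero => rfl
  | succ k =>
    simp only [firstTrial, hτ k k.lt_succ_self, hγ (k + 1) le_rfl, hγ k k.le_succ]
    rw [stateAt_congr (fun i hi => hz i (hi.trans k.le_succ))
      (fun i hi => hτ i (hi.trans k.lt_succ_self)) (fun i hi => hγ i (hi.trans k.le_succ))]

/-- One more iteration: backtracking stops because small step sizes pass the test. -/
theorem IsAPDB.exists_succ (hW : IsPotential P φp φd Yh q κp κd trial test W)
    (h : IsAPDB trial test q z0 K z τ γ) (hq : q.Valid) (hμ : 0 ≤ q.μ) (hz0 : z0 ∈ P.dom Yh)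
    {b : ℝ} (hb : 0 < b) (hsmall : ∀ t > 0, t ≤ b → ∀ w, trial (stateAt q z τ γ K) t w →
      test (stateAt q z τ γ K) t w) :
    ∃ z τ γ, IsAPDB trial test q z0 (K + 1) z τ γ := by
  classical
  obtain ⟨hok, hft⟩ := h.stateOK hq hμ hW.trial_mem hz0 le_rfl
  set s := stateAt q z τ γ K with hs
  set f := firstTrial q z τ γ K with hf
  have hex : ∃ j : ℕ, ∃ w, trial s (q.η ^ j * f) w ∧ test s (q.η ^ j * f) w := by
    have hlim : Tendsto (fun j : ℕ => q.η ^ j * f) atTop (𝓝 (0 * f)) :=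
      (tendsto_pow_atTop_nhds_zero_of_lt_one hq.η_pos.le hq.η_lt_one).mul_const f
    rw [zero_mul] at hlim
    obtain ⟨j, hj⟩ := (hlim.eventually (gt_mem_nhds hb)).exists
    have hpos : 0 < q.η ^ j * f := mul_pos (pow_pos hq.η_pos j) hft
    obtain ⟨w, hw⟩ := hW.exists_trial hok hpos
    exact ⟨j, w, hw, hsmall _ hpos hj.le w hw⟩
  obtain ⟨w, htr, hte⟩ := Nat.find_spec hex
  set j := Nat.find hex with hj
  set t := q.η ^ j * f with ht
  have hz : ∀ i ≤ K, Function.update z (K + 1) w i = z i := fun i hi =>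
    Function.update_of_ne (by omega) _ _
  have hτ : ∀ i < K, Function.update τ K t i = τ i := fun i hi =>
    Function.update_of_ne (by omega) _ _
  have hγ : ∀ i ≤ K, Function.update γ (K + 1) (γ K * (1 + q.μ * t)) i = γ i := fun i hi =>
    Function.update_of_ne (by omega) _ _
  refine ⟨Function.update z (K + 1) w, Function.update τ K t,
    Function.update γ (K + 1) (γ K * (1 + q.μ * t)), ?_, ?_, ?_, ?_⟩
  · rw [hz 0 K.zero_le, h.z_zero]
  · rw [hγ 0 K.zero_le, h.γ_zero]
  · intro k hk
    rcases Nat.lt_succ_iff_lt_or_eq.1 hk with hk | rfl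
    · rw [hγ k hk.le, hγ (k + 1) hk, hτ k hk, h.γ_succ k hk]
    · rw [hγ k le_rfl, Function.update_self, Function.update_self]
  · intro k hk
    have hkK : k ≤ K := by omega
    rw [stateAt_congr (z' := z) (τ' := τ) (γ' := γ) (fun i hi => hz i (hi.trans hkK))
        (fun i hi => hτ i (hi.trans_le hkK)) (fun i hi => hγ i (hi.trans hkK)),
      firstTrial_congr (z' := z) (τ' := τ) (γ' := γ) (fun i hi => hz i (hi.trans hkK))
        (fun i hi => hτ i (hi.trans_le hkK)) (fun i hi => hγ i (hi.trans hkK))]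
    rcases Nat.lt_succ_iff_lt_or_eq.1 hk with hk | rfl
    · rw [hτ k hk, hz (k + 1) hk]
      exact h.step k hk
    · rw [Function.update_self, Function.update_self, ← hs, ← hf]
      exact ⟨j, rfl, htr, hte, fun i hi w' hw' hte' => Nat.find_min hex hi ⟨w', hw', hte'⟩⟩

theorem exists_isAPDB (hW : IsPotential P φp φd Yh q κp κd trial test W) (hq : q.Valid)
    (hμ : 0 ≤ q.μ) (hz0 : z0 ∈ P.dom Yh) {Ψ : ℝ} (hΨ : 0 < Ψ)
    (hsmall : ∀ k z τ γ, IsAPDB trial test q z0 k z τ γ → ∀ t > 0, t ≤ Ψ * √(q.γ0 / γ k) →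
      ∀ w, trial (stateAt q z τ γ k) t w → test (stateAt q z τ γ k) t w) (K : ℕ) :
    ∃ z τ γ, IsAPDB trial test q z0 K z τ γ := by
  induction K with
  | zero =>
    exact ⟨fun _ => z0, fun _ => 0, fun _ => q.γ0, rfl, rfl, fun k hk => absurd hk k.not_lt_zero,
      fun k hk => absurd hk k.not_lt_zero⟩
  | succ K ih =>
    obtain ⟨z, τ, γ, h⟩ := ih
    have hγ : 0 < γ K := hq.γ0_pos.trans_le (h.γ0_le hq hμ hW.trial_mem hz0 le_rfl)
    exact h.exists_succ hW hq hμ hz0 (mul_pos hΨ (Real.sqrt_pos.2 (div_pos hq.γ0_pos hγ)))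
      (hsmall K z τ γ h)

/-- Convergence of the restarted method, for any method with a potential all of whose small steps
pass the test.  By induction the `t`-th restart point is within `e⁻ᵗ dist(z⁰, Z*)` of the saddle
points and within `R (1 - e⁻ᵗ)` of `z⁰`, where `R` is the sum of the geometric series of the
displacement bounds; so quadratic growth is needed only on the ball of radius `R`. -/
theorem IsPotential.restart_converges (hW : IsPotential P φp φd Yh q κp κd trial test W)
    (hq : q.Valid) (hf : P.FunAssumptions q.μ)
    (hs : P.SetAssumptions) (hYc : Convex ℝ Yh) (hY : IsClosed Yh)
    (hYh : Yh ⊆ P.Y) (hL : 0 < Lφ) (hφp : IsBregmanKernel P.X Lφ φp)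
    (hφd : IsBregmanKernel Yh Lφ φd)
    (hκp : 0 < κp) (hκd : 0 < κd) (hz0 : z0 ∈ P.dom Yh) (hξ : 0 < ξ)
    (hne : (P.saddle Yh).Nonempty) {Ψ ρ c R : ℝ} (hΨ : 0 < Ψ) (hμΨ : q.μ * Ψ ≤ 3) (hρ : 0 < ρ)
    (hc : c = √(Lφ * max q.γ0 1 / min κp κd))
    (hR : R = (c + 1) / (1 - 1 / Real.exp 1) * Metric.infDist z0 (P.saddle Yh))
    (hK : PeriodLargeEnough q Lφ (tauHat q Ψ) c ξ ρ K)
    (hqg : P.QuadGrowth φp φd Yh ξ {z | z ∈ P.dom Yh ∧ ‖z - z0‖ ≤ R} ρ)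
    (hsmall : ∀ z1 ∈ P.dom Yh, ‖z1 - z0‖ ≤ R → ∀ k z τ γ, IsAPDB trial test q z1 k z τ γ →
      ∀ t > 0, t ≤ Ψ * √(q.γ0 / γ k) → ∀ w, trial (stateAt q z τ γ k) t w →
        test (stateAt q z τ γ k) t w) :
    (∃ Z, IsRestarted trial test q z0 K Z) ∧ ∀ Z, IsRestarted trial test q z0 K Z →
      (∀ t, ‖Z t - z0‖ ≤ R) ∧
      (∀ t : ℕ, Metric.infDist (Z t) (P.saddle Yh) ≤
        Real.exp (-(t : ℝ)) * Metric.infDist z0 (P.saddle Yh)) ∧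
      ∃ zs ∈ P.saddle Yh, Tendsto Z atTop (𝓝 zs) := by
  have hμ := hf.mu_nonneg
  set D := Metric.infDist z0 (P.saddle Yh) with hD
  have hD0 : 0 ≤ D := Metric.infDist_nonneg
  have hc0 : 0 ≤ c := hc ▸ Real.sqrt_nonneg _
  set r := Real.exp (-1) with hr
  have hr0 : 0 < r := Real.exp_pos _
  have hr1 : r < 1 := Real.exp_lt_one_iff.2 (by norm_num)
  have hre : 1 / Real.exp 1 = r := by rw [hr, Real.exp_neg, one_div]
  rw [hre] at hR
  have hRr : R * (1 - r) = (c + 1) * D := by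
    rw [hR]
    have : 1 - r ≠ 0 := by linarith
    field_simp
  have hR0 : 0 ≤ R := by
    rw [hR]
    have : 0 < 1 - r := by linarith
    positivity
  have hτh : 0 < tauHat q Ψ := lt_min hq.τbar_pos (mul_pos hq.η_pos hΨ)
  have hμτ : q.μ * tauHat q Ψ ≤ 3 := by
    have h1 : tauHat q Ψ ≤ Ψ :=
      (min_le_right _ _).trans (mul_le_of_le_one_left hΨ.le hq.η_lt_one.le)
    exact (mul_le_mul_of_nonneg_left h1 hμ).trans hμΨ
  let Good : ℕ → PDVec n p m → Prop := fun t w => w ∈ P.dom Yh ∧ ‖w - z0‖ ≤ R * (1 - r ^ t) ∧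
    Metric.infDist w (P.saddle Yh) ≤ r ^ t * D
  have hball : ∀ t w, Good t w → ‖w - z0‖ ≤ R := fun t w hw =>
    hw.2.1.trans (mul_le_of_le_one_right hR0 (by linarith [pow_pos hr0 t]))
  have hgood0 : Good 0 z0 := ⟨hz0, by simp, by simp [hD]⟩
  have hrun : ∀ t w, Good t w → ∃ z τ γ, IsAPDB trial test q w K z τ γ := fun t w hw =>
    exists_isAPDB hW hq hμ hw.1 hΨ (hsmall w hw.1 (hball t w hw)) K
  have hnext : ∀ t w, Good t w → ∀ z τ γ, IsAPDB trial test q w K z τ γ →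
      Good (t + 1) (average K z τ γ) ∧ ‖average K z τ γ - w‖ ≤ (c + 1) * D * r ^ t := by
    intro t w hw z τ γ h
    have hτ : ∀ k < K, tauHat q Ψ * √(q.γ0 / γ k) ≤ τ k := fun k hk =>
      h.tauHat_le hq hμ hW.trial_mem hW.exists_trial hw.1 hΨ
        (fun k hk => hsmall w hw.1 (hball t w hw) k z τ γ (h.mono hk.le)) hk
    obtain ⟨h1, h2, h3⟩ := hW.period_contraction h hq hf hs hYc hY hYh hL hφp hφd hκp hκd hw.1 hξ
      hne hτh hμτ hτ hρ hc hK
    have h4 : ‖average K z τ γ - w‖ ≤ (c + 1) * D * r ^ t :=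
      h2.trans ((mul_le_mul_of_nonneg_left hw.2.2 (by positivity)).trans_eq (by ring))
    have h5 : ‖average K z τ γ - z0‖ ≤ R * (1 - r ^ (t + 1)) := by
      have h6 := norm_add_le (average K z τ γ - w) (w - z0)
      rw [sub_add_sub_cancel] at h6
      have h7 := hw.2.1
      rw [← hRr] at h4
      rw [pow_succ]
      linarith
    have h6 : ‖average K z τ γ - z0‖ ≤ R :=
      h5.trans (mul_le_of_le_one_right hR0 (by linarith [pow_pos hr0 (t + 1)]))
    refine ⟨⟨h1, h5, (h3 (hqg _ ⟨h1, h6⟩)).trans ?_⟩, h4⟩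
    rw [pow_succ]
    exact (mul_le_mul_of_nonneg_left hw.2.2 hr0.le).trans_eq (by ring)
  refine ⟨?_, fun Z hZ => ?_⟩
  · choose! z τ γ hzτγ using hrun
    let Z : ℕ → PDVec n p m := fun t => Nat.rec z0 (fun t w => average K (z t w) (τ t w) (γ t w)) t
    have hgood : ∀ t, Good t (Z t) := by
      intro t
      induction t with
      | zero => exact hgood0
      | succ t ih => exact (hnext t (Z t) ih _ _ _ (hzτγ t (Z t) ih)).1
    exact ⟨Z, rfl, fun t => ⟨_, _, _, hzτγ t (Z t) (hgood t), rfl⟩⟩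
  · have hgood : ∀ t, Good t (Z t) := by
      intro t
      induction t with
      | zero => exact hZ.1 ▸ hgood0
      | succ t ih =>
        obtain ⟨z, τ, γ, h, e⟩ := hZ.2 t
        exact e ▸ (hnext t (Z t) ih z τ γ h).1
    refine ⟨fun t => hball t _ (hgood t), fun t => ?_, ?_⟩
    · have e : Real.exp (-(t : ℝ)) = r ^ t := by
        rw [hr, ← Real.exp_nat_mul, mul_neg_one]
      exact e ▸ (hgood t).2.2
    · have hcauchy : CauchySeq Z := by
        refine cauchySeq_of_le_geometric r ((c + 1) * D) hr1 fun t => ?_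
        obtain ⟨z, τ, γ, h, e⟩ := hZ.2 t
        rw [dist_comm, dist_eq_norm, e]
        exact (hnext t (Z t) (hgood t) z τ γ h).2
      obtain ⟨zs, hzs⟩ := cauchySeq_tendsto_of_complete hcauchy
      refine ⟨zs, ?_, hzs⟩
      rw [(hf.isClosed_saddle hs hY).mem_iff_infDist_zero hne]
      refine le_antisymm ?_ Metric.infDist_nonneg
      have h1 : Tendsto (fun t => Metric.infDist (Z t) (P.saddle Yh)) atTop
          (𝓝 (Metric.infDist zs (P.saddle Yh))) :=
        ((Metric.continuous_infDist_pt _).tendsto zs).comp hzs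
      have h2 : Tendsto (fun t : ℕ => r ^ t * D) atTop (𝓝 (0 * D)) :=
        (tendsto_pow_atTop_nhds_zero_of_lt_one hr0.le hr1).mul_const D
      rw [zero_mul] at h2
      exact le_of_tendsto_of_tendsto' h1 h2 fun t => (hgood t).2.2

end Restart

/-! ### Small steps pass the backtracking tests -/

section SmallSteps

variable {n p m : ℕ} {P : ConicProgram n p m} {q : Params} {φp : Vec n → ℝ}
  {φd : DualVec p m → ℝ} {Lφ Lxx Lxy Lyx κp κd : ℝ} {Yh : Set (DualVec p m)}
  {s : IterState n p m} {τ : ℝ} {w : PDVec n p m}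

theorem mul_sq_le_of_le_sqrt {γ0 γ t Ψ : ℝ} (hγ0 : 0 < γ0) (hγ : 0 < γ) (ht : 0 < t)
    (h : t ≤ Ψ * √(γ0 / γ)) : γ * t ^ 2 ≤ γ0 * Ψ ^ 2 := by
  have h1 := pow_le_pow_left₀ ht.le h 2
  rw [mul_pow, Real.sq_sqrt (div_pos hγ0 hγ).le] at h1
  have h2 := mul_le_mul_of_nonneg_left h1 hγ.le
  have e : γ * (Ψ ^ 2 * (γ0 / γ)) = γ0 * Ψ ^ 2 := by field_simp
  linarith

theorem Psi1_pos (hγ0 : 0 < q.γ0) (hα : 0 < q.cα) (hβ : 0 < q.cβ)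
    (hsum : q.cα + q.cβ + q.δ < 1) (hxx : 0 < Lxx) (hxy : 0 < Lxy) : 0 < Psi1 q Lxx Lxy := by
  have h1 : 0 < 1 - q.δ := by linarith
  have h2 : 0 < 1 - (q.cα + q.cβ + q.δ) := by linarith
  refine lt_min ?_ ?_ <;> positivity

theorem sq_Psi1_le (hγ0 : 0 < q.γ0) (hα : 0 < q.cα) (hβ : 0 < q.cβ)
    (hsum : q.cα + q.cβ + q.δ < 1) (hxx : 0 < Lxx) (hxy : 0 < Lxy) :
    q.γ0 * Psi1 q Lxx Lxy ^ 2 * Lxy ^ 2 ≤ q.cα * (1 - q.δ) ∧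
    Psi1 q Lxx Lxy ^ 2 * Lxx ^ 2 ≤ q.cβ * (1 - (q.cα + q.cβ + q.δ)) := by
  have hΨ := (Psi1_pos hγ0 hα hβ hsum hxx hxy).le
  have h1 : 0 < 1 - q.δ := by linarith
  have h2 : 0 < 1 - (q.cα + q.cβ + q.δ) := by linarith
  constructor
  · have h3 := pow_le_pow_left₀ hΨ (min_le_left _ _ : Psi1 q Lxx Lxy ≤ _) 2
    rw [div_pow, mul_pow, Real.sq_sqrt hγ0.le, Real.sq_sqrt (by positivity),
      le_div_iff₀ (by positivity)] at h3
    linarith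
  · have h3 := pow_le_pow_left₀ hΨ (min_le_right _ _ : Psi1 q Lxx Lxy ≤ _) 2
    rwa [div_pow, Real.sq_sqrt (by positivity), le_div_iff₀ (by positivity)] at h3

theorem mu_mul_Psi1_le (hγ0 : 0 < q.γ0) (hα : 0 < q.cα) (hβ : 0 < q.cβ) (hδ : 0 ≤ q.δ)
    (hsum : q.cα + q.cβ + q.δ < 1) (hxx : 0 < Lxx) (hxy : 0 < Lxy) (hμ : q.μ ≤ Lxx) :
    q.μ * Psi1 q Lxx Lxy ≤ 3 := by
  have hΨ := Psi1_pos hγ0 hα hβ hsum hxx hxy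
  have h1 := (sq_Psi1_le hγ0 hα hβ hsum hxx hxy).2
  have h2 : q.cβ * (1 - (q.cα + q.cβ + q.δ)) ≤ 1 * 1 :=
    mul_le_mul (by linarith) (by linarith) (by linarith) zero_le_one
  have h3 : (Psi1 q Lxx Lxy * Lxx) ^ 2 ≤ 1 ^ 2 := by rw [mul_pow]; linarith
  have h4 := abs_le_of_sq_le_sq' h3 zero_le_one |>.2
  have h5 := mul_le_mul_of_nonneg_right hμ hΨ.le
  linarith

/-- A sufficiently small step passes the test of APDB-xy, given the Lipschitz estimates along the
segment from the current point to the candidate. -/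
theorem xyTest_of_small (hγ0 : 0 < q.γ0) (hφp : IsBregmanKernel P.X Lφ φp)
    (hφd : IsBregmanKernel P.Y Lφ φd) (hα : 0 < q.cα) (hβ : 0 < q.cβ)
    (hsum : q.cα + q.cβ + q.δ < 1) (hxx : 0 < Lxx) (hxy : 0 < Lxy) (hs : StateOK P P.Y q s)
    (hτ : 0 < τ) (hτΨ : τ ≤ Psi1 q Lxx Lxy * √(q.γ0 / s.γ)) (hw : w ∈ P.dom P.Y)
    (hx : ‖P.gradX w.fst s.z.snd - P.gradX s.z.fst s.z.snd‖ ≤ Lxx * ‖w.fst - s.z.fst‖)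
    (hy : ‖P.gradX w.fst w.snd - P.gradX w.fst s.z.snd‖ ≤ Lxy * ‖w.snd - s.z.snd‖) :
    xyTest P φp φd q s τ w := by
  obtain ⟨hz, -, hτp, hσp, hγ, hστ⟩ := hs
  have hγpos : 0 < s.γ := hγ0.trans_le hγ
  obtain ⟨hΨ1, hΨ2⟩ := sq_Psi1_le hγ0 hα hβ hsum hxx hxy
  have hsq := mul_sq_le_of_le_sqrt hγ0 hγpos hτ hτΨ
  have hDp := hφp.half_sq_le_breg hw.1 hz.1
  have hDd := hφd.half_sq_le_breg hw.2 hz.2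
  have hDp0 := hφp.breg_nonneg hw.1 hz.1
  have hDd0 := hφd.breg_nonneg hw.2 hz.2
  have hx2 := pow_le_pow_left₀ (norm_nonneg _) hx 2
  have hy2 := pow_le_pow_left₀ (norm_nonneg _) hy 2
  rw [mul_pow] at hx2 hy2
  unfold xyTest
  simp only
  set Dp := breg φp w.fst s.z.fst
  set Dd := breg φd w.snd s.z.snd
  set σ := s.γ * τ with hσ
  have hσpos : 0 < σ := by positivity
  have hyterm : 1 / (2 * (q.cα / τ)) *
      ‖P.gradX w.fst w.snd - P.gradX w.fst s.z.snd‖ ^ 2 ≤ (1 - q.δ) / σ * Dd := by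
    have h1 : ‖P.gradX w.fst w.snd - P.gradX w.fst s.z.snd‖ ^ 2 ≤ Lxy ^ 2 * (2 * Dd) :=
      hy2.trans (mul_le_mul_of_nonneg_left (by linarith) (by positivity))
    refine (mul_le_mul_of_nonneg_left h1 (by positivity)).trans ?_
    have e : 1 / (2 * (q.cα / τ)) * (Lxy ^ 2 * (2 * Dd)) = τ * Lxy ^ 2 / q.cα * Dd := by
      field_simp
    rw [e]
    refine mul_le_mul_of_nonneg_right ?_ hDd0
    rw [div_le_div_iff₀ hα hσpos, hσ]
    have h2 := mul_le_mul_of_nonneg_right hsq (sq_nonneg Lxy)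
    linarith
  have hxterm : 1 / (2 * (q.γ0 * q.cβ / σ)) *
      ‖P.gradX w.fst s.z.snd - P.gradX s.z.fst s.z.snd‖ ^ 2 ≤
      (1 - (q.cα + q.cβ + q.δ)) / τ * Dp := by
    have h1 : ‖P.gradX w.fst s.z.snd - P.gradX s.z.fst s.z.snd‖ ^ 2 ≤ Lxx ^ 2 * (2 * Dp) :=
      hx2.trans (mul_le_mul_of_nonneg_left (by linarith) (by positivity))
    refine (mul_le_mul_of_nonneg_left h1 (by positivity)).trans ?_
    have e : 1 / (2 * (q.γ0 * q.cβ / σ)) * (Lxx ^ 2 * (2 * Dp)) =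
        σ * Lxx ^ 2 / (q.γ0 * q.cβ) * Dp := by
      field_simp
    rw [e]
    refine mul_le_mul_of_nonneg_right ?_ hDp0
    rw [div_le_div_iff₀ (by positivity) hτ, hσ]
    have h2 := mul_le_mul_of_nonneg_right hsq (sq_nonneg Lxx)
    have h3 := mul_le_mul_of_nonneg_left hΨ2 hγ0.le
    linarith
  have hθ : s.σprev / σ * (q.cα / s.τprev + q.γ0 * q.cβ / s.σprev) ≤ (q.cα + q.cβ) / τ := by
    have e : s.σprev / σ * (q.cα / s.τprev + q.γ0 * q.cβ / s.σprev) =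
        (s.σprev / s.τprev * q.cα + q.γ0 * q.cβ) / σ := by field_simp
    rw [e, div_le_div_iff₀ hσpos hτ, hσ]
    have h6 := mul_le_mul_of_nonneg_right ((div_le_iff₀ hτp).2 hστ) hα.le
    have h8 := mul_le_mul_of_nonneg_right hγ hβ.le
    have h9 := mul_le_mul_of_nonneg_right (add_le_add h6 h8) hτ.le
    linarith
  have hθ' := mul_le_mul_of_nonneg_right hθ hDp0
  have e1 : (1 - (q.cα + q.cβ + q.δ)) / τ * Dp =
      1 / τ * Dp - (q.cα + q.cβ) / τ * Dp - q.δ / τ * Dp := by ring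
  have e2 : (1 - q.δ) / σ * Dd = 1 / σ * Dd - q.δ / σ * Dd := by ring
  rw [e1] at hxterm
  rw [e2] at hyterm
  linarith

theorem Psi2_pos (hγ0 : 0 < q.γ0) (hα : 0 < q.cα) (hδ : q.δ < 1) (hxx : 0 < Lxx)
    (hyx : 0 < Lyx) : 0 < Psi2 q Lxx Lyx := by
  have h1 : 0 < 1 - q.δ := by linarith
  have h2 : 1 < √(1 + 4 * (1 - q.δ) * q.γ0 / q.cα * (Lyx ^ 2 / Lxx ^ 2)) := by
    rw [Real.lt_sqrt zero_le_one]
    have : 0 < 4 * (1 - q.δ) * q.γ0 / q.cα * (Lyx ^ 2 / Lxx ^ 2) := by positivity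
    linarith
  exact mul_pos (by positivity) (by linarith)

/-- `Ψ₂` is the positive root of `L_xx t + (γ₀ L_yx² / c_α) t² = 1 - δ`. -/
theorem Psi2_root (hγ0 : 0 < q.γ0) (hα : 0 < q.cα) (hδ : q.δ < 1) (hxx : 0 < Lxx)
    (hyx : 0 < Lyx) : Lxx * Psi2 q Lxx Lyx + q.γ0 * Psi2 q Lxx Lyx ^ 2 * (Lyx ^ 2 / q.cα) =
      1 - q.δ := by
  have h1 : 0 < 1 - q.δ := by linarith
  have h2 := Real.sq_sqrt (by positivity :
    0 ≤ 1 + 4 * (1 - q.δ) * q.γ0 / q.cα * (Lyx ^ 2 / Lxx ^ 2))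
  unfold Psi2
  set S := √(1 + 4 * (1 - q.δ) * q.γ0 / q.cα * (Lyx ^ 2 / Lxx ^ 2))
  have e : Lxx * (q.cα / (2 * q.γ0) * (Lxx / Lyx ^ 2) * (-1 + S)) +
      q.γ0 * (q.cα / (2 * q.γ0) * (Lxx / Lyx ^ 2) * (-1 + S)) ^ 2 * (Lyx ^ 2 / q.cα) =
      q.cα * Lxx ^ 2 / (4 * q.γ0 * Lyx ^ 2) * (S ^ 2 - 1) := by
    field_simp
    ring
  rw [e, h2]
  field_simp
  ring

theorem mu_mul_Psi2_le (hγ0 : 0 < q.γ0) (hα : 0 < q.cα) (hδ0 : 0 ≤ q.δ) (hδ : q.δ < 1)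
    (hxx : 0 < Lxx) (hyx : 0 < Lyx) (hμ : q.μ ≤ Lxx) : q.μ * Psi2 q Lxx Lyx ≤ 3 := by
  have h1 := Psi2_root hγ0 hα hδ hxx hyx
  have h2 := mul_le_mul_of_nonneg_right hμ (Psi2_pos hγ0 hα hδ hxx hyx).le
  have h3 : 0 ≤ q.γ0 * Psi2 q Lxx Lyx ^ 2 * (Lyx ^ 2 / q.cα) := by positivity
  linarith

/-- A sufficiently small step passes the test of APDB-yx: the linearization error of `Φ(·, y)` is
bounded by the descent lemma, and `Ψ₂` balances it against the change of `∇_yΦ`. -/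
theorem yxTest_of_small (hf : P.FunAssumptions q.μ) (hs : P.SetAssumptions) (hγ0 : 0 < q.γ0)
    (hφp : IsBregmanKernel P.X Lφ φp) (hφd : IsBregmanKernel Yh Lφ φd) (hα : 0 < q.cα)
    (hδ : q.δ < 1) (hsum : q.cα + q.δ ≤ 1) (hxx : 0 < Lxx) (hyx : 0 < Lyx)
    (hLxx : P.LipXX Yh Lxx) (hLyx : P.LipYX Yh Lyx) (hst : StateOK P Yh q s)
    (hτ : 0 < τ) (hτΨ : τ ≤ Psi2 q Lxx Lyx * √(q.γ0 / s.γ)) (hw : w ∈ P.dom Yh) :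
    yxTest P φp φd q s τ w := by
  obtain ⟨hz, -, hτp, hσp, hγ, hστ⟩ := hst
  have hγpos : 0 < s.γ := hγ0.trans_le hγ
  have hΨ := Psi2_root hγ0 hα hδ hxx hyx
  have hΨ0 := Psi2_pos hγ0 hα hδ hxx hyx
  have hsq := mul_sq_le_of_le_sqrt hγ0 hγpos hτ hτΨ
  have hτle : τ ≤ Psi2 q Lxx Lyx :=
    hτΨ.trans (mul_le_of_le_one_right hΨ0.le
      (Real.sqrt_le_one.2 ((div_le_one hγpos).2 hγ)))
  have hDp := hφp.half_sq_le_breg hw.1 hz.1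
  have hDp0 := hφp.breg_nonneg hw.1 hz.1
  have hDd0 := hφd.breg_nonneg hw.2 hz.2
  have hdesc := descent_lemma (h := fun u => P.Phi u w.snd) hs.convex_X
    (fun u hu => (hf.hasGradientAt_Phi hu w.snd).differentiableAt)
    (fun u hu v hv => hLxx v hv u hu w.snd hw.2) hz.1 hw.1
  change P.Phi w.fst w.snd - P.Phi s.z.fst w.snd -
    ⟪P.gradX s.z.fst w.snd, w.fst - s.z.fst⟫ ≤ _ at hdesc
  have hy2 := pow_le_pow_left₀ (norm_nonneg _) (hLyx _ hz.1 _ hw.1 _ hw.2) 2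
  rw [mul_pow] at hy2
  unfold yxTest
  simp only
  set Dp := breg φp w.fst s.z.fst
  set Dd := breg φd w.snd s.z.snd
  set σ := s.γ * τ with hσ
  have hσpos : 0 < σ := by positivity
  have hyterm : 1 / (2 * (q.cα / σ)) * ‖P.gradY w.fst w.snd - P.gradY s.z.fst w.snd‖ ^ 2 ≤
      σ * Lyx ^ 2 / q.cα * Dp := by
    have h1 : ‖P.gradY w.fst w.snd - P.gradY s.z.fst w.snd‖ ^ 2 ≤ Lyx ^ 2 * (2 * Dp) :=
      hy2.trans (mul_le_mul_of_nonneg_left (by linarith) (by positivity))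
    refine (mul_le_mul_of_nonneg_left h1 (by positivity)).trans_eq ?_
    field_simp
  have hcoef : Lxx + σ * Lyx ^ 2 / q.cα ≤ (1 - q.δ) / τ := by
    rw [le_div_iff₀ hτ]
    have h1 := mul_le_mul_of_nonneg_left hτle hxx.le
    have h2 := mul_le_mul_of_nonneg_right hsq (by positivity : 0 ≤ Lyx ^ 2 / q.cα)
    have e : (Lxx + σ * Lyx ^ 2 / q.cα) * τ = Lxx * τ + s.γ * τ ^ 2 * (Lyx ^ 2 / q.cα) := by
      rw [hσ]; ring
    linarith
  have hcoef' := mul_le_mul_of_nonneg_right hcoef hDp0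
  have hLam : Lxx / 2 * ‖w.fst - s.z.fst‖ ^ 2 ≤ Lxx * Dp := by
    have := mul_le_mul_of_nonneg_left hDp hxx.le
    linarith
  have hdual : q.δ / σ * Dd ≤ (1 / σ - s.σprev / σ * (q.cα / s.σprev)) * Dd := by
    refine mul_le_mul_of_nonneg_right ?_ hDd0
    have e : 1 / σ - s.σprev / σ * (q.cα / s.σprev) = (1 - q.cα) / σ := by field_simp
    rw [e]
    exact div_le_div_of_nonneg_right (by linarith) hσpos.le
  have e1 : (1 - q.δ) / τ * Dp = 1 / τ * Dp - q.δ / τ * Dp := by ring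
  rw [e1] at hcoef'
  linarith

/-- Since `Y` is a cone and `∇ₓΦ` is affine in `y`, a Lipschitz constant on a ball of positive
radius is one on all of `Y`. -/
theorem ConicProgram.LipXY.global (hf : P.FunAssumptions q.μ) {B : ℝ} (hB : 0 < B)
    (h : P.LipXY (P.YB B) Lxy) : P.LipXY P.Y Lxy := by
  intro x hx y hy y' hy'
  set t := B / (‖y‖ + ‖y'‖ + 1) with ht
  have hpos : 0 < ‖y‖ + ‖y'‖ + 1 := by positivity
  have ht0 : 0 < t := div_pos hB hpos
  have hmem : ∀ u ∈ P.Y, ‖u‖ ≤ ‖y‖ + ‖y'‖ + 1 → t • u ∈ P.YB B := by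
    intro u hu hle
    refine ⟨P.smul_mem_Y hu ht0.le, ?_⟩
    change ‖t • u‖ ≤ B
    rw [norm_smul, Real.norm_of_nonneg ht0.le]
    exact (mul_le_mul_of_nonneg_left hle ht0.le).trans_eq (div_mul_cancel₀ _ hpos.ne')
  have h1 := h x hx (t • y) (hmem y hy (by linarith [norm_nonneg y'])) (t • y')
    (hmem y' hy' (by linarith [norm_nonneg y]))
  rw [hf.gradX_sub hx, ← smul_sub, map_smul, norm_smul, norm_smul, ← hf.gradX_sub hx,
    Real.norm_of_nonneg ht0.le] at h1
  exact le_of_mul_le_mul_left (by linarith) ht0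

end SmallSteps

/-! ### The dual bound of APDB-xy -/

section DualBound

variable {n p m : ℕ} {P : ConicProgram n p m} {q : Params} {φp : Vec n → ℝ}
  {φd : DualVec p m → ℝ} {Lφ Lxx Lxy κp : ℝ} {Yh : Set (DualVec p m)}
  {trial test : IterState n p m → ℝ → PDVec n p m → Prop}
  {W : IterState n p m → PDVec n p m → ℝ} {z0 z1 : PDVec n p m} {K : ℕ}
  {z : ℕ → PDVec n p m} {τ γ : ℕ → ℝ}

theorem dualBound_le (φp : Vec n → ℝ) (φd : DualVec p m → ℝ) (γ0 : ℝ) {zs : PDVec n p m}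
    (hzs : zs ∈ P.saddle P.Y) (z1 : PDVec n p m) : P.dualBound φp φd γ0 z1 ≤
      ‖zs.snd‖ + √(2 * γ0 * breg φp zs.fst z1.fst + 2 * breg φd zs.snd z1.snd) :=
  csInf_le ⟨0, by rintro _ ⟨u, -, rfl⟩; positivity⟩ ⟨zs, hzs, rfl⟩

/-- On the bounded set `Z₀` the dual bounds are bounded, so that their supremum is not a junk
value. -/
theorem dualBound_le_dualBoundOn (hγ0 : 0 < q.γ0) (hL : 0 < Lφ) (hφp : IsBregmanKernel P.X Lφ φp)
    (hφd : IsBregmanKernel P.Y Lφ φd) (hne : (P.saddle P.Y).Nonempty)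
    (hz1 : z1 ∈ P.Z0 q Lφ z0) :
    P.dualBound φp φd q.γ0 z1 ≤ P.dualBoundOn φp φd q.γ0 (P.Z0 q Lφ z0) := by
  obtain ⟨zs, hzs⟩ := hne
  refine le_csSup ⟨‖zs.snd‖ + √(Lφ * max q.γ0 1 * (‖zs - z0‖ + P.radius q Lφ z0) ^ 2), ?_⟩
    ⟨z1, hz1, rfl⟩
  rintro _ ⟨u, hu, rfl⟩
  refine (dualBound_le φp φd q.γ0 hzs u).trans (add_le_add le_rfl (Real.sqrt_le_sqrt ?_))
  have h1 := init_le (Yh := P.Y) hγ0 hφp hφd hu.1 hzs.1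
  have h2 : ‖zs - u‖ ≤ ‖zs - z0‖ + P.radius q Lφ z0 := by
    have h3 := norm_sub_le_norm_sub_add_norm_sub zs z0 u
    rw [norm_sub_rev z0] at h3
    linarith [hu.2]
  have h3 := mul_le_mul_of_nonneg_left (pow_le_pow_left₀ (norm_nonneg _) h2 2)
    (by positivity : 0 ≤ Lφ * max q.γ0 1)
  linarith

theorem IsPotential.norm_snd_le_dualBound
    (hW : IsPotential P φp φd P.Y q κp 1 trial test W)
    (h : IsAPDB trial test q z1 K z τ γ) (hq : q.Valid) (hf : P.FunAssumptions q.μ)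
    (hs : P.SetAssumptions) (hφp : IsBregmanKernel P.X Lφ φp) (hφd : IsBregmanKernel P.Y Lφ φd)
    (hκp : 0 < κp) (hne : (P.saddle P.Y).Nonempty) (hz1 : z1 ∈ P.dom P.Y) {k : ℕ} (hk : k ≤ K) :
    ‖(z k).snd‖ ≤ P.dualBound φp φd q.γ0 z1 := by
  refine le_csInf (hne.image _) ?_
  rintro _ ⟨zs, hzs, rfl⟩
  have hzk := h.mem_dom hq hf.mu_nonneg hW.trial_mem hz1 hk
  have h1 := hW.run_le h hq hf hs subset_rfl hz1 hzs hk
  have h2 := mul_nonneg hκp.le (hφp.breg_nonneg hzs.1.1 hzk.1)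
  have h3 := hφd.half_sq_le_breg hzs.1.2 hzk.2
  have h4 : ‖zs.snd - (z k).snd‖ ≤
      √(2 * q.γ0 * breg φp zs.fst z1.fst + 2 * breg φd zs.snd z1.snd) :=
    Real.le_sqrt_of_sq_le (by linarith)
  have h5 := norm_le_norm_add_norm_sub zs.snd (z k).snd
  linarith

/-- The dual bound vanishes only at saddle points. -/
theorem mem_saddle_of_dualBound_nonpos (hf : P.FunAssumptions q.μ) (hs : P.SetAssumptions)
    (hγ0 : 0 < q.γ0) (hφp : IsBregmanKernel P.X Lφ φp) (hφd : IsBregmanKernel P.Y Lφ φd)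
    (hne : (P.saddle P.Y).Nonempty) (hz1 : z1 ∈ P.dom P.Y)
    (h : P.dualBound φp φd q.γ0 z1 ≤ 0) : z1 ∈ P.saddle P.Y := by
  rw [(hf.isClosed_saddle hs P.isClosed_Y).mem_iff_infDist_zero hne]
  by_contra hd
  have hd : 0 < Metric.infDist z1 (P.saddle P.Y) :=
    lt_of_le_of_ne Metric.infDist_nonneg (Ne.symm hd)
  have hm : 0 < min q.γ0 1 := lt_min hγ0 one_pos
  have hε : 0 < √(min q.γ0 1 * Metric.infDist z1 (P.saddle P.Y) ^ 2) :=
    Real.sqrt_pos.2 (by positivity)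
  obtain ⟨_, ⟨zs, hzs, rfl⟩, hlt⟩ := exists_lt_of_csInf_lt (hne.image _) (h.trans_lt hε)
  refine absurd hlt (not_lt.2 (le_add_of_nonneg_of_le (norm_nonneg _) (Real.sqrt_le_sqrt ?_)))
  have h1 := Metric.infDist_le_dist_of_mem hzs (x := z1)
  rw [dist_comm, dist_eq_norm] at h1
  have h2 := pow_le_pow_left₀ Metric.infDist_nonneg h1 2
  have h3 := mul_le_mul (min_le_left q.γ0 1) (hφp.half_sq_le_breg hzs.1.1 hz1.1) (by positivity)
    hγ0.le
  have h4 := mul_le_mul (min_le_right q.γ0 1) (hφd.half_sq_le_breg hzs.1.2 hz1.2) (by positivity)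
    zero_le_one
  have h5 := mul_le_mul_of_nonneg_left h2 hm.le
  rw [norm_sub_sq_prod] at h5
  linarith

/-- From a saddle point without momentum, APDB-xy does not move. -/
theorem xyTrial_eq_of_saddle (hf : P.FunAssumptions q.μ) (hs : P.SetAssumptions)
    (hφp : IsBregmanKernel P.X Lφ φp) (hφd : IsBregmanKernel P.Y Lφ φd)
    {s : IterState n p m} {t : ℝ} {w : PDVec n p m} (hz : s.z ∈ P.saddle P.Y)
    (hprev : s.zprev = s.z) (ht : 0 < t) (hγ : 0 < s.γ) (hw : xyTrial P φp φd s t w) :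
    w.fst = s.z.fst ∧ w.snd = s.z.snd := by
  obtain ⟨⟨hwx, hwxm⟩, hwy, hwym⟩ := hw
  have hmin : IsMinOn (fun x => P.Phi x s.z.snd) P.X s.z.fst := fun x hx => hz.2.2 x hx
  have e : ∀ θ : ℝ, (1 + θ) • P.gradX s.z.fst s.z.snd - θ • P.gradX s.zprev.fst s.zprev.snd =
      P.gradX s.z.fst s.z.snd := fun θ => by rw [hprev]; module
  have hx : w.fst = s.z.fst := by
    have h1 := hφp.prox_inequality hwxm hwx hz.1.1
    have h2 := inner_nonneg_of_isMinOn hs.convex_X hmin (hf.hasGradientAt_Phi hz.1.1 _)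
      hz.1.1 hwx
    rw [e, breg_self] at h1
    have h3 := hφp.half_sq_le_breg hwx hz.1.1
    have h4 := hφp.breg_nonneg hz.1.1 hwx
    have h5 : 0 < 1 / t := by positivity
    have h6 : 0 ≤ 0 - breg φp s.z.fst w.fst - breg φp w.fst s.z.fst :=
      nonneg_of_mul_nonneg_right (h2.trans h1) h5
    have h7 : ‖w.fst - s.z.fst‖ ^ 2 ≤ 0 := by linarith
    exact sub_eq_zero.1 (norm_eq_zero.1 (pow_eq_zero_iff two_ne_zero |>.1
      (le_antisymm h7 (sq_nonneg _))))
  refine ⟨hx, ?_⟩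
  have h1 := prox_inequality_snd hφd hwym hwy hz.1.2
  have h2 := P.Phi_sub s.z.fst s.z.snd w.snd
  have h2' := hz.2.1 _ hwy
  rw [breg_self, P.gradY_eq, hx] at h1
  have h3 := hφd.half_sq_le_breg hwy hz.1.2
  have h4 := hφd.breg_nonneg hz.1.2 hwy
  have h5 : 0 < 1 / (s.γ * t) := by positivity
  have h6 : 0 ≤ 0 - breg φd s.z.snd w.snd - breg φd w.snd s.z.snd :=
    nonneg_of_mul_nonneg_right (by linarith) h5
  have h7 : ‖w.snd - s.z.snd‖ ^ 2 ≤ 0 := by linarith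
  exact sub_eq_zero.1 (norm_eq_zero.1 (pow_eq_zero_iff two_ne_zero |>.1
    (le_antisymm h7 (sq_nonneg _))))

/-- Small steps pass the test along every run of APDB-xy that starts in `Z₀`.  If the dual bound is
positive, `L_xy` is a Lipschitz constant on all of `Y`, so candidates need not be bounded a priori;
if it is zero, the run starts at a saddle point and stays there. -/
theorem xy_small_steps_pass (hs : P.SetAssumptions) (hf : P.FunAssumptions q.μ) (hq : q.Valid)
    (hL : 0 < Lφ) (hφp : IsBregmanKernel P.X Lφ φp) (hφd : IsBregmanKernel P.Y Lφ φd)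
    (hφμ : 0 < q.μ → φp = fun x => 1 / 2 * ‖x‖ ^ 2) (hα : 0 < q.cα) (hβ : 0 < q.cβ)
    (hδ : 0 ≤ q.δ) (hsum : q.cα + q.cβ + q.δ < 1) (hne : (P.saddle P.Y).Nonempty)
    (hxx : 0 < Lxx) (hxy : 0 < Lxy)
    (hLxx : P.LipXX (P.YB (P.dualBoundOn φp φd q.γ0 (P.Z0 q Lφ z0))) Lxx)
    (hLxy : P.LipXY (P.YB (P.dualBoundOn φp φd q.γ0 (P.Z0 q Lφ z0))) Lxy)
    (hz1 : z1 ∈ P.Z0 q Lφ z0) {k : ℕ}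
    (h : IsAPDB (xyTrial P φp φd) (xyTest P φp φd q) q z1 k z τ γ) {t : ℝ} (ht : 0 < t)
    (htΨ : t ≤ Psi1 q Lxx Lxy * √(q.γ0 / γ k)) {w : PDVec n p m}
    (hw : xyTrial P φp φd (stateAt q z τ γ k) t w) :
    xyTest P φp φd q (stateAt q z τ γ k) t w := by
  have hγ0 := hq.γ0_pos
  have hW := isPotential_xy hs hf hγ0 hφp hφd hφμ hα hβ hδ (by linarith)
  have hκp : 0 < q.γ0 * (1 - (q.cα + q.cβ)) := mul_pos hγ0 (by linarith)
  have hok := (h.stateOK hq hf.mu_nonneg hW.trial_mem hz1.1 le_rfl).1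
  have hdb := dualBound_le_dualBoundOn hγ0 hL hφp hφd hne hz1
  have hyk : (z k).snd ∈ P.YB (P.dualBoundOn φp φd q.γ0 (P.Z0 q Lφ z0)) :=
    ⟨(h.mem_dom hq hf.mu_nonneg hW.trial_mem hz1.1 le_rfl).2,
      (hW.norm_snd_le_dualBound h hq hf hs hφp hφd hκp hne hz1.1 le_rfl).trans hdb⟩
  have hwd := hW.trial_mem hw
  refine xyTest_of_small hγ0 hφp hφd hα hβ hsum hxx hxy hok ht (by rwa [stateAt_γ]) hwd ?_ ?_
  · exact hLxx _ hok.z_mem.1 _ hwd.1 _ (by rwa [stateAt_z])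
  · rcases lt_or_ge 0 (P.dualBoundOn φp φd q.γ0 (P.Z0 q Lφ z0)) with hB | hB
    · exact hLxy.global hf hB _ hwd.1 _ hok.z_mem.2 _ hwd.2
    · have hsad := mem_saddle_of_dualBound_nonpos hf hs hγ0 hφp hφd hne hz1.1 (hdb.trans hB)
      have hstay : ∀ j ≤ k, z j = z1 := fun j hj => by
        have := hW.norm_sub_saddle_le h hq hf hs subset_rfl hL hφp hφd hκp one_pos hz1.1 hsad hj
        rw [sub_self, norm_zero, mul_zero] at this
        exact sub_eq_zero.1 (norm_le_zero_iff.1 this)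
      have hprev : (stateAt q z τ γ k).zprev = (stateAt q z τ γ k).z := by
        rw [stateAt_z]
        cases k with
        | zero => rfl
        | succ k => exact (hstay k k.le_succ).trans (hstay (k + 1) le_rfl).symm
      have hzsad : (stateAt q z τ γ k).z ∈ P.saddle P.Y := by
        rw [stateAt_z, hstay k le_rfl]
        exact hsad
      have e := (xyTrial_eq_of_saddle hf hs hφp hφd hzsad hprev ht
        (hγ0.trans_le hok.γ0_le) hw).2
      rw [e]
      simp

/-! ### Compactness of the growth sets and saddle points of the restricted problem -/

theorem isCompact_Z0 (hs : P.SetAssumptions) : IsCompact (P.Z0 q Lφ z0) := by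
  have e : P.Z0 q Lφ z0 = P.dom P.Y ∩ Metric.closedBall z0 (P.radius q Lφ z0) := by
    ext u
    simp [ConicProgram.Z0, dist_eq_norm]
  rw [e]
  exact (isCompact_closedBall _ _).inter_left (P.isClosed_dom hs P.isClosed_Y)

theorem isCompact_dom_YB (hs : P.SetAssumptions) (B : ℝ) : IsCompact (P.dom (P.YB B)) := by
  obtain ⟨C, hC⟩ := hs.compact_X.exists_bound_of_continuousOn (f := fun x => x) continuousOn_id
  refine (isCompact_closedBall (0 : PDVec n p m) (|C| + |B|)).of_isClosed_subset
    (P.isClosed_dom hs (P.isClosed_YB B)) fun u hu => ?_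
  have h1 : ‖u.fst‖ ≤ |C| := (hC _ hu.1).trans (le_abs_self C)
  have h2 : ‖u.snd‖ ≤ |B| := le_trans hu.2.2 (le_abs_self B)
  rw [mem_closedBall_zero_iff]
  refine abs_le_of_sq_le_sq' ?_ (by positivity) |>.2
  rw [norm_sq_prod]
  nlinarith [norm_nonneg u.fst, norm_nonneg u.snd, abs_nonneg C, abs_nonneg B]

/-- A dual optimal solution, paired with the primal part of any saddle point, is a saddle point;
it remains one when the dual domain is restricted to a ball that contains it. -/
theorem saddle_YB_nonempty (hs : P.SetAssumptions) (hf : P.FunAssumptions q.μ)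
    (hne : (P.saddle P.Y).Nonempty) {y : DualVec p m} (hy : y ∈ P.dualOpt) {B : ℝ}
    (hB : ‖y‖ ≤ B) : (P.saddle (P.YB B)).Nonempty := by
  obtain ⟨zs, hzs⟩ := hne
  have hbdd : ∀ u : DualVec p m, BddBelow ((fun x => P.Phi x u) '' P.X) := fun u =>
    hs.compact_X.bddBelow_image (hf.continuousOn_Phi u)
  have h1 : P.Phi zs.fst zs.snd ≤ P.dualFun zs.snd :=
    le_csInf ⟨_, zs.fst, hzs.1.1, rfl⟩ (by rintro _ ⟨x, hx, rfl⟩; exact hzs.2.2 x hx)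
  have h2 := h1.trans (hy.2 _ hzs.1.2)
  have h3 : ∀ x ∈ P.X, P.dualFun y ≤ P.Phi x y := fun x hx => csInf_le (hbdd y) ⟨x, hx, rfl⟩
  have h4 := hzs.2.1 y hy.1
  refine ⟨WithLp.toLp 2 (zs.fst, y), ⟨hzs.1.1, hy.1, hB⟩, fun y' hy' => ?_, fun x hx => ?_⟩
  · exact (hzs.2.1 y' hy'.1).trans (h2.trans (h3 _ hzs.1.1))
  · exact h4.trans (h2.trans (h3 x hx))

end DualBound

end RAPDB

theorem mainTheorem1 {n p m : ℕ} (P : RAPDB.ConicProgram n p m) (q : RAPDB.Params)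
    (φp : RAPDB.Vec n → ℝ) (φd : RAPDB.DualVec p m → ℝ) (Lφ ξ : ℝ)
    (hsets : P.SetAssumptions) (hfun : P.FunAssumptions q.μ)
    (hsaddle : (P.saddle P.Y).Nonempty)
    (hLφ : 0 < Lφ) (hφp : RAPDB.IsBregmanKernel P.X Lφ φp)
    (hφd : RAPDB.IsBregmanKernel P.Y Lφ φd)
    (hφμ : 0 < q.μ → φp = fun x => 1 / 2 * ‖x‖ ^ 2)
    (hq : q.Valid) (hξ : 0 < ξ) :
    -- rAPDB-xy
    (0 < q.cα → 0 < q.cβ → 0 ≤ q.δ → q.cα + q.cβ + q.δ < 1 →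
      P.MetricSubregular P.Y →
      ∀ z0 ∈ P.dom P.Y, ∀ Lxx > 0, ∀ Lxy > 0, q.μ ≤ Lxx →
      P.LipXX (P.YB (P.dualBoundOn φp φd q.γ0 (P.Z0 q Lφ z0))) Lxx →
      P.LipXY (P.YB (P.dualBoundOn φp φd q.γ0 (P.Z0 q Lφ z0))) Lxy →
      (∃ ρ > 0, P.QuadGrowth φp φd P.Y ξ (P.Z0 q Lφ z0) ρ) ∧
      ∀ ρ > 0, P.QuadGrowth φp φd P.Y ξ (P.Z0 q Lφ z0) ρ →
      ∀ K : ℕ, RAPDB.PeriodLargeEnough q Lφ (RAPDB.tauHat q (RAPDB.Psi1 q Lxx Lxy))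
        (RAPDB.c2 q Lφ) ξ ρ K →
      (∃ Z, RAPDB.IsRAPDBxy P φp φd q z0 K Z) ∧
      ∀ Z, RAPDB.IsRAPDBxy P φp φd q z0 K Z →
        (∀ t, ‖Z t - z0‖ ≤ P.radius q Lφ z0) ∧
        (∀ t : ℕ, Metric.infDist (Z t) (P.saddle P.Y) ≤
          Real.exp (-(t : ℝ)) * Metric.infDist z0 (P.saddle P.Y)) ∧
        ∃ zs ∈ P.saddle P.Y, Filter.Tendsto Z Filter.atTop (nhds zs)) ∧
    -- rAPDB-yx
    (0 < q.cα → q.cα < 1 → q.cβ = 0 → 0 ≤ q.δ → q.cα + q.δ ≤ 1 →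
      ∀ Bbar > 0, (∃ y ∈ P.dualOpt, ‖y‖ ≤ Bbar) → ∀ B > Bbar,
      P.MetricSubregular (P.YB B) →
      ∀ z0 ∈ P.dom (P.YB B), ∀ Lxx > 0, ∀ Lyx > 0, q.μ ≤ Lxx →
      P.LipXX (P.YB B) Lxx → P.LipYX (P.YB B) Lyx →
      (∃ ρ > 0, P.QuadGrowth φp φd (P.YB B) ξ (P.dom (P.YB B)) ρ) ∧
      ∀ ρ > 0, P.QuadGrowth φp φd (P.YB B) ξ (P.dom (P.YB B)) ρ →
      ∀ K : ℕ, RAPDB.PeriodLargeEnough q Lφ (RAPDB.tauHat q (RAPDB.Psi2 q Lxx Lyx))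
        (RAPDB.c2hat q Lφ) ξ ρ K →
      (∃ Z, RAPDB.IsRAPDByx P φp φd (P.YB B) q z0 K Z) ∧
      ∀ Z, RAPDB.IsRAPDByx P φp φd (P.YB B) q z0 K Z →
        (∀ t : ℕ, Metric.infDist (Z t) (P.saddle (P.YB B)) ≤
          Real.exp (-(t : ℝ)) * Metric.infDist z0 (P.saddle (P.YB B))) ∧
        ∃ zs ∈ P.saddle (P.YB B), Filter.Tendsto Z Filter.atTop (nhds zs)) := by
  have hγ0 := hq.γ0_pos
  constructor
  · intro hα hβ hδ hsum hms z0 hz0 Lxx hxx Lxy hxy hμxx hLxx hLxy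
    refine ⟨hms.exists_quadGrowth hfun hsets subset_rfl P.isClosed_Y hξ hLφ hφp hφd
      (RAPDB.isCompact_Z0 hsets) (fun u hu => hu.1), fun ρ hρ hqg K hK => ?_⟩
    have hW := RAPDB.isPotential_xy hsets hfun hγ0 hφp hφd hφμ hα hβ hδ (by linarith)
    exact hW.restart_converges hq hfun hsets P.convex_Y P.isClosed_Y subset_rfl hLφ hφp hφd
      (mul_pos hγ0 (by linarith)) one_pos hz0 hξ hsaddle
      (RAPDB.Psi1_pos hγ0 hα hβ hsum hxx hxy)
      (RAPDB.mu_mul_Psi1_le hγ0 hα hβ hδ hsum hxx hxy hμxx) hρ rfl rfl hK hqg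
      fun z1 hz1 hR k z τ γ h t ht htΨ w hw =>
        RAPDB.xy_small_steps_pass hsets hfun hq hLφ hφp hφd hφμ hα hβ hδ hsum hsaddle hxx hxy
          hLxx hLxy ⟨hz1, hR⟩ h ht htΨ hw
  · intro hα hα1 _ hδ hsum Bbar _ hy B hB hms z0 hz0 Lxx hxx Lyx hyx hμxx hLxx hLyx
    obtain ⟨y, hy, hyB⟩ := hy
    have hsub : P.YB B ⊆ P.Y := fun u hu => hu.1
    have hφd' := hφd.mono (P.convex_YB B) hsub
    have hδ1 : q.δ < 1 := by linarith
    refine ⟨hms.exists_quadGrowth hfun hsets hsub (P.isClosed_YB B) hξ hLφ hφp hφd'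
      (RAPDB.isCompact_dom_YB hsets B) subset_rfl, fun ρ hρ hqg K hK => ?_⟩
    have hW := RAPDB.isPotential_yx hsets hfun hγ0 hφp hφd' hsub (P.isClosed_YB B) hφμ hα hδ
    have hmain := hW.restart_converges hq hfun hsets (P.convex_YB B) (P.isClosed_YB B) hsub hLφ
      hφp hφd' hγ0 (by linarith) hz0 hξ
      (RAPDB.saddle_YB_nonempty hsets hfun hsaddle hy (hyB.trans hB.le))
      (RAPDB.Psi2_pos hγ0 hα hδ1 hxx hyx)
      (RAPDB.mu_mul_Psi2_le hγ0 hα hδ hδ1 hxx hyx hμxx) hρ rfl rfl hK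
      (fun z hz => hqg z hz.1)
      fun z1 hz1 _ k z τ γ h t ht htΨ w hw =>
        RAPDB.yxTest_of_small hfun hsets hγ0 hφp hφd' hα hδ1 hsum hxx hyx hLxx hLyx
          (h.stateOK hq hfun.mu_nonneg hW.trial_mem hz1 le_rfl).1 ht
          (by rwa [RAPDB.stateAt_γ]) (hW.trial_mem hw)
    exact ⟨hmain.1, fun Z hZ => (hmain.2 Z hZ).2⟩
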